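/- Let $d\ge 1$ be an integer, $\alpha_0\in(0,1]$, and let $K(\mathbf t,\mathbf s)=K(\mathbf t-\mathbf s)$ be a $\sigma(\alpha_0)$-regular stationary kernel on $[0,1)^d$. This means that for some integer $b\ge2$ there are positive definite, non-negative, bounded continuous functions $K_j$ ($j\ge 0$) on $[-1,1]^d$ with $K(\mathbf t)=\sum_{j\ge0}K_j(\mathbf t)$ for all $\mathbf t\in(-1,1)^d\setminus\{\mathbf 0\}$ such that (H1) there is $j_0\ge 0$ such that $\mathrm{supp}(K_j)\subset \bar B(\mathbf 0,b^{-j})$ (closed Euclidean ball) for all $j\ge j_0$; (H2) $\limsup_{j\to\infty}K_j(\mathbf 0)=\log b$; (H3) $\displaystyle\sup_{j\ge0}\ \sup_{0<|\mathbf t|\le b^{-j}}\frac{|K_j(\mathbf t)-K_j(\mathbf 0)|}{b^{2j\alpha_0}|\mathbf t|^{2\alpha_0}}<\infty$. Fix $b$ and such a decomposition $(K_j)$, let $\gamma\in(0,\sqrt{2d})$, and let $\psi_0,\psi_1,\dots$ be independent (jointly measurable) centered Gaussian processes on $[0,1)^d$, defined on one probability space, where $\psi_j$ has covariance $K_j(\mathbf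 t-\mathbf s)$. Put $$\mu_m(\mathrm d\mathbf t)=\Big[\prod_{j=0}^m e^{\gamma\psi_j(\mathbf t)-\frac{\gamma^2}{2}\mathbb E[\psi_j(\mathbf t)^2]}\Big]\mathrm d\mathbf t .$$ Then almost surely $\mu_m$ converges weakly, as $m\to\infty$, to a finite random measure $\mathrm{GMC}_K^\gamma$ (on $[0,1]^d$). This measure is non-degenerate, that is, $\mathbb P(\mathrm{GMC}_K^\gamma\neq0)>0$. Moreover, almost surely, it is non-zero and has polynomial Fourier decay, that is, $|\widehat{\mathrm{GMC}_K^\gamma}(\mathbf x)|^2=O(|\mathbf x|^{-D})$ as $|\mathbf x|\to\infty$ for some $D>0$, and $$\dim_F(\mathrm{GMC}_K^\gamma)\ \ge\ \min\{2\alpha_0,\,D_{\gamma,d}\}>0 .$$ Here $\widehat\nu(\mathbf x)=\int e^{-2\pi i\mathbf x\cdot\mathbf t}\,\nu(\mathrm d\mathbf t)$ for $\mathbf x\in\mathbb R^d$, $$\dim_F(\nu)=\sup\{D\in[0,d):|\widehat\nu(\mathbf x)|^2=O(|\mathbf x|^{-D})\text{ as }|\mathbf x|\to\infty\},$$ and $D_{\gamma,d}=d-\gamma^2$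 if $0<\gamma<\sqrt{2d}/2$, while $D_{\gamma,d}=(\sqrt{2d}-\gamma)^2$ if $\sqrt{2d}/2\le\gamma<\sqrt{2d}$. -/

import Mathlib

open MeasureTheory ProbabilityTheory Filter Topology
open scoped NNReal ENNReal

noncomputable section

/-- The half-open unit cube `[0,1)^d` in Euclidean space. -/
def halfOpenCube (d : ℕ) : Set (EuclideanSpace ℝ (Fin d)) :=
  {t | ∀ i, t i ∈ Set.Ico (0 : ℝ) 1}

/-- The closed unit cube `[0,1]^d`. -/
def closedCube (d : ℕ) : Set (EuclideanSpace ℝ (Fin d)) :=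
  {t | ∀ i, t i ∈ Set.Icc (0 : ℝ) 1}

/-- The set `[-1,1]^d` of differences of points of `[0,1]^d`. -/
def differenceCube (d : ℕ) : Set (EuclideanSpace ℝ (Fin d)) :=
  {t | ∀ i, t i ∈ Set.Icc (-1 : ℝ) 1}

/-- The open cube `(-1,1)^d`. -/
def openDifferenceCube (d : ℕ) : Set (EuclideanSpace ℝ (Fin d)) :=
  {t | ∀ i, t i ∈ Set.Ioo (-1 : ℝ) 1}

/-- Positive definiteness on `[-1,1]^d` of a function `k` (in the sense of covariance kernels):
all the matrices `(k (t_p - t_q))_{p,q}` with points `t_p` in `[0,1]^d` are symmetric and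
positive semidefinite. -/
def IsPosDefOnDifferenceCube {d : ℕ} (k : EuclideanSpace ℝ (Fin d) → ℝ) : Prop :=
  ∀ (n : ℕ) (t : Fin n → EuclideanSpace ℝ (Fin d)), (∀ p, t p ∈ closedCube d) →
    (Matrix.of fun p q : Fin n => k (t p - t q)).PosSemidef

/-- `Kj` is a decomposition `K = ∑ j, Kj j` on `(-1,1)^d \ {0}` of the stationary kernel `K`
that is `σ^b(α₀)`-admissible. The values of the `Kj j` outside `[-1,1]^d`, and those of `K` outside
`(-1,1)^d \ {0}`, play no role. -/
structure IsSigmaAdmissible {d : ℕ} (b : ℕ) (α₀ : ℝ) (K : EuclideanSpace ℝ (Fin d) → ℝ)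
    (Kj : ℕ → EuclideanSpace ℝ (Fin d) → ℝ) : Prop where
  hasSum : ∀ t ∈ openDifferenceCube d, t ≠ 0 → HasSum (fun j => Kj j t) (K t)
  posDef : ∀ j, IsPosDefOnDifferenceCube (Kj j)
  nonneg : ∀ j, ∀ t ∈ differenceCube d, 0 ≤ Kj j t
  bounded : ∀ j, ∃ C : ℝ, ∀ t ∈ differenceCube d, Kj j t ≤ C
  continuousOn : ∀ j, ContinuousOn (Kj j) (differenceCube d)
  /-- Shrinking supports: eventually `supp (Kj j)` lies in the closed ball of radius `b⁻ʲ`. -/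
  support : ∃ j₀ : ℕ, ∀ j ≥ j₀,
    closure {t | t ∈ differenceCube d ∧ Kj j t ≠ 0} ⊆ Metric.closedBall 0 (((b : ℝ) ^ j)⁻¹)
  /-- The limit superior is taken in the extended reals. -/
  limsup_zero : limsup (fun j => ((Kj j 0 : ℝ) : EReal)) atTop = ((Real.log b : ℝ) : EReal)
  /-- Rescaled uniform Hölder regularity of exponent `2 α₀` at the origin only. -/
  holder_zero : ∃ C : ℝ, ∀ (j : ℕ) (t : EuclideanSpace ℝ (Fin d)),
    0 < ‖t‖ → ‖t‖ ≤ ((b : ℝ) ^ j)⁻¹ →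
      |Kj j t - Kj j 0| / ((b : ℝ) ^ (2 * (j : ℝ) * α₀) * ‖t‖ ^ (2 * α₀)) ≤ C

/-- `ψ 0, ψ 1, …` are independent measurable centered Gaussian processes on `[0,1)^d`, and `ψ j`
has covariance kernel `(s, t) ↦ Kj j (s - t)`. -/
structure IsGaussianDecomposition {d : ℕ} {Ω : Type*} [MeasurableSpace Ω] (P : Measure Ω)
    (Kj : ℕ → EuclideanSpace ℝ (Fin d) → ℝ) (ψ : ℕ → halfOpenCube d → Ω → ℝ) : Prop where
  measurable : ∀ j, Measurable fun p : halfOpenCube d × Ω => ψ j p.1 p.2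
  gaussian : ∀ j, IsGaussianProcess (ψ j) P
  centered : ∀ j t, ∫ ω, ψ j t ω ∂P = 0
  covariance_eq : ∀ j s t, covariance (ψ j s) (ψ j t) P = Kj j (s.1 - t.1)
  /-- The processes, as random elements of `ℝ^([0,1)^d)`, are jointly independent. -/
  indep : iIndepFun (fun (j : ℕ) (ω : Ω) (t : halfOpenCube d) => ψ j t ω) P

/-- The exponential process `P_{γ,j}(t) = exp (γ ψ_j(t) - γ² / 2 * E[ψ_j(t)²])`. -/
def expProcess {d : ℕ} {Ω : Type*} [MeasurableSpace Ω] (P : Measure Ω)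
    (ψ : ℕ → halfOpenCube d → Ω → ℝ) (γ : ℝ) (j : ℕ) (t : halfOpenCube d) (ω : Ω) : ℝ :=
  Real.exp (γ * ψ j t ω - γ ^ 2 / 2 * ∫ ω', ψ j t ω' ^ 2 ∂P)

/-- The approximating random measure `μ_m(dt) = ∏_{j=0}^m P_{γ,j}(t) dt`, seen as a measure on
`ℝ^d` that is carried by `[0,1)^d`. -/
def approxGMC {d : ℕ} {Ω : Type*} [MeasurableSpace Ω] (P : Measure Ω)
    (ψ : ℕ → halfOpenCube d → Ω → ℝ) (γ : ℝ) (m : ℕ) (ω : Ω) :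
    Measure (EuclideanSpace ℝ (Fin d)) :=
  ((Measure.comap Subtype.val volume).withDensity fun t : halfOpenCube d =>
    ENNReal.ofReal (∏ j ∈ Finset.range (m + 1), expProcess P ψ γ j t ω)).map Subtype.val

/-- `M` is the Gaussian multiplicative chaos measure: a random finite measure which is almost
surely the weak limit of the approximating measures. -/
structure IsGMC {d : ℕ} {Ω : Type*} [MeasurableSpace Ω] (P : Measure Ω)
    (ψ : ℕ → halfOpenCube d → Ω → ℝ) (γ : ℝ)
    (M : Ω → Measure (EuclideanSpace ℝ (Fin d))) : Prop where
  measurable : Measurable M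
  finite : ∀ᵐ ω ∂P, IsFiniteMeasure (M ω)
  tendsto : ∀ᵐ ω ∂P, ∀ f : BoundedContinuousFunction (EuclideanSpace ℝ (Fin d)) ℝ≥0,
    Tendsto (fun m => ∫⁻ t, (f t : ℝ≥0∞) ∂(approxGMC P ψ γ m ω)) atTop
      (𝓝 (∫⁻ t, (f t : ℝ≥0∞) ∂(M ω)))

/-- The Fourier transform `x ↦ ∫ exp (-2πi x·t) ν(dt)` of a measure. -/
def measureFourier {d : ℕ} (ν : Measure (EuclideanSpace ℝ (Fin d)))
    (x : EuclideanSpace ℝ (Fin d)) : ℂ :=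
  ∫ t, Complex.exp (-2 * Real.pi * Complex.I * ((inner ℝ x t : ℝ) : ℂ)) ∂ν

/-- `|ν̂(x)|² = O(|x|^{-D})` as `|x| → ∞`. -/
def HasFourierDecay {d : ℕ} (ν : Measure (EuclideanSpace ℝ (Fin d))) (D : ℝ) : Prop :=
  (fun x => ‖measureFourier ν x‖ ^ 2) =O[Bornology.cobounded (EuclideanSpace ℝ (Fin d))]
    fun x => ‖x‖ ^ (-D)

/-- A nonzero measure has polynomial Fourier decay if `|ν̂(x)|² = O(|x|^{-D})` for some `D > 0`. -/
def HasPolynomialFourierDecay {d : ℕ} (ν : Measure (EuclideanSpace ℝ (Fin d))) : Prop :=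
  ν ≠ 0 ∧ ∃ D : ℝ, 0 < D ∧ HasFourierDecay ν D

/-- The Fourier dimension `sup {D ∈ [0,d) : |ν̂(x)|² = O(|x|^{-D})}`. For a finite measure and
`d ≥ 1` the set contains `0` and is bounded by `d`. -/
def fourierDim {d : ℕ} (ν : Measure (EuclideanSpace ℝ (Fin d))) : ℝ :=
  sSup {D : ℝ | 0 ≤ D ∧ D < d ∧ HasFourierDecay ν D}

/-- The exponent `D_{γ,d}`, meant for `0 < γ < √(2d)`. -/
def gmcExponent (γ : ℝ) (d : ℕ) : ℝ :=
  if γ < √(2 * d) / 2 then d - γ ^ 2 else (√(2 * d) - γ) ^ 2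

end

/-! ### Smoothness and convexity of powers of `ℓ^q` norms -/

/-! Let D_m be the product of the first m exponential factors and E_m the factor of level m. The
integral of a test function g against D_m telescopes over the increments D_{m+1} − D_m = D_m (E_m −
1), and everything rests on one moment bound for a single level, with an exponent 1 < p ≤ 2.

Cut the cube into b^{md} cells of side b^{-m} and sort them into 2^d parity classes. By (H1), for m
large, ψ_m is uncorrelated between distinct cells of one class, so their contributions behave like
martingale differences and their p-th moments add up to a constant. On one cell, D_m is its value at
the corner times a factor whose moments are bounded uniformly in m, by (H3). By (H2), E[D_m^p] is at
most about b^{mγ²(p²−p)/2}. Level m therefore contributes about b^{-mβ} with β = d(p−1) −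
γ²(p²−p)/2, and maximising β/p over (1,2] gives half of `gmcExponent` (`exists_moment_exponent`).

A plane wave of frequency of size 1/η changes sign under a translation of length of order η.
Comparing the field with its translate gains a factor (η b^m)^δ in each cell, for every 0 ≤ δ ≤ α₀
(`eLpNorm_integral_halfOpenBox_le`). The levels remain summable as long as δ < β/p, and the total is
of order η^δ. This is where the minimum of 2α₀ and D_{γ,d} comes from.

All frequencies have to be handled simultaneously. The integrals against the N ≈ b^{2dn} waves of a
grid at frequency scale bⁿ are treated as one vector in ℓ^{2k}. The p-th power of that norm
satisfies a smoothness inequality whose constant depends on k but not on N (`powNorm_add_le`), so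
the decoupling over cells (`integral_powNorm_sum_le`, `integral_powNorm_increment_le`) works for the
whole vector, and the final loss is only N^{p/(2k)}, negligible for large k. Summing expectations
gives almost sure decay on the grid (`ae_bound_integral_antiperiodic`), and Lipschitz dependence on
the frequency fills the gaps (`hasFourierDecay_of_tendsto`).

The same level bound without oscillation makes the increments summable in L¹. Countably many plane
waves, compactness and Fourier uniqueness then produce the weak limit (`exists_isGMC`). The total
mass has mean one at every level, so its limit is not almost surely zero. Up to null sets, its
vanishing does not depend on any finite number of levels (`ae_tendsto_totalMass_zero_iff`), and
Kolmogorov's zero-one law makes the limit almost surely non-zero. -/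

lemma even_odd_part_bounds (s : ℝ) (hs : |s| ≤ 1) (n : ℕ) :
    ((1 + s) ^ n + (1 - s) ^ n) / 2 ≤ 1 + 2 ^ n * s ^ 2 ∧
    |((1 + s) ^ n + (1 - s) ^ n) / 2| ≤ 2 ^ n ∧
    |((1 + s) ^ n - (1 - s) ^ n) / 2| ≤ 2 ^ n * |s| := by
  induction n with
  | zero => simp; positivity
  | succ n ih =>
    obtain ⟨h1, h2, h3⟩ := ih
    set e := ((1 + s) ^ n + (1 - s) ^ n) / 2 with he
    set o := ((1 + s) ^ n - (1 - s) ^ n) / 2 with ho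
    -- The even and odd parts of (1 + s)^n feed each other in this recursion, so the three bounds
    -- have to be carried together.
    have e1 : ((1 + s) ^ (n + 1) + (1 - s) ^ (n + 1)) / 2 = e + s * o := by
      rw [he, ho]; ring
    have o1 : ((1 + s) ^ (n + 1) - (1 - s) ^ (n + 1)) / 2 = o + s * e := by
      rw [he, ho]; ring
    rw [e1, o1]
    have hso : |s * o| ≤ 2 ^ n * s ^ 2 := by
      rw [abs_mul, ← sq_abs s]
      nlinarith [abs_nonneg s]
    have hse : |s * e| ≤ 2 ^ n * |s| := by
      rw [abs_mul]
      nlinarith [abs_nonneg s]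
    have hs2 : s ^ 2 ≤ 1 := by rw [← sq_abs]; nlinarith [abs_nonneg s]
    have hp : (0:ℝ) < 2 ^ n := by positivity
    refine ⟨?_, ?_, ?_⟩
    · have := le_abs_self (s * o)
      rw [pow_succ]; nlinarith
    · have := abs_add_le e (s * o)
      rw [pow_succ]; nlinarith
    · have := abs_add_le o (s * e)
      rw [pow_succ]; nlinarith

/-- For |y| ≤ |x| one scales to x = 1: the even part of (1 + s)^{2k} has no linear term, and
Bernoulli's inequality absorbs the quadratic one. For |y| > |x| the bound (x ± y)² ≤ 2x² + 2y² is
already enough, since 4^k ≥ 4. -/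
lemma two_point_inequality (k : ℕ) (hk : 1 ≤ k) (x y : ℝ) :
    ((x + y) ^ (2 * k) + (x - y) ^ (2 * k)) / 2 ≤ (x ^ 2 + 4 ^ k * y ^ 2) ^ k := by
  have h4 : (4:ℝ) ≤ 4 ^ k := by
    calc (4:ℝ) = 4 ^ 1 := by norm_num
      _ ≤ 4 ^ k := pow_le_pow_right₀ (by norm_num) hk
  rcases le_or_gt |y| |x| with h | h
  · rcases eq_or_ne x 0 with rfl | hx
    · have : y = 0 := by simpa using h
      subst this
      simp [pow_mul]
    · have hs : |y / x| ≤ 1 := by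
        rw [abs_div]; exact div_le_one_of_le₀ h (abs_nonneg _)
      have := (even_odd_part_bounds (y / x) hs (2 * k)).1
      have hb : 1 + (k:ℝ) * (4 ^ k * (y / x) ^ 2) ≤ (1 + 4 ^ k * (y / x) ^ 2) ^ k :=
        one_add_mul_le_pow (by have : 0 ≤ 4 ^ k * (y / x) ^ 2 := by positivity
                               linarith) k
      have hk' : (1:ℝ) ≤ k := by exact_mod_cast hk
      have h0 : 0 ≤ 4 ^ k * (y / x) ^ 2 := by positivity
      have h2 : ((1 + y / x) ^ (2 * k) + (1 - y / x) ^ (2 * k)) / 2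
          ≤ (1 + 4 ^ k * (y / x) ^ 2) ^ k := by
        refine this.trans (le_trans ?_ hb)
        rw [pow_mul]; norm_num; nlinarith
      have e1 : x + y = x * (1 + y / x) := by field_simp
      have e2 : x - y = x * (1 - y / x) := by field_simp
      have e3 : x ^ 2 + 4 ^ k * y ^ 2 = x ^ 2 * (1 + 4 ^ k * (y / x) ^ 2) := by field_simp
      rw [e1, e2, e3, mul_pow, mul_pow, mul_pow, ← pow_mul]
      have hx2 : 0 ≤ x ^ (2 * k) := by rw [pow_mul]; positivity
      nlinarith
  · have hy : x ^ 2 ≤ y ^ 2 := sq_le_sq.mpr h.le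
    have a1 : (x + y) ^ (2 * k) ≤ (x ^ 2 + 4 ^ k * y ^ 2) ^ k := by
      rw [pow_mul]
      refine pow_le_pow_left₀ (by positivity) ?_ k
      nlinarith [sq_nonneg (x - y), sq_nonneg y]
    have a2 : (x - y) ^ (2 * k) ≤ (x ^ 2 + 4 ^ k * y ^ 2) ^ k := by
      rw [pow_mul]
      refine pow_le_pow_left₀ (by positivity) ?_ k
      nlinarith [sq_nonneg (x + y), sq_nonneg y]
    linarith

section PowNorm

variable {ι : Type*} [Fintype ι]

/-- The `p`-th power of the `ℓ^{2k}` norm of a finite real vector. -/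
noncomputable def powNorm (k : ℕ) (p : ℝ) (x : ι → ℝ) : ℝ :=
  (∑ i, x i ^ (2 * k)) ^ (p / (2 * k))

/-- The gradient of `powNorm`. -/
noncomputable def powNormGrad (k : ℕ) (p : ℝ) (x : ι → ℝ) (i : ι) : ℝ :=
  p * (∑ i, x i ^ (2 * k)) ^ (p / (2 * k) - 1) * x i ^ (2 * k - 1)

lemma sum_even_pow_nonneg (k : ℕ) (x : ι → ℝ) : 0 ≤ ∑ i, x i ^ (2 * k) :=
  Finset.sum_nonneg fun i _ => by rw [pow_mul]; positivity

lemma powNorm_nonneg (k : ℕ) (p : ℝ) (x : ι → ℝ) : 0 ≤ powNorm k p x :=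
  Real.rpow_nonneg (sum_even_pow_nonneg k x) _

lemma powNorm_zero (k : ℕ) (hk : 1 ≤ k) {p : ℝ} (hp : 0 < p) : powNorm k p (0 : ι → ℝ) = 0 := by
  have hk' : (0:ℝ) < k := by exact_mod_cast hk
  unfold powNorm
  have : ∑ i : ι, (0 : ι → ℝ) i ^ (2 * k) = 0 := by
    refine Finset.sum_eq_zero fun i _ => ?_
    simp; omega
  rw [this, Real.zero_rpow (by positivity)]

/-- Uniform smoothness of power type p for ℓ^{2k}: concavity of t^{p/(2k)}, the scalar inequality in
each coordinate, Minkowski in ℓ^k for the squares, and subadditivity of t^{p/2}. The constant does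
not involve the dimension, which is what allows a whole grid of frequencies as coordinates. -/
lemma powNorm_add_add_powNorm_sub_le (k : ℕ) (hk : 1 ≤ k) {p : ℝ} (hp : 0 < p) (hp2 : p ≤ 2)
    (x y : ι → ℝ) :
    powNorm k p (x + y) + powNorm k p (x - y) ≤ 2 * powNorm k p x + 2 * 4 ^ k * powNorm k p y := by
  have hk' : (1:ℝ) ≤ k := by exact_mod_cast hk
  set u := ∑ i, (x + y) i ^ (2 * k) with hu
  set v := ∑ i, (x - y) i ^ (2 * k) with hv
  have hu0 : 0 ≤ u := sum_even_pow_nonneg k _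
  have hv0 : 0 ≤ v := sum_even_pow_nonneg k _
  set X := ∑ i, x i ^ (2 * k) with hX
  set Y := ∑ i, y i ^ (2 * k) with hY
  have hX0 : 0 ≤ X := sum_even_pow_nonneg k _
  have hY0 : 0 ≤ Y := sum_even_pow_nonneg k _
  have hθ : 0 ≤ p / (2 * k) := by positivity
  have hθ1 : p / (2 * k) ≤ 1 := by rw [div_le_one (by positivity)]; linarith
  have h1 : u ^ (p / (2 * k)) + v ^ (p / (2 * k)) ≤ 2 * ((u + v) / 2) ^ (p / (2 * k)) := by
    have := (Real.concaveOn_rpow hθ hθ1).2 (Set.mem_Ici.2 hu0) (Set.mem_Ici.2 hv0)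
      (by norm_num : (0:ℝ) ≤ 1/2) (by norm_num : (0:ℝ) ≤ 1/2) (by norm_num)
    simp only [smul_eq_mul] at this
    have e : (u + v) / 2 = 1 / 2 * u + 1 / 2 * v := by ring
    rw [e]; linarith
  have h2 : (u + v) / 2 ≤ ∑ i, (x i ^ 2 + 4 ^ k * y i ^ 2) ^ k := by
    rw [hu, hv, ← Finset.sum_add_distrib, Finset.sum_div]
    exact Finset.sum_le_sum fun i _ => two_point_inequality k hk (x i) (y i)
  have h3 : (∑ i, (x i ^ 2 + 4 ^ k * y i ^ 2) ^ k) ^ (1 / (k:ℝ))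
      ≤ X ^ (1 / (k:ℝ)) + 4 ^ k * Y ^ (1 / (k:ℝ)) := by
    have := Real.Lp_add_le_of_nonneg (s := Finset.univ) (f := fun i => x i ^ 2)
      (g := fun i => 4 ^ k * y i ^ 2) (p := (k:ℝ)) hk' (fun i _ => by positivity)
      (fun i _ => by positivity)
    simp only [Real.rpow_natCast] at this
    refine this.trans (le_of_eq ?_)
    congr 1
    · simp only [hX, pow_mul]
    · have e : ∑ i, (4 ^ k * y i ^ 2) ^ k = (4 ^ k) ^ k * Y := by
        rw [hY, Finset.mul_sum]
        refine Finset.sum_congr rfl fun i _ => ?_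
        rw [mul_pow, pow_mul (y i)]
      rw [e, Real.mul_rpow (by positivity) hY0, ← Real.rpow_natCast (4 ^ k) k,
        ← Real.rpow_mul (by positivity)]
      rw [mul_one_div_cancel (by positivity), Real.rpow_one]
  have key : ∀ w : ℝ, 0 ≤ w → w ^ (p / (2 * k)) = (w ^ (1 / (k:ℝ))) ^ (p / 2) := by
    intro w hw
    rw [← Real.rpow_mul hw]; congr 1; field_simp
  have h4 : ((u + v) / 2) ^ (p / (2 * k)) ≤ X ^ (p / (2 * k)) + 4 ^ k * Y ^ (p / (2 * k)) := by
    rw [key X hX0, key Y hY0]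
    refine (Real.rpow_le_rpow (by positivity) h2 hθ).trans ?_
    rw [key _ (Finset.sum_nonneg fun i _ => by positivity)]
    refine (Real.rpow_le_rpow (by positivity) h3 (by positivity)).trans ?_
    refine (Real.rpow_add_le_add_rpow (by positivity) (by positivity) (by positivity)
      (by linarith)).trans ?_
    rw [Real.mul_rpow (by positivity) (by positivity)]
    have : ((4:ℝ) ^ k) ^ (p / 2) ≤ 4 ^ k := by
      calc ((4:ℝ) ^ k) ^ (p / 2) ≤ ((4:ℝ) ^ k) ^ (1:ℝ) :=
            Real.rpow_le_rpow_of_exponent_le (one_le_pow₀ (by norm_num)) (by linarith)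
        _ = 4 ^ k := Real.rpow_one _
    gcongr
  unfold powNorm
  rw [← hu, ← hv, ← hX, ← hY]
  linarith

/-- Convexity in tangent form. Hölder bounds the gradient paired with x − y and Young separates the
two powers, so no differentiation is needed. -/
lemma powNorm_sub_ge (k : ℕ) (hk : 1 ≤ k) {p : ℝ} (hp : 1 < p) (x y : ι → ℝ) :
    powNorm k p x - ∑ i, powNormGrad k p x i * y i ≤ powNorm k p (x - y) := by
  have hk' : (1:ℝ) ≤ k := by exact_mod_cast hk
  set X := ∑ i, x i ^ (2 * k) with hX
  have hX0 : 0 ≤ X := sum_even_pow_nonneg k _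
  -- At the origin the power p/(2k) − 1 in the gradient may be negative, but the factor x_i^{2k−1}
  -- kills every coordinate.
  rcases hX0.eq_or_lt with h0 | hXp
  · have hx : ∀ i, x i = 0 := by
      intro i
      have := (Finset.sum_eq_zero_iff_of_nonneg (fun i _ => by rw [pow_mul]; positivity)).1
        h0.symm i (Finset.mem_univ i)
      exact pow_eq_zero_iff (by omega) |>.1 this
    have : x = 0 := funext hx
    have e : ∑ i, powNormGrad k p x i * y i = 0 := by
      refine Finset.sum_eq_zero fun i _ => ?_
      simp [powNormGrad, hx i]; left; right; omega
    rw [e, sub_zero]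
    subst this
    rw [powNorm_zero k hk (by linarith)]
    exact powNorm_nonneg _ _ _
  set Z := ∑ i, (x - y) i ^ (2 * k) with hZ
  have hZ0 : 0 ≤ Z := sum_even_pow_nonneg k _
  set q : ℝ := 2 * k with hq
  have hq1 : 1 < q := by rw [hq]; linarith
  -- Hölder
  have hol : ∑ i, x i ^ (2 * k - 1) * (x - y) i ≤ X ^ (1 - 1 / q) * Z ^ (1 / q) := by
    have hpq : (q / (q - 1)).HolderConjugate q := (Real.HolderConjugate.conjExponent hq1).symm
    refine (Real.inner_le_Lp_mul_Lq Finset.univ _ _ hpq).trans (le_of_eq ?_)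
    have e1 : ∑ i, |x i ^ (2 * k - 1)| ^ (q / (q - 1)) = X := by
      refine Finset.sum_congr rfl fun i _ => ?_
      have : ((2 * k - 1 : ℕ) : ℝ) = q - 1 := by
        rw [Nat.cast_sub (by omega)]; push_cast; rfl
      rw [abs_pow, ← Real.rpow_natCast, ← Real.rpow_mul (abs_nonneg _), this,
        mul_div_cancel₀ _ (by linarith), hq]
      rw [show (2 * (k:ℝ)) = ((2 * k : ℕ) : ℝ) by push_cast; ring, Real.rpow_natCast,
        (even_two_mul k).pow_abs]
    have e2 : ∑ i, |(x - y) i| ^ q = Z := by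
      refine Finset.sum_congr rfl fun i _ => ?_
      rw [hq, show (2 * (k:ℝ)) = ((2 * k : ℕ) : ℝ) by push_cast; ring, Real.rpow_natCast,
        (even_two_mul k).pow_abs]
    rw [e1, e2]
    congr 2
    have : q ≠ 0 := by linarith
    have : q - 1 ≠ 0 := by linarith
    field_simp
  have e3 : ∑ i, x i ^ (2 * k - 1) * (x - y) i = X - ∑ i, x i ^ (2 * k - 1) * y i := by
    rw [hX, ← Finset.sum_sub_distrib]
    refine Finset.sum_congr rfl fun i _ => ?_
    have : x i ^ (2 * k) = x i ^ (2 * k - 1) * x i := by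
      rw [← pow_succ]; congr 1; omega
    rw [this, Pi.sub_apply]; ring
  have e4 : ∑ i, powNormGrad k p x i * y i
      = p * X ^ (p / q - 1) * ∑ i, x i ^ (2 * k - 1) * y i := by
    rw [Finset.mul_sum]
    refine Finset.sum_congr rfl fun i _ => ?_
    unfold powNormGrad; rw [← hX]; ring
  have hXpos : 0 < X ^ (p / q - 1) := Real.rpow_pos_of_pos hXp _
  -- Young
  have young : p * (X ^ ((p - 1) / q) * Z ^ (1 / q)) ≤ (p - 1) * X ^ (p / q) + Z ^ (p / q) := by
    have := Real.young_inequality_of_nonneg (a := X ^ ((p - 1) / q)) (b := Z ^ (1 / q))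
      (by positivity) (by positivity)
      (p := p / (p - 1)) (q := p) (Real.HolderConjugate.conjExponent hp).symm
    rw [← Real.rpow_mul hX0, ← Real.rpow_mul hZ0] at this
    have a1 : (p - 1) / q * (p / (p - 1)) = p / q := by
      have : p - 1 ≠ 0 := by linarith
      field_simp
    have a2 : 1 / q * p = p / q := by ring
    rw [a1, a2] at this
    have h5 := mul_le_mul_of_nonneg_left this (by linarith : 0 ≤ p)
    refine h5.trans (le_of_eq ?_)
    have : p - 1 ≠ 0 := by linarith
    field_simp
  have e5 : X ^ (p / q - 1) * (X ^ (1 - 1 / q) * Z ^ (1 / q)) = X ^ ((p - 1) / q) * Z ^ (1 / q) := by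
    rw [← mul_assoc, ← Real.rpow_add hXp]; congr 2; ring
  have e6 : X ^ (p / q - 1) * X = X ^ (p / q) := by
    nth_rw 2 [← Real.rpow_one X]
    rw [← Real.rpow_add hXp]; congr 1; ring
  have h6 := mul_le_mul_of_nonneg_left hol hXpos.le
  rw [e5, e3, mul_sub, e6] at h6
  have h7 := mul_le_mul_of_nonneg_left h6 (by linarith : 0 ≤ p)
  rw [e4]
  unfold powNorm
  rw [← hX, ← hZ, ← hq]
  have hc : ((2:ℝ) * (k:ℝ)) = q := rfl
  nlinarith

/-- The tangent inequality in direction −y turns the two-sided smoothness bound into a one-sided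
expansion. Its linear term will integrate to zero. -/
lemma powNorm_add_le (k : ℕ) (hk : 1 ≤ k) {p : ℝ} (hp : 1 < p) (hp2 : p ≤ 2) (x y : ι → ℝ) :
    powNorm k p (x + y) ≤
      powNorm k p x + ∑ i, powNormGrad k p x i * y i + 2 * 4 ^ k * powNorm k p y := by
  have h1 := powNorm_add_add_powNorm_sub_le k hk (by linarith) hp2 x y
  have h2 := powNorm_sub_ge k hk hp x y
  linarith

lemma sum_even_pow_rpow_le (k : ℕ) (hk : 1 ≤ k) (x : ι → ℝ) :
    (∑ i, x i ^ (2 * k)) ^ (1 / (2 * k : ℝ)) ≤ ∑ i, |x i| := by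
  have hk' : (1:ℝ) ≤ k := by exact_mod_cast hk
  have h : ∑ i, x i ^ (2 * k) ≤ (∑ i, |x i|) ^ (2 * k) := by
    calc ∑ i, x i ^ (2 * k) = ∑ i, |x i| ^ (2 * k) := by
          refine Finset.sum_congr rfl fun i _ => ((even_two_mul k).pow_abs _).symm
      _ ≤ ∑ i, |x i| * (∑ i, |x i|) ^ (2 * k - 1) := by
          refine Finset.sum_le_sum fun i _ => ?_
          rw [show 2 * k = (2 * k - 1) + 1 by omega, pow_succ', show 2 * k - 1 + 1 - 1 = 2 * k - 1 by omega]
          gcongr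
          exact Finset.single_le_sum (f := fun i => |x i|) (fun i _ => abs_nonneg _) (Finset.mem_univ i)
      _ = (∑ i, |x i|) ^ (2 * k) := by
          rw [← Finset.sum_mul, ← pow_succ']; congr 1; omega
  have h0 : 0 ≤ ∑ i, |x i| := Finset.sum_nonneg fun i _ => abs_nonneg _
  refine (Real.rpow_le_rpow (sum_even_pow_nonneg k x) h (by positivity)).trans (le_of_eq ?_)
  rw [← Real.rpow_natCast, ← Real.rpow_mul h0]
  push_cast
  rw [mul_one_div_cancel (by positivity), Real.rpow_one]

lemma powNorm_le (k : ℕ) (hk : 1 ≤ k) {p : ℝ} (hp : 0 ≤ p) (hp2 : p ≤ 2) (x : ι → ℝ) :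
    powNorm k p x ≤ 1 + (∑ i, |x i|) ^ 2 := by
  have hk' : (1:ℝ) ≤ k := by exact_mod_cast hk
  have h0 : 0 ≤ ∑ i, |x i| := Finset.sum_nonneg fun i _ => abs_nonneg _
  have hs := sum_even_pow_nonneg k x
  have e : powNorm k p x = ((∑ i, x i ^ (2 * k)) ^ (1 / (2 * k : ℝ))) ^ p := by
    unfold powNorm
    rw [← Real.rpow_mul hs]; congr 1; ring
  rw [e]
  refine (Real.rpow_le_rpow (by positivity) (sum_even_pow_rpow_le k hk x) hp).trans ?_
  rcases le_total (∑ i, |x i|) 1 with h | h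
  · have := Real.rpow_le_one h0 h hp
    nlinarith [sq_nonneg (∑ i, |x i|)]
  · have := Real.rpow_le_rpow_of_exponent_le h hp2
    rw [Real.rpow_two] at this
    linarith

/-- Linear growth keeps the gradient at an L² vector in L², so that its pairing with an L² increment
is integrable. -/
lemma abs_powNormGrad_le (k : ℕ) (hk : 1 ≤ k) {p : ℝ} (hp : 1 ≤ p) (hp2 : p ≤ 2) (x : ι → ℝ)
    (i : ι) : |powNormGrad k p x i| ≤ 2 * (1 + ∑ i, |x i|) := by
  have hk' : (1:ℝ) ≤ k := by exact_mod_cast hk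
  have hs := sum_even_pow_nonneg k x
  have h0 : 0 ≤ ∑ i, |x i| := Finset.sum_nonneg fun i _ => abs_nonneg _
  rcases hs.eq_or_lt with hz | hpos
  · have hx : x i = 0 := by
      have := (Finset.sum_eq_zero_iff_of_nonneg (fun i _ => by rw [pow_mul]; positivity)).1
        hz.symm i (Finset.mem_univ i)
      exact pow_eq_zero_iff (by omega) |>.1 this
    have : powNormGrad k p x i = 0 := by
      simp [powNormGrad, hx]; right; omega
    rw [this]; simp; positivity
  set X := ∑ i, x i ^ (2 * k) with hX
  set N := X ^ (1 / (2 * k : ℝ)) with hN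
  have hN0 : 0 < N := Real.rpow_pos_of_pos hpos _
  have hNle : N ≤ ∑ i, |x i| := sum_even_pow_rpow_le k hk x
  have hxi : |x i| ≤ N := by
    have : |x i| ^ (2 * k) ≤ X := by
      rw [(even_two_mul k).pow_abs]
      exact Finset.single_le_sum (f := fun i => x i ^ (2 * k))
        (fun i _ => by rw [pow_mul]; positivity) (Finset.mem_univ i)
    calc |x i| = (|x i| ^ (2 * k)) ^ (1 / (2 * k : ℝ)) := by
          rw [← Real.rpow_natCast, ← Real.rpow_mul (abs_nonneg _)]
          push_cast
          rw [mul_one_div_cancel (by positivity), Real.rpow_one]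
      _ ≤ N := Real.rpow_le_rpow (by positivity) this (by positivity)
  have e1 : X ^ (p / (2 * k) - 1) = N ^ (p - 2 * k) := by
    rw [hN, ← Real.rpow_mul hpos.le]; congr 1; field_simp
  have h1 : |powNormGrad k p x i| ≤ p * N ^ (p - 1) := by
    unfold powNormGrad
    rw [← hX, e1, abs_mul, abs_mul, abs_of_nonneg (by linarith : 0 ≤ p),
      abs_of_nonneg (by positivity : 0 ≤ N ^ (p - 2 * k)), abs_pow]
    calc p * N ^ (p - 2 * k) * |x i| ^ (2 * k - 1) ≤ p * N ^ (p - 2 * k) * N ^ (2 * k - 1) := by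
          gcongr
      _ = p * N ^ (p - 1) := by
          rw [mul_assoc, ← Real.rpow_natCast, ← Real.rpow_add hN0]
          rw [Nat.cast_sub (by omega)]; push_cast; congr 2; ring
  refine h1.trans ?_
  have h2 : N ^ (p - 1) ≤ 1 + ∑ i, |x i| := by
    rcases le_total N 1 with h | h
    · have := Real.rpow_le_one hN0.le h (by linarith : 0 ≤ p - 1)
      linarith
    · have := Real.rpow_le_rpow_of_exponent_le h (by linarith : p - 1 ≤ 1)
      rw [Real.rpow_one] at this
      linarith
  have : 0 ≤ N ^ (p - 1) := by positivity
  nlinarith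

/-- A crude quasi-triangle inequality, used only to merge the boundedly many parity classes. The
power 2k of the cardinality becomes at most 2 after raising to p/(2k), since p ≤ 2. -/
lemma powNorm_sum_le (k : ℕ) (hk : 1 ≤ k) {p : ℝ} (hp : 0 < p) (hp2 : p ≤ 2) {κ : Type*}
    (s : Finset κ) (x : κ → ι → ℝ) :
    powNorm k p (∑ c ∈ s, x c) ≤ (s.card : ℝ) ^ 2 * ∑ c ∈ s, powNorm k p (x c) := by
  classical
  have hk' : (1:ℝ) ≤ k := by exact_mod_cast hk
  rcases s.eq_empty_or_nonempty with rfl | hne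
  · simp [powNorm_zero k hk hp]
  have hc1 : (1:ℝ) ≤ s.card := by exact_mod_cast hne.card_pos
  have h1 : ∑ i, (∑ c ∈ s, x c) i ^ (2 * k)
      ≤ (s.card : ℝ) ^ (2 * k) * ∑ c ∈ s, ∑ i, x c i ^ (2 * k) := by
    rw [Finset.sum_comm, Finset.mul_sum]
    refine Finset.sum_le_sum fun i _ => ?_
    rw [Finset.sum_apply]
    have h := pow_sum_div_card_le_sum_pow (s := s) (f := fun c => |x c i|) (n := 2 * k - 1)
      (fun c _ => abs_nonneg _)
    rw [show 2 * k - 1 + 1 = 2 * k by omega] at h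
    have h' : (∑ c ∈ s, |x c i|) ^ (2 * k) ≤ (s.card : ℝ) ^ (2 * k - 1) * ∑ c ∈ s, x c i ^ (2 * k) := by
      rw [div_le_iff₀ (by positivity)] at h
      simp only [(even_two_mul k).pow_abs] at h
      linarith
    have h'' : (∑ c ∈ s, x c i) ^ (2 * k) ≤ (∑ c ∈ s, |x c i|) ^ (2 * k) := by
      rw [← (even_two_mul k).pow_abs]
      exact pow_le_pow_left₀ (abs_nonneg _) (Finset.abs_sum_le_sum_abs _ _) _
    refine h''.trans (h'.trans ?_)
    have : 0 ≤ ∑ c ∈ s, x c i ^ (2 * k) :=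
      Finset.sum_nonneg fun c _ => by rw [pow_mul]; positivity
    gcongr
    omega
  have hsub : ∀ (t : Finset κ) (a : κ → ℝ), (∀ c, 0 ≤ a c) →
      (∑ c ∈ t, a c) ^ (p / (2 * k)) ≤ ∑ c ∈ t, a c ^ (p / (2 * k)) := by
    intro t a ha
    induction t using Finset.induction_on with
    | empty => simp; rw [Real.zero_rpow]; positivity
    | insert c t hct ih =>
      rw [Finset.sum_insert hct, Finset.sum_insert hct]
      refine (Real.rpow_add_le_add_rpow (ha c) (Finset.sum_nonneg fun c _ => ha c)
        (by positivity) ?_).trans ?_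
      · rw [div_le_one (by positivity)]; linarith
      · linarith
  unfold powNorm
  refine (Real.rpow_le_rpow (sum_even_pow_nonneg k _) h1 (by positivity)).trans ?_
  rw [Real.mul_rpow (by positivity)
    (Finset.sum_nonneg fun c _ => sum_even_pow_nonneg k _)]
  have e : ((s.card : ℝ) ^ (2 * k)) ^ (p / (2 * k)) ≤ (s.card : ℝ) ^ 2 := by
    rw [← Real.rpow_natCast, ← Real.rpow_mul (by positivity), ← Real.rpow_natCast _ 2]
    refine Real.rpow_le_rpow_of_exponent_le hc1 ?_
    push_cast
    rw [mul_div_cancel₀ _ (by positivity)]; exact hp2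
  have := hsub s (fun c => ∑ i, x c i ^ (2 * k)) (fun c => sum_even_pow_nonneg k _)
  gcongr
  exact Real.rpow_nonneg (Finset.sum_nonneg fun c _ => sum_even_pow_nonneg k _) _

lemma measurable_powNorm (k : ℕ) (p : ℝ) : Measurable (powNorm k p : (ι → ℝ) → ℝ) := by
  unfold powNorm
  fun_prop

lemma measurable_powNormGrad (k : ℕ) (p : ℝ) (i : ι) :
    Measurable (fun x : ι → ℝ => powNormGrad k p x i) := by
  unfold powNormGrad
  fun_prop

end PowNorm

/-! ### Orthogonal sums and measurability of parameter integrals -/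

section Orthogonal

variable {Ω : Type*} [MeasurableSpace Ω] {P : Measure Ω} [IsProbabilityMeasure P]
  {ι : Type*} [Fintype ι]

omit [IsProbabilityMeasure P] in
lemma memLp_two_sum_abs {S : ι → Ω → ℝ} (hS : ∀ i, MemLp (S i) 2 P) :
    MemLp (fun ω => ∑ i, |S i ω|) 2 P :=
  memLp_finsetSum _ fun i _ => (hS i).abs

lemma integrable_powNorm {k : ℕ} (hk : 1 ≤ k) {p : ℝ} (hp : 0 ≤ p) (hp2 : p ≤ 2)
    {S : ι → Ω → ℝ} (hS : ∀ i, MemLp (S i) 2 P) :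
    Integrable (fun ω => powNorm k p fun i => S i ω) P := by
  have h1 : AEMeasurable (fun ω i => S i ω) P :=
    aemeasurable_pi_lambda _ fun i => (hS i).1.aemeasurable
  refine Integrable.mono' (g := fun ω => 1 + (∑ i, |S i ω|) ^ 2)
    ((integrable_const _).add (memLp_two_sum_abs hS).integrable_sq)
    ((measurable_powNorm k p).comp_aemeasurable h1).aestronglyMeasurable
    (ae_of_all _ fun ω => ?_)
  rw [Real.norm_of_nonneg (powNorm_nonneg _ _ _)]
  exact powNorm_le k hk hp hp2 _

lemma memLp_two_comp_of_linear_growth {φ : (ι → ℝ) → ℝ} (hφ : Measurable φ)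
    (hb : ∀ x, |φ x| ≤ 2 * (1 + ∑ i, |x i|)) {S : ι → Ω → ℝ} (hS : ∀ i, MemLp (S i) 2 P) :
    MemLp (fun ω => φ fun i => S i ω) 2 P := by
  have h1 : AEMeasurable (fun ω i => S i ω) P :=
    aemeasurable_pi_lambda _ fun i => (hS i).1.aemeasurable
  refine MemLp.of_le (g := fun ω => 2 * (1 + ∑ i, |S i ω|))
    (((memLp_const (1:ℝ)).add (memLp_two_sum_abs hS)).const_mul 2)
    (hφ.comp_aemeasurable h1).aestronglyMeasurable (ae_of_all _ fun ω => ?_)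
  refine (hb _).trans (le_abs_self _)

lemma integral_powNorm_add_le {k : ℕ} (hk : 1 ≤ k) {p : ℝ} (hp : 1 < p) (hp2 : p ≤ 2)
    {S Z : ι → Ω → ℝ} (hS : ∀ i, MemLp (S i) 2 P) (hZ : ∀ i, MemLp (Z i) 2 P)
    (horth : ∀ i, ∫ ω, powNormGrad k p (fun i => S i ω) i * Z i ω ∂P = 0) :
    ∫ ω, powNorm k p (fun i => S i ω + Z i ω) ∂P ≤
      ∫ ω, powNorm k p (fun i => S i ω) ∂P + 2 * 4 ^ k * ∫ ω, powNorm k p (fun i => Z i ω) ∂P := by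
  have hL : ∀ i, Integrable (fun ω => powNormGrad k p (fun i => S i ω) i * Z i ω) P := fun i =>
    (memLp_two_comp_of_linear_growth (measurable_powNormGrad k p i)
      (fun x => abs_powNormGrad_le k hk hp.le hp2 x i) hS).integrable_mul (hZ i)
  have hp0 : 0 ≤ p := by linarith
  have iS := integrable_powNorm (k := k) hk hp0 hp2 hS
  have iZ := integrable_powNorm (k := k) hk hp0 hp2 hZ
  have iSZ := integrable_powNorm (k := k) hk hp0 hp2 (S := fun i ω => S i ω + Z i ω)
    fun i => (hS i).add (hZ i)
  have iL : Integrable (fun ω => ∑ i, powNormGrad k p (fun i => S i ω) i * Z i ω) P :=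
    integrable_finsetSum _ fun i _ => hL i
  calc ∫ ω, powNorm k p (fun i => S i ω + Z i ω) ∂P
      ≤ ∫ ω, ((powNorm k p (fun i => S i ω) + ∑ i, powNormGrad k p (fun i => S i ω) i * Z i ω)
          + 2 * 4 ^ k * powNorm k p (fun i => Z i ω)) ∂P := by
        refine integral_mono iSZ ((iS.add iL).add (iZ.const_mul _)) fun ω => ?_
        exact powNorm_add_le k hk hp hp2 (fun i => S i ω) (fun i => Z i ω)
    _ = _ := by
        have h1 : Integrable (fun ω => powNorm k p (fun i => S i ω)
            + ∑ i, powNormGrad k p (fun i => S i ω) i * Z i ω) P := iS.add iL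
        rw [integral_add h1 (iZ.const_mul _), integral_add iS iL,
          integral_finsetSum _ fun i _ => hL i, integral_const_mul]
        simp [horth]

/-- A vector-valued von Bahr–Esseen inequality. Orthogonality is required against functions of any
subfamily that omits the new term, so terms can be added in any order and no filtration is needed.
-/
lemma integral_powNorm_sum_le {k : ℕ} (hk : 1 ≤ k) {p : ℝ} (hp : 1 < p) (hp2 : p ≤ 2)
    {κ : Type*} (s : Finset κ) {Z : κ → ι → Ω → ℝ} (hZ : ∀ c ∈ s, ∀ i, MemLp (Z c i) 2 P)
    (horth : ∀ s' ⊆ s, ∀ c ∈ s, c ∉ s' → ∀ φ : (ι → ℝ) → ℝ, Measurable φ →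
      (∀ x, |φ x| ≤ 2 * (1 + ∑ i, |x i|)) →
      ∀ i, ∫ ω, φ (fun i => ∑ c' ∈ s', Z c' i ω) * Z c i ω ∂P = 0) :
    ∫ ω, powNorm k p (fun i => ∑ c ∈ s, Z c i ω) ∂P ≤
      2 * 4 ^ k * ∑ c ∈ s, ∫ ω, powNorm k p (fun i => Z c i ω) ∂P := by
  classical
  induction s using Finset.induction_on with
  | empty =>
    have : powNorm k p (fun _ : ι => (0:ℝ)) = 0 := powNorm_zero k hk (by linarith)
    simp [this]
  | insert c s hcs ih =>
    have ih' := ih (fun c' hc' => hZ c' (Finset.mem_insert_of_mem hc'))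
      (fun s' hs' c' hc' => horth s' (hs'.trans (Finset.subset_insert _ _)) c'
        (Finset.mem_insert_of_mem hc'))
    have h := integral_powNorm_add_le (P := P) hk hp hp2 (S := fun i ω => ∑ c ∈ s, Z c i ω)
      (Z := Z c) (fun i => memLp_finsetSum _ fun c' hc' => hZ c' (Finset.mem_insert_of_mem hc') i)
      (hZ c (Finset.mem_insert_self _ _)) (fun i => horth s (Finset.subset_insert _ _) c
        (Finset.mem_insert_self _ _) hcs _ (measurable_powNormGrad k p i)
        (fun x => abs_powNormGrad_le k hk hp.le hp2 x i) i)
    rw [Finset.sum_insert hcs]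
    have e : (fun ω => powNorm k p fun i => ∑ c ∈ insert c s, Z c i ω)
        = fun ω => powNorm k p fun i => (∑ c ∈ s, Z c i ω) + Z c i ω := by
      funext ω; congr 1; funext i; rw [Finset.sum_insert hcs, add_comm]
    rw [e]
    linarith

end Orthogonal

/-! ### Integrals over a parameter: measurability, orthogonality and L² bounds -/

section ParameterIntegral

variable {Ω T : Type*} {G mΩ : MeasurableSpace Ω} [MeasurableSpace T] {P : Measure Ω}
  [IsProbabilityMeasure P] {ν : Measure T} [IsFiniteMeasure ν]

/-- A parameter integral of `G`-measurable functions is almost everywhere `G`-measurable, even if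
the integrand is jointly measurable only for the larger σ-algebra. -/
lemma aestronglyMeasurable_integral_of_forall (hG : G ≤ mΩ)
    {f : T → Ω → ℝ} (hf : Integrable (Function.uncurry f) (ν.prod P))
    (hfG : ∀ᵐ t ∂ν, StronglyMeasurable[G] (f t)) :
    AEStronglyMeasurable[G] (fun ω => ∫ t, f t ω ∂ν) P := by
  have hX : Integrable (fun ω => ∫ t, f t ω ∂ν) P := hf.integral_prod_right
  set X : Ω → ℝ := fun ω => ∫ t, f t ω ∂ν with hXdef
  -- The identity is tested on an arbitrary measurable set. Fubini moves the test inside the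
  -- parameter integral, where its indicator can be replaced by its conditional expectation because
  -- each `f t` is `G`-measurable. Fubini back and the self-adjointness of conditional expectation
  -- finish.
  suffices h : X =ᵐ[P] P[X | G] from ⟨_, stronglyMeasurable_condExp, h⟩
  refine Integrable.ae_eq_of_forall_setIntegral_eq _ _ hX integrable_condExp ?_
  intro s hs _
  set H : Ω → ℝ := s.indicator fun _ => (1:ℝ) with hH
  have hHm : StronglyMeasurable H := stronglyMeasurable_const.indicator hs
  have hHi : Integrable H P := (integrable_const _).indicator hs
  have hH01 : ∀ ω, H ω ∈ Set.Icc (0:ℝ) 1 := fun ω => by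
    by_cases h : ω ∈ s <;> simp [hH, h]
  have hcH : ∀ᵐ ω ∂P, ‖(P[H | G]) ω‖ ≤ 1 := by
    have h0 : (0 : Ω → ℝ) ≤ᵐ[P] P[H | G] :=
      condExp_nonneg (ae_of_all _ fun ω => (hH01 ω).1)
    have h1 : P[H | G] ≤ᵐ[P] P[(fun _ => (1:ℝ)) | G] :=
      condExp_mono hHi (integrable_const _) (ae_of_all _ fun ω => (hH01 ω).2)
    rw [condExp_const hG] at h1
    filter_upwards [h0, h1] with ω a b
    rw [Real.norm_of_nonneg a]; exact b
  have cHm : AEStronglyMeasurable (P[H | G]) P :=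
    (stronglyMeasurable_condExp.mono hG).aestronglyMeasurable
  have pull : ∀ Y : Ω → ℝ, StronglyMeasurable[G] Y → Integrable Y P →
      ∫ ω, (P[H | G]) ω * Y ω ∂P = ∫ ω, H ω * Y ω ∂P := by
    intro Y hY hYi
    have hHY : Integrable (H * Y) P :=
      hYi.bdd_mul hHm.aestronglyMeasurable (c := 1) (ae_of_all _ fun ω => by
        rw [Real.norm_of_nonneg (hH01 ω).1]; exact (hH01 ω).2)
    have := condExp_mul_of_stronglyMeasurable_right hY hHY hHi
    calc ∫ ω, (P[H | G]) ω * Y ω ∂P = ∫ ω, (P[H * Y | G]) ω ∂P :=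
          (integral_congr_ae this).symm
      _ = ∫ ω, H ω * Y ω ∂P := integral_condExp hG
  have pull2 : ∀ Y : Ω → ℝ, Integrable Y P →
      ∫ ω, (P[H | G]) ω * Y ω ∂P = ∫ ω, (P[H | G]) ω * (P[Y | G]) ω ∂P := by
    intro Y hYi
    have hHY : Integrable (P[H | G] * Y) P := hYi.bdd_mul cHm hcH
    have := condExp_mul_of_stronglyMeasurable_left
      (stronglyMeasurable_condExp (f := H) (μ := P) (m := G)) hHY hYi
    calc ∫ ω, (P[H | G]) ω * Y ω ∂P = ∫ ω, (P[P[H | G] * Y | G]) ω ∂P :=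
          (integral_condExp hG).symm
      _ = _ := integral_congr_ae this
  have ind : ∀ Y : Ω → ℝ, ∫ ω in s, Y ω ∂P = ∫ ω, H ω * Y ω ∂P := by
    intro Y
    rw [← integral_indicator hs]
    refine integral_congr_ae (ae_of_all _ fun ω => ?_)
    by_cases h : ω ∈ s <;> simp [hH, h]
  have fub : ∀ Y : Ω → ℝ, AEStronglyMeasurable Y P → (∀ᵐ ω ∂P, ‖Y ω‖ ≤ 1) →
      ∫ ω, Y ω * X ω ∂P = ∫ t, ∫ ω, Y ω * f t ω ∂P ∂ν := by
    intro Y hY hb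
    have hi : Integrable (Function.uncurry fun t ω => Y ω * f t ω) (ν.prod P) := by
      refine hf.bdd_mul (f := fun z : T × Ω => Y z.2) hY.comp_snd (c := 1) ?_
      exact (Measure.quasiMeasurePreserving_snd (μ := ν) (ν := P)).ae hb
    rw [← integral_integral_swap (f := fun ω t => Y ω * f t ω) hi.swap]
    refine integral_congr_ae (ae_of_all _ fun ω => ?_)
    exact (integral_const_mul _ _).symm
  have hft : ∀ᵐ t ∂ν, Integrable (f t) P := hf.prod_right_ae
  rw [ind, ind, fub H hHm.aestronglyMeasurable (ae_of_all _ fun ω => by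
        rw [Real.norm_of_nonneg (hH01 ω).1]; exact (hH01 ω).2)]
  rw [← pull _ stronglyMeasurable_condExp integrable_condExp, ← pull2 X hX, fub _ cHm hcH]
  refine integral_congr_ae ?_
  filter_upwards [hft, hfG] with t h1 h2
  exact (pull _ h2 h1).symm

lemma integral_mul_parameter_integral_eq_zero {H : Ω → ℝ} {f : T → Ω → ℝ} (hH : MemLp H 2 P)
    (hf : MemLp (Function.uncurry f) 2 (ν.prod P)) (h0 : ∀ᵐ t ∂ν, ∫ ω, H ω * f t ω ∂P = 0) :
    ∫ ω, H ω * ∫ t, f t ω ∂ν ∂P = 0 := by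
  have hi : Integrable (Function.uncurry fun t ω => H ω * f t ω) (ν.prod P) :=
    (hH.comp_snd ν).integrable_mul hf
  calc ∫ ω, H ω * ∫ t, f t ω ∂ν ∂P = ∫ ω, ∫ t, H ω * f t ω ∂ν ∂P :=
        integral_congr_ae (ae_of_all _ fun ω => (integral_const_mul _ _).symm)
    _ = ∫ t, ∫ ω, H ω * f t ω ∂P ∂ν := integral_integral_swap hi.swap
    _ = 0 := by rw [integral_congr_ae h0]; simp

lemma memLp_two_parameter_integral {f : T → Ω → ℝ}
    (hf : MemLp (Function.uncurry f) 2 (ν.prod P)) : MemLp (fun ω => ∫ t, f t ω ∂ν) 2 P := by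
  have hfi : Integrable (Function.uncurry f) (ν.prod P) := hf.integrable one_le_two
  have hm : AEStronglyMeasurable (fun ω => ∫ t, f t ω ∂ν) P :=
    hfi.integral_prod_right.aestronglyMeasurable
  rw [memLp_two_iff_integrable_sq hm]
  have h2 : Integrable (fun z : T × Ω => (Function.uncurry f z) ^ 2) (ν.prod P) := hf.integrable_sq
  have h3 : Integrable (fun ω => ν.real Set.univ * ∫ t, (f t ω) ^ 2 ∂ν) P :=
    h2.integral_prod_right.const_mul _
  refine h3.mono' (hm.pow 2) ?_
  filter_upwards [hfi.prod_left_ae, h2.prod_left_ae, hf.1.prodMk_right] with ω a b c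
  have hL : MemLp (fun t => f t ω) 2 ν := (memLp_two_iff_integrable_sq a.1).2 b
  rw [Real.norm_of_nonneg (sq_nonneg _)]
  set c' := ν.real Set.univ with hc'
  set m := ∫ t, f t ω ∂ν with hm'
  have b' : Integrable (fun t => f t ω ^ 2) ν := b
  have a' : Integrable (fun t => f t ω) ν := a
  -- Cauchy–Schwarz for a finite measure, read off from the non-negativity of this variance-like
  -- integral.
  have hnn : 0 ≤ ∫ t, (c' * f t ω - m) ^ 2 ∂ν := integral_nonneg fun t => sq_nonneg _
  have he : ∫ t, (c' * f t ω - m) ^ 2 ∂ν = c' * (c' * (∫ t, f t ω ^ 2 ∂ν) - m ^ 2) := by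
    have e1 : ∀ t, (c' * f t ω - m) ^ 2
        = c' ^ 2 * f t ω ^ 2 - 2 * c' * m * f t ω + m ^ 2 := fun t => by ring
    simp_rw [e1]
    have i1 : Integrable (fun t => c' ^ 2 * f t ω ^ 2) ν := b'.const_mul _
    have i2 : Integrable (fun t => 2 * c' * m * f t ω) ν := a'.const_mul _
    have i3 : Integrable (fun t => c' ^ 2 * f t ω ^ 2 - 2 * c' * m * f t ω) ν := i1.sub i2
    rw [integral_add i3 (integrable_const _), integral_sub i1 i2,
      integral_const_mul, integral_const_mul, integral_const, ← hm', ← hc', smul_eq_mul]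
    ring
  rw [he] at hnn
  rcases (measureReal_nonneg (μ := ν) (s := Set.univ)).eq_or_lt with h0 | hpos
  · have hν : ν = 0 := by
      rw [← Measure.measure_univ_eq_zero]
      exact (measureReal_eq_zero_iff).1 h0.symm
    have : m = 0 := by rw [hm', hν]; simp
    rw [this, hc', ← h0]; simp
  · have := nonneg_of_mul_nonneg_right hnn hpos
    linarith

omit [IsFiniteMeasure ν] in
lemma lintegral_rpow_le_measure_univ_mul {g : T → ℝ≥0∞} (hg : AEMeasurable g ν) {s : ℝ}
    (hs : 1 < s) :
    (∫⁻ t, g t ∂ν) ^ s ≤ ν Set.univ ^ (s - 1) * ∫⁻ t, g t ^ s ∂ν := by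
  have hpq : s.HolderConjugate (s / (s - 1)) := Real.HolderConjugate.conjExponent hs
  have h := ENNReal.lintegral_mul_le_Lp_mul_Lq ν hpq hg (aemeasurable_const (b := (1:ℝ≥0∞)))
  simp only [Pi.mul_apply, mul_one, ENNReal.one_rpow, lintegral_one] at h
  have h0 : 0 ≤ s := by linarith
  refine (ENNReal.rpow_le_rpow h h0).trans (le_of_eq ?_)
  rw [ENNReal.mul_rpow_of_nonneg _ _ h0, ← ENNReal.rpow_mul, ← ENNReal.rpow_mul, mul_comm]
  have : s - 1 ≠ 0 := by linarith
  have e1 : 1 / (s / (s - 1)) * s = s - 1 := by field_simp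
  have e2 : 1 / s * s = 1 := by field_simp
  rw [e1, e2, ENNReal.rpow_one]

end ParameterIntegral

/-! ### Random variables with the exponential moments of a centred Gaussian -/

section ExpGaussian

variable {Ω : Type*} [MeasurableSpace Ω] {P : Measure Ω}

/-- `X` has the moment generating function of a centred Gaussian variable of variance `v`. -/
def HasGaussianMgf (X : Ω → ℝ) (P : Measure Ω) (v : ℝ) : Prop :=
  AEMeasurable X P ∧ ∀ a, mgf X P a = Real.exp (v * a ^ 2 / 2)

/-- A non-integrable exponential would have integral zero by convention, whereas the prescribed
value is positive. -/
lemma HasGaussianMgf.integrable_exp {X : Ω → ℝ} {v : ℝ} (h : HasGaussianMgf X P v) (a : ℝ) :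
    Integrable (fun ω => Real.exp (a * X ω)) P := by
  by_contra hc
  have h1 := h.2 a
  unfold mgf at h1
  rw [integral_undef hc] at h1
  exact (Real.exp_pos _).ne h1

lemma HasGaussianMgf.lintegral_exp {X : Ω → ℝ} {v : ℝ} (h : HasGaussianMgf X P v) (a : ℝ) :
    ∫⁻ ω, ENNReal.ofReal (Real.exp (a * X ω)) ∂P = ENNReal.ofReal (Real.exp (v * a ^ 2 / 2)) := by
  rw [← h.2 a, ← ofReal_integral_eq_lintegral_ofReal (h.integrable_exp a)
    (ae_of_all _ fun ω => (Real.exp_pos _).le)]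
  rfl

lemma HasGaussianMgf.const_mul {X : Ω → ℝ} {v : ℝ} (h : HasGaussianMgf X P v) (c : ℝ) :
    HasGaussianMgf (fun ω => c * X ω) P (c ^ 2 * v) := by
  refine ⟨h.1.const_mul c, fun a => ?_⟩
  have := h.2 (a * c)
  unfold mgf at this ⊢
  simp_rw [← mul_assoc, this]
  congr 1; ring

lemma hasGaussianMgf_of_hasGaussianLaw [IsProbabilityMeasure P] {X : Ω → ℝ}
    (hX : HasGaussianLaw X P) (h0 : ∫ ω, X ω ∂P = 0) : HasGaussianMgf X P Var[X; P] := by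
  refine ⟨hX.aemeasurable, fun a => ?_⟩
  rw [mgf_gaussianReal hX.map_eq_gaussianReal, h0]
  rw [Real.coe_toNNReal _ (variance_nonneg _ _)]
  simp

lemma hasGaussianMgf_sum {ι : Type*} {X : ι → Ω → ℝ} {v : ι → ℝ} (hX : iIndepFun X P)
    (h : ∀ i, HasGaussianMgf (X i) P (v i)) (s : Finset ι) :
    HasGaussianMgf (fun ω => ∑ i ∈ s, X i ω) P (∑ i ∈ s, v i) := by
  refine ⟨by have := fun i => (h i).1; fun_prop, fun a => ?_⟩
  have e : (fun ω => ∑ i ∈ s, X i ω) = ∑ i ∈ s, X i := by ext; simp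
  rw [e, hX.mgf_sum₀ (fun i => (h i).1), Finset.prod_congr rfl fun i _ => (h i).2 a,
    ← Real.exp_sum]
  congr 1
  rw [Finset.sum_mul, Finset.sum_div]

/-- An exponential minus one has s-th moment of order σ^s. Pointwise, |e^x − 1| ≤ |x| e^{|x|} ≤ σ
exp((1 + S)|x|/σ). -/
lemma HasGaussianMgf.lintegral_exp_sub_one_le {X : Ω → ℝ} {v : ℝ} (h : HasGaussianMgf X P v)
    {σ S s : ℝ} (hσ : 0 < σ) (hσS : σ ≤ S) (hv : v ≤ σ ^ 2) (hs : 0 ≤ s) :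
    ∫⁻ ω, ENNReal.ofReal (|Real.exp (X ω) - 1| ^ s) ∂P ≤
      ENNReal.ofReal (2 * Real.exp (s ^ 2 * (1 + S) ^ 2 / 2) * σ ^ s) := by
  -- With this rate, v a² ≤ s²(1 + S)² however small σ is, so the exponential moments stay bounded.
  set a : ℝ := s * ((1 + S) / σ) with ha
  have hS : 0 < S := hσ.trans_le hσS
  have ha0 : 0 ≤ a := by positivity
  have pt : ∀ x : ℝ, |Real.exp x - 1| ^ s ≤
      σ ^ s * (Real.exp (a * x) + Real.exp (-a * x)) := by
    intro x
    have h1 : |Real.exp x - 1| ≤ |x| * Real.exp |x| := by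
      rcases le_total 0 x with hx | hx
      · rw [abs_of_nonneg (by linarith [Real.add_one_le_exp x] : 0 ≤ Real.exp x - 1),
          abs_of_nonneg hx]
        have := Real.add_one_le_exp (-x)
        have e : Real.exp x * Real.exp (-x) = 1 := by rw [← Real.exp_add]; simp
        nlinarith [Real.exp_pos x]
      · rw [abs_of_nonpos (by linarith [Real.exp_le_one_iff.2 hx] : Real.exp x - 1 ≤ 0),
          abs_of_nonpos hx]
        have := Real.add_one_le_exp x
        have := Real.one_le_exp (by linarith : 0 ≤ -x)
        nlinarith
    have h2 : |x| ≤ σ * Real.exp (|x| / σ) := by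
      have := Real.add_one_le_exp (|x| / σ)
      have e : |x| = σ * (|x| / σ) := by field_simp
      nlinarith
    have h3 : |x| * Real.exp |x| ≤ σ * Real.exp ((1 + S) / σ * |x|) := by
      calc |x| * Real.exp |x| ≤ σ * Real.exp (|x| / σ) * Real.exp |x| := by gcongr
        _ = σ * Real.exp (|x| / σ + |x|) := by rw [mul_assoc, Real.exp_add]
        _ ≤ σ * Real.exp ((1 + S) / σ * |x|) := by
            gcongr
            have : |x| ≤ S / σ * |x| := by
              have : 1 ≤ S / σ := by rw [le_div_iff₀ hσ]; linarith
              nlinarith [abs_nonneg x]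
            calc |x| / σ + |x| ≤ |x| / σ + S / σ * |x| := by gcongr
              _ = (1 + S) / σ * |x| := by ring
    calc |Real.exp x - 1| ^ s ≤ (σ * Real.exp ((1 + S) / σ * |x|)) ^ s :=
          Real.rpow_le_rpow (abs_nonneg _) (h1.trans h3) hs
      _ = σ ^ s * Real.exp (a * |x|) := by
          rw [Real.mul_rpow hσ.le (Real.exp_pos _).le, ← Real.exp_mul]
          congr 2; rw [ha]; ring
      _ ≤ σ ^ s * (Real.exp (a * x) + Real.exp (-a * x)) := by
          gcongr
          rcases abs_cases x with ⟨e, _⟩ | ⟨e, _⟩ <;> rw [e]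
          · linarith [Real.exp_pos (-a * x)]
          · have : a * -x = -a * x := by ring
            rw [this]; linarith [Real.exp_pos (a * x)]
  have hbound : v * a ^ 2 / 2 ≤ s ^ 2 * (1 + S) ^ 2 / 2 := by
    have : v * a ^ 2 ≤ σ ^ 2 * a ^ 2 := by gcongr
    have e : σ ^ 2 * a ^ 2 = s ^ 2 * (1 + S) ^ 2 := by rw [ha]; field_simp
    linarith
  calc ∫⁻ ω, ENNReal.ofReal (|Real.exp (X ω) - 1| ^ s) ∂P
      ≤ ∫⁻ ω, ENNReal.ofReal (σ ^ s) * (ENNReal.ofReal (Real.exp (a * X ω))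
          + ENNReal.ofReal (Real.exp (-a * X ω))) ∂P := by
        refine lintegral_mono fun ω => ?_
        rw [← ENNReal.ofReal_add (Real.exp_pos _).le (Real.exp_pos _).le,
          ← ENNReal.ofReal_mul (by positivity)]
        exact ENNReal.ofReal_le_ofReal (pt _)
    _ = ENNReal.ofReal (σ ^ s) * (ENNReal.ofReal (Real.exp (v * a ^ 2 / 2))
          + ENNReal.ofReal (Real.exp (v * a ^ 2 / 2))) := by
        rw [lintegral_const_mul' _ _ ENNReal.ofReal_ne_top, lintegral_add_left' ,
          h.lintegral_exp, h.lintegral_exp, neg_sq]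
        have := h.1
        fun_prop
    _ ≤ _ := by
        rw [← ENNReal.ofReal_add (Real.exp_pos _).le (Real.exp_pos _).le,
          ← ENNReal.ofReal_mul (by positivity)]
        refine ENNReal.ofReal_le_ofReal ?_
        have := Real.exp_le_exp.2 hbound
        have : 0 ≤ σ ^ s := by positivity
        nlinarith

end ExpGaussian

/-! ### Regular Gaussian fields -/

lemma IndepFun.prodMk_left_of_prodMk_right {Ω α β δ : Type*} [MeasurableSpace Ω]
    [MeasurableSpace α] [MeasurableSpace β] [MeasurableSpace δ] {P : Measure Ω}
    [IsProbabilityMeasure P] {X : Ω → α} {Y : Ω → β} {Z : Ω → δ} (hX : Measurable X)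
    (hY : Measurable Y) (hZ : Measurable Z) (h1 : IndepFun X (fun ω => (Y ω, Z ω)) P)
    (h2 : IndepFun Y Z P) : IndepFun (fun ω => (X ω, Y ω)) Z P := by
  have := Measure.isProbabilityMeasure_map (μ := P) hX.aemeasurable
  have := Measure.isProbabilityMeasure_map (μ := P) hY.aemeasurable
  have := Measure.isProbabilityMeasure_map (μ := P) hZ.aemeasurable
  have h3 : IndepFun X Y P := h1.comp measurable_id measurable_fst
  rw [indepFun_iff_map_prod_eq_prod_map_map (by fun_prop) (by fun_prop)] at h1 h2 h3 ⊢
  rw [h2] at h1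
  rw [h3]
  have e : (fun ω => ((X ω, Y ω), Z ω)) =
      MeasurableEquiv.prodAssoc.symm ∘ fun ω => (X ω, Y ω, Z ω) := rfl
  rw [e, ← Measure.map_map (MeasurableEquiv.measurable _) (by fun_prop), h1]
  exact (MeasurePreserving.symm _ (measurePreserving_prodAssoc _ _ _)).map_eq

section RegularField

variable {d : ℕ} {Ω : Type*} [MeasurableSpace Ω]

/-- The properties of the Gaussian fields `ψ j` (with variances `v j`) that the analysis of the
multiplicative chaos uses. -/
structure IsRegularField (P : Measure Ω) (ψ : ℕ → halfOpenCube d → Ω → ℝ) (v : ℕ → ℝ) (b : ℕ)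
    (α : ℝ) : Prop where
  measurable : ∀ j, Measurable fun p : halfOpenCube d × Ω => ψ j p.1 p.2
  gaussian : ∀ j, IsGaussianProcess (ψ j) P
  centered : ∀ j t, ∫ ω, ψ j t ω ∂P = 0
  second_moment : ∀ j t, ∫ ω, ψ j t ω ^ 2 ∂P = v j
  indep : iIndepFun (fun (j : ℕ) (ω : Ω) (t : halfOpenCube d) => ψ j t ω) P
  increments : ∃ C : ℝ, ∀ j s t, Var[fun ω => ψ j s ω - ψ j t ω; P] ≤
    C * ((b : ℝ) ^ j * ‖s.1 - t.1‖) ^ (2 * α)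
  finite_range : ∃ j₀ : ℕ, ∀ j ≥ j₀, ∀ s t : halfOpenCube d, ((b : ℝ) ^ j)⁻¹ < ‖s.1 - t.1‖ →
    covariance (ψ j s) (ψ j t) P = 0
  bounded : ∃ C : ℝ, ∀ j, v j ≤ C
  growth : ∀ ε > 0, ∃ C : ℝ, ∀ m, ∑ j ∈ Finset.range m, v j ≤ C + (1 + ε) * (m * Real.log b)

namespace IsRegularField

variable {P : Measure Ω} [IsProbabilityMeasure P] {ψ : ℕ → halfOpenCube d → Ω → ℝ} {v : ℕ → ℝ}
  {b : ℕ} {α : ℝ}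

omit [IsProbabilityMeasure P] in
lemma measurable_eval (h : IsRegularField P ψ v b α) (j : ℕ) (t : halfOpenCube d) :
    Measurable (ψ j t) :=
  (h.measurable j).comp measurable_prodMk_left

omit [IsProbabilityMeasure P] in
lemma measurable_path (h : IsRegularField P ψ v b α) (j : ℕ) :
    Measurable fun (ω : Ω) (t : halfOpenCube d) => ψ j t ω :=
  measurable_pi_lambda _ fun t => h.measurable_eval j t

omit [IsProbabilityMeasure P] in
lemma variance_nonneg (h : IsRegularField P ψ v b α) (t : halfOpenCube d) (j : ℕ) : 0 ≤ v j := by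
  rw [← h.second_moment j t]
  exact integral_nonneg fun ω => sq_nonneg _

lemma hasGaussianMgf (h : IsRegularField P ψ v b α) (j : ℕ) (t : halfOpenCube d) :
    HasGaussianMgf (ψ j t) P (v j) := by
  have := hasGaussianMgf_of_hasGaussianLaw ((h.gaussian j).hasGaussianLaw_eval t) (h.centered j t)
  rwa [variance_of_integral_eq_zero ((h.measurable_eval j t).aemeasurable) (h.centered j t),
    h.second_moment] at this

lemma hasGaussianMgf_sum (h : IsRegularField P ψ v b α) (s : Finset ℕ) (t : halfOpenCube d) :
    HasGaussianMgf (fun ω => ∑ j ∈ s, ψ j t ω) P (∑ j ∈ s, v j) :=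
  _root_.hasGaussianMgf_sum (h.indep.comp (fun _ f => f t) fun _ => measurable_pi_apply t)
    (fun j => h.hasGaussianMgf j t) s

omit [IsProbabilityMeasure P] in
lemma integrable_eval (h : IsRegularField P ψ v b α) (j : ℕ) (t : halfOpenCube d) :
    Integrable (ψ j t) P :=
  ((h.gaussian j).hasGaussianLaw_eval t).integrable

lemma hasGaussianMgf_sum_increments (h : IsRegularField P ψ v b α) (s : Finset ℕ)
    (t t' : halfOpenCube d) :
    HasGaussianMgf (fun ω => ∑ j ∈ s, (ψ j t ω - ψ j t' ω)) P
      (∑ j ∈ s, Var[fun ω => ψ j t ω - ψ j t' ω; P]) := by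
  refine _root_.hasGaussianMgf_sum (h.indep.comp (fun _ f => f t - f t') fun _ => by fun_prop)
    (fun j => hasGaussianMgf_of_hasGaussianLaw ((h.gaussian j).hasGaussianLaw_fun_sub) ?_) s
  refine (integral_sub (h.integrable_eval j t) (h.integrable_eval j t')).trans ?_
  rw [h.centered, h.centered, sub_zero]

/-- At small scales, the value of `ψ m` at `t` is independent of the coarser fields together with
the values of `ψ m` at distance more than `b⁻ᵐ` from `t`. -/
lemma indepFun_past (h : IsRegularField P ψ v b α) :
    ∃ j₀ : ℕ, ∀ m ≥ j₀, ∀ (t : halfOpenCube d) (B : Set (halfOpenCube d)),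
      (∀ s ∈ B, ((b : ℝ) ^ m)⁻¹ < ‖s.1 - t.1‖) →
      IndepFun (fun ω => ((fun (j : Finset.range m) (t : halfOpenCube d) => ψ j t ω),
        fun s : B => ψ m s ω)) (ψ m t) P := by
  obtain ⟨j₀, hj⟩ := h.finite_range
  refine ⟨j₀, fun m hm t B hB => ?_⟩
  have i1 := h.indep.indepFun_finset (Finset.range m) {m} (by simp) fun j => h.measurable_path j
  -- Within one Gaussian process vanishing covariance is independence. Combined with `i1`, the
  -- independence of different levels, it yields joint independence by reassociating the three
  -- blocks.
  have i2 : IndepFun (fun ω (s : B) => ψ m s ω) (fun ω (_ : Unit) => ψ m t ω) P := by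
    refine IsGaussianProcess.indepFun_of_covariance_eq_zero (X := fun s : B => ψ m s)
      (Y := fun _ : Unit => ψ m t) ?_ (fun s => (h.measurable_eval m s).aemeasurable)
      (fun _ => (h.measurable_eval m t).aemeasurable) fun s _ => hj m hm s t (hB s s.2)
    have e : Sum.elim (fun s : B => ψ m s) (fun _ : Unit => ψ m t) =
        ψ m ∘ Sum.elim (fun s : B => (s : halfOpenCube d)) fun _ : Unit => t := by
      ext x; cases x <;> rfl
    rw [e]
    exact (h.gaussian m).comp_right _
  refine IndepFun.prodMk_left_of_prodMk_right ?_ ?_ (h.measurable_eval m t) ?_ ?_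
  · exact measurable_pi_lambda _ fun j => h.measurable_path j
  · exact measurable_pi_lambda _ fun s => h.measurable_eval m s
  · refine i1.comp (φ := id) (ψ := fun f : (({m} : Finset ℕ) → halfOpenCube d → ℝ) =>
      ((fun s : B => f ⟨m, by simp⟩ s), f ⟨m, by simp⟩ t)) measurable_id ?_
    fun_prop
  · exact i2.comp (φ := id) (ψ := fun f : Unit → ℝ => f ()) measurable_id (by fun_prop)

omit [IsProbabilityMeasure P] in
/-- Replacing the first `n` fields by zero preserves regularity. -/
lemma zeroBelow (h : IsRegularField P ψ v b α) (n : ℕ) :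
    IsRegularField P (fun j t ω => if j < n then 0 else ψ j t ω) (fun j => if j < n then 0 else v j)
      b α where
  measurable j := by
    by_cases hj : j < n
    · simp [hj]
    · simpa [hj] using h.measurable j
  gaussian j := by
    by_cases hj : j < n
    · simp only [hj, if_true]
      have e : (fun (_ : halfOpenCube d) (_ : Ω) => (0:ℝ)) = fun t ω => (0:ℝ) • ψ j t ω := by
        ext; simp
      rw [e]
      exact (h.gaussian j).smul (fun _ => (0:ℝ))
    · simpa [hj] using h.gaussian j
  centered j t := by
    by_cases hj : j < n
    · simp [hj]
    · simpa [hj] using h.centered j t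
  second_moment j t := by
    by_cases hj : j < n
    · simp [hj]
    · simpa [hj] using h.second_moment j t
  indep := by
    refine h.indep.comp (fun j f t => if j < n then 0 else f t) fun j => ?_
    by_cases hj : j < n
    · simp only [hj, if_true]; fun_prop
    · simp only [hj, if_false]; fun_prop
  increments := by
    obtain ⟨C, hC⟩ := h.increments
    refine ⟨C, fun j s t => ?_⟩
    by_cases hj : j < n
    · have := (ProbabilityTheory.variance_nonneg _ _).trans (hC j s t)
      have e : Var[fun _ : Ω => (0:ℝ); P] = 0 := variance_zero P
      simpa [hj, e] using this
    · simpa [hj] using hC j s t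
  finite_range := by
    obtain ⟨j₀, hj₀⟩ := h.finite_range
    refine ⟨j₀, fun j hj s t hst => ?_⟩
    by_cases hjn : j < n
    · simp only [hjn, if_true]
      exact covariance_zero_left
    · simpa [hjn] using hj₀ j hj s t hst
  bounded := by
    obtain ⟨C, hC⟩ := h.bounded
    refine ⟨max C 0, fun j => ?_⟩
    by_cases hj : j < n
    · simp [hj]
    · simp [hj, hC j]
  growth ε hε := by
    obtain ⟨C, hC⟩ := h.growth ε hε
    refine ⟨C + ∑ j ∈ Finset.range n, |v j|, fun m => ?_⟩
    have := hC m
    have h2 : ∑ j ∈ Finset.range m, (if j < n then 0 else v j) ≤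
        ∑ j ∈ Finset.range m, v j + ∑ j ∈ Finset.range n, |v j| := by
      have e : ∑ j ∈ Finset.range m, (if j < n then 0 else v j) =
          ∑ j ∈ Finset.range m, v j - ∑ j ∈ Finset.range m, (if j < n then v j else 0) := by
        rw [← Finset.sum_sub_distrib]
        refine Finset.sum_congr rfl fun j _ => ?_
        split_ifs <;> simp
      rw [e, ← Finset.sum_filter]
      have h3 : -∑ j ∈ Finset.range m with j < n, v j ≤ ∑ j ∈ Finset.range n, |v j| := by
        rw [← Finset.sum_neg_distrib]
        calc ∑ j ∈ Finset.range m with j < n, -v j ≤ ∑ j ∈ Finset.range m with j < n, |v j| :=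
              Finset.sum_le_sum fun j _ => neg_le_abs _
          _ ≤ ∑ j ∈ Finset.range n, |v j| := by
              refine Finset.sum_le_sum_of_subset_of_nonneg (fun j hj => ?_) fun j _ _ => abs_nonneg _
              simp only [Finset.mem_filter, Finset.mem_range] at hj ⊢
              exact hj.2
      linarith
    linarith

end IsRegularField

/-! ### From the kernel hypotheses to a regular field -/

section Admissible

lemma sub_mem_openDifferenceCube (s t : halfOpenCube d) : s.1 - t.1 ∈ openDifferenceCube d := by
  intro i
  have h1 := s.2 i
  have h2 := t.2 i
  simp only [PiLp.sub_apply, Set.mem_Ico, Set.mem_Ioo] at *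
  constructor <;> linarith [h1.1, h1.2, h2.1, h2.2]

lemma sub_mem_differenceCube (s t : halfOpenCube d) : s.1 - t.1 ∈ differenceCube d := fun i =>
  ⟨(sub_mem_openDifferenceCube s t i).1.le, (sub_mem_openDifferenceCube s t i).2.le⟩

/-- By stationarity the variance of an increment is 2(K_j(0) − K_j(s − t)), so regularity of the
kernel at the origin alone controls all increments. The support condition gives the finite range,
and the limit superior gives the growth of the summed variances. -/
lemma IsSigmaAdmissible.isRegularField {α₀ : ℝ} (hα₀ : 0 < α₀ ∧ α₀ ≤ 1)
    {K : EuclideanSpace ℝ (Fin d) → ℝ} {b : ℕ} (hb : 2 ≤ b)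
    {Kj : ℕ → EuclideanSpace ℝ (Fin d) → ℝ} (hK : IsSigmaAdmissible b α₀ K Kj)
    {P : Measure Ω} [IsProbabilityMeasure P]
    {ψ : ℕ → halfOpenCube d → Ω → ℝ} (hψ : IsGaussianDecomposition P Kj ψ) :
    IsRegularField P ψ (fun j => Kj j 0) b α₀ := by
  have hbpos : (0:ℝ) < b := by positivity
  have hmeas : ∀ j t, Measurable (ψ j t) := fun j t => (hψ.measurable j).comp measurable_prodMk_left
  have hL2 : ∀ j t, MemLp (ψ j t) 2 P := fun j t => ((hψ.gaussian j).hasGaussianLaw_eval t).memLp_two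
  have hlog : 0 < Real.log b := Real.log_pos (by exact_mod_cast hb)
  have hgrow : ∀ ε > 0, ∀ᶠ j in atTop, Kj j 0 < (1 + ε) * Real.log b := by
    intro ε hε
    have : limsup (fun j => ((Kj j 0 : ℝ) : EReal)) atTop < (((1 + ε) * Real.log b : ℝ) : EReal) := by
      rw [hK.limsup_zero, EReal.coe_lt_coe_iff]; nlinarith
    filter_upwards [eventually_lt_of_limsup_lt this] with j hj
    exact EReal.coe_lt_coe_iff.1 hj
  have hbdd : ∃ C : ℝ, ∀ j, Kj j 0 ≤ C := by
    obtain ⟨N, hN⟩ := eventually_atTop.1 (hgrow 1 one_pos)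
    refine ⟨∑ j ∈ Finset.range N, |Kj j 0| + 2 * Real.log b, fun j => ?_⟩
    have h0 : 0 ≤ ∑ j ∈ Finset.range N, |Kj j 0| := Finset.sum_nonneg fun j _ => abs_nonneg _
    rcases lt_or_ge j N with hj | hj
    · have := Finset.single_le_sum (f := fun j => |Kj j 0|) (fun j _ => abs_nonneg _)
        (Finset.mem_range.2 hj)
      have := le_abs_self (Kj j 0)
      linarith
    · have := hN j hj
      linarith
  have hsm : ∀ j t, Var[ψ j t; P] = Kj j 0 := fun j t => by
    rw [← covariance_self (hmeas j t).aemeasurable, hψ.covariance_eq, sub_self]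
  have hincr : ∀ j s t, Var[fun ω => ψ j s ω - ψ j t ω; P] = 2 * (Kj j 0 - Kj j (s.1 - t.1)) := by
    intro j s t
    have := variance_sub (hL2 j s) (hL2 j t)
    rw [hsm, hsm, hψ.covariance_eq] at this
    have e : (fun ω => ψ j s ω - ψ j t ω) = ψ j s - ψ j t := rfl
    rw [e, this]; ring
  refine ⟨hψ.measurable, hψ.gaussian, hψ.centered, ?_, hψ.indep, ?_, ?_, hbdd, ?_⟩
  · intro j t
    rw [← hsm j t, variance_of_integral_eq_zero (hmeas j t).aemeasurable (hψ.centered j t)]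
  · obtain ⟨V, hV⟩ := hbdd
    obtain ⟨C, hC⟩ := hK.holder_zero
    refine ⟨2 * |C| + 2 * |V|, fun j s t => ?_⟩
    rw [hincr]
    set r := s.1 - t.1 with hr
    have hbj : (0:ℝ) < (b:ℝ) ^ j := by positivity
    rcases (norm_nonneg r).eq_or_lt with h0 | hpos
    · have : r = 0 := norm_eq_zero.1 h0.symm
      rw [this]; simp; positivity
    have hx : 0 < ((b:ℝ) ^ j * ‖r‖) ^ (2 * α₀) := by positivity
    rcases le_or_gt ‖r‖ ((b:ℝ) ^ j)⁻¹ with hle | hgt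
    · have := hC j r hpos hle
      have e : (b : ℝ) ^ (2 * (j : ℝ) * α₀) * ‖r‖ ^ (2 * α₀) = ((b:ℝ) ^ j * ‖r‖) ^ (2 * α₀) := by
        rw [Real.mul_rpow hbj.le hpos.le, ← Real.rpow_natCast, ← Real.rpow_mul hbpos.le]
        congr 2; ring
      rw [e, div_le_iff₀ hx] at this
      have h1 : Kj j 0 - Kj j r ≤ |Kj j r - Kj j 0| := by
        rw [abs_sub_comm]; exact le_abs_self _
      have h2 : C * ((b:ℝ) ^ j * ‖r‖) ^ (2 * α₀) ≤ |C| * ((b:ℝ) ^ j * ‖r‖) ^ (2 * α₀) := by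
        gcongr; exact le_abs_self _
      have h3 : 0 ≤ |V| * ((b:ℝ) ^ j * ‖r‖) ^ (2 * α₀) := by positivity
      nlinarith
    -- Beyond distance b⁻ʲ no regularity is needed: K_j ≥ 0 bounds the variance by 2K_j(0), while
    -- the right-hand factor is at least one.
    · have h1 : 1 ≤ ((b:ℝ) ^ j * ‖r‖) ^ (2 * α₀) := by
        refine Real.one_le_rpow ?_ (by linarith [hα₀.1])
        rw [inv_lt_iff_one_lt_mul₀ hbj] at hgt
        linarith
      have h2 := hK.nonneg j r (sub_mem_differenceCube s t)
      have h3 := (hV j).trans (le_abs_self V)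
      have h4 : 0 ≤ |C| * ((b:ℝ) ^ j * ‖r‖) ^ (2 * α₀) := by positivity
      nlinarith [abs_nonneg V]
  · obtain ⟨j₀, hj₀⟩ := hK.support
    refine ⟨j₀, fun j hj s t hst => ?_⟩
    rw [hψ.covariance_eq]
    by_contra hne
    have := hj₀ j hj (subset_closure ⟨sub_mem_differenceCube s t, hne⟩)
    rw [mem_closedBall_zero_iff] at this
    linarith
  · intro ε hε
    obtain ⟨N, hN⟩ := eventually_atTop.1 (hgrow ε hε)
    -- The finitely many levels whose variance may exceed (1 + ε) log b are paid for by the additive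
    -- constant.
    refine ⟨∑ j ∈ Finset.range N, |Kj j 0|, fun m => ?_⟩
    have h1 : ∀ j, Kj j 0 ≤ (if j < N then |Kj j 0| else 0) + (1 + ε) * Real.log b := by
      intro j
      split_ifs with hj
      · have := le_abs_self (Kj j 0)
        nlinarith
      · have := hN j (not_lt.1 hj); linarith
    calc ∑ j ∈ Finset.range m, Kj j 0
        ≤ ∑ j ∈ Finset.range m, ((if j < N then |Kj j 0| else 0) + (1 + ε) * Real.log b) :=
          Finset.sum_le_sum fun j _ => h1 j
      _ = ∑ j ∈ Finset.range m with j < N, |Kj j 0| + (1 + ε) * (m * Real.log b) := by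
          rw [Finset.sum_add_distrib, ← Finset.sum_filter]; simp; ring
      _ ≤ _ := by
          gcongr
          intro j hj
          simp only [Finset.mem_filter, Finset.mem_range] at hj ⊢
          exact hj.2

end Admissible

end RegularField

/-! ### Moment bounds for exponentials of Gaussian fields -/

section ExpMoments

variable {Ω : Type*} [MeasurableSpace Ω] {P : Measure Ω}

lemma eLpNorm_le_ofReal_of_lintegral_rpow_le {f : Ω → ℝ} {n : ℕ} (hn : 1 ≤ n) {A : ℝ} (hA : 0 ≤ A)
    (h : ∫⁻ ω, ENNReal.ofReal (|f ω| ^ (n:ℝ)) ∂P ≤ ENNReal.ofReal (A ^ n)) :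
    eLpNorm f n P ≤ ENNReal.ofReal A := by
  have hn0 : (n:ℝ≥0∞) ≠ 0 := by exact_mod_cast (by omega : n ≠ 0)
  have hnr : (0:ℝ) < n := by exact_mod_cast hn
  rw [eLpNorm_eq_lintegral_rpow_enorm_toReal hn0 (ENNReal.natCast_ne_top n)]
  simp only [ENNReal.toReal_natCast]
  rw [one_div, ENNReal.rpow_inv_le_iff hnr]
  refine le_trans (le_of_eq ?_) (h.trans (le_of_eq ?_))
  · refine lintegral_congr fun ω => ?_
    rw [Real.enorm_eq_ofReal_abs, ENNReal.ofReal_rpow_of_nonneg (abs_nonneg _) hnr.le]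
  · rw [ENNReal.rpow_natCast, ENNReal.ofReal_pow hA]

lemma HasGaussianMgf.eLpNorm_exp_le {X : Ω → ℝ} {v : ℝ} (h : HasGaussianMgf X P v) {n : ℕ}
    (hn : 1 ≤ n) : eLpNorm (fun ω => Real.exp (X ω)) n P ≤ ENNReal.ofReal (Real.exp (v * n / 2)) := by
  refine eLpNorm_le_ofReal_of_lintegral_rpow_le hn (Real.exp_pos _).le ?_
  have := h.lintegral_exp n
  refine le_trans (le_of_eq ?_) (this.le.trans (le_of_eq ?_))
  · refine lintegral_congr fun ω => ?_
    rw [abs_of_pos (Real.exp_pos _), ← Real.exp_mul, mul_comm]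
  · rw [← Real.exp_nat_mul]; congr 2; ring

lemma HasGaussianMgf.eLpNorm_exp_sub_one_le {X : Ω → ℝ} {v : ℝ} (h : HasGaussianMgf X P v) {n : ℕ}
    (hn : 1 ≤ n) {σ S : ℝ} (hσ : 0 < σ) (hσS : σ ≤ S) (hv : v ≤ σ ^ 2) :
    eLpNorm (fun ω => Real.exp (X ω) - 1) n P ≤
      ENNReal.ofReal (2 * Real.exp (n * (1 + S) ^ 2 / 2) * σ) := by
  refine eLpNorm_le_ofReal_of_lintegral_rpow_le hn (by positivity) ?_
  refine (h.lintegral_exp_sub_one_le hσ hσS hv (Nat.cast_nonneg n)).trans ?_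
  refine ENNReal.ofReal_le_ofReal ?_
  rw [mul_pow, mul_pow, ← Real.exp_nat_mul, Real.rpow_natCast]
  have e : (n:ℝ) * (n * (1 + S) ^ 2 / 2) = (n:ℝ) ^ 2 * (1 + S) ^ 2 / 2 := by ring
  rw [e]
  gcongr
  exact le_self_pow₀ (by norm_num) (by omega)

instance holderTriple_two_mul_natCast (n : ℕ) :
    ENNReal.HolderTriple ((2 * n : ℕ) : ℝ≥0∞) ((2 * n : ℕ) : ℝ≥0∞) (n : ℝ≥0∞) := by
  constructor
  push_cast
  rw [ENNReal.mul_inv (by simp) (by simp), ← two_mul, ← mul_assoc,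
    ENNReal.mul_inv_cancel (by simp) (by simp), one_mul]

lemma eLpNorm_mul_le_two_mul {f g : Ω → ℝ} (hf : AEMeasurable f P) (hg : AEMeasurable g P) {n : ℕ}
    {A B : ℝ} (hA : 0 ≤ A) (hf' : eLpNorm f (2 * n : ℕ) P ≤ ENNReal.ofReal A)
    (hg' : eLpNorm g (2 * n : ℕ) P ≤ ENNReal.ofReal B) :
    eLpNorm (fun ω => f ω * g ω) n P ≤ ENNReal.ofReal (A * B) := by
  rw [ENNReal.ofReal_mul hA]
  exact (eLpNorm_smul_le_mul_eLpNorm (p := ((2 * n : ℕ) : ℝ≥0∞)) (q := ((2 * n : ℕ) : ℝ≥0∞))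
    (r := (n:ℝ≥0∞)) hg.aestronglyMeasurable hf.aestronglyMeasurable).trans (by gcongr)

/-- Factor e^X − e^Y = e^Y (e^{X−Y} − 1) and apply Cauchy–Schwarz, which is why a 2n-th moment of
e^Y is needed. -/
lemma eLpNorm_exp_sub_exp_le {X Y : Ω → ℝ} (hY : AEMeasurable Y P) {v : ℝ}
    (h : HasGaussianMgf (fun ω => X ω - Y ω) P v) {n : ℕ} (hn : 1 ≤ n) {σ S C : ℝ} (hσ : 0 < σ)
    (hσS : σ ≤ S) (hv : v ≤ σ ^ 2) (hC : 0 ≤ C)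
    (hYC : eLpNorm (fun ω => Real.exp (Y ω)) (2 * n : ℕ) P ≤ ENNReal.ofReal C) :
    eLpNorm (fun ω => Real.exp (X ω) - Real.exp (Y ω)) n P ≤
      ENNReal.ofReal (C * (2 * Real.exp (n * (1 + S) ^ 2)) * σ) := by
  have h1 := h.eLpNorm_exp_sub_one_le (n := 2 * n) (by omega) hσ hσS hv
  have h2 := eLpNorm_mul_le_two_mul (hY.exp) (h.1.exp.sub aemeasurable_const) hC hYC h1
  refine le_trans (le_of_eq ?_) (h2.trans (le_of_eq ?_))
  · congr 1; funext ω
    rw [Pi.sub_apply, mul_sub, ← Real.exp_add]; simp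
  · congr 1; push_cast
    have : (2 * (n:ℝ) * (1 + S) ^ 2 / 2) = n * (1 + S) ^ 2 := by ring
    rw [this]; ring

end ExpMoments

/-! ### Accumulated variance of increments across scales -/

namespace IsRegularField

variable {d : ℕ} {Ω : Type*} [MeasurableSpace Ω] {P : Measure Ω} [IsProbabilityMeasure P]
  {ψ : ℕ → halfOpenCube d → Ω → ℝ} {v : ℕ → ℝ} {b : ℕ} {α : ℝ}

omit [IsProbabilityMeasure P] in
-- The bounds form a geometric series of ratio b^{2α} > 1, dominated by its finest level. Allowing
-- m' = m + 1 covers the field with level m included.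
lemma sum_variance_increments_le (h : IsRegularField P ψ v b α) (hb : 2 ≤ b) (hα : 0 < α) :
    ∃ C : ℝ, 0 < C ∧ ∀ m m' : ℕ, m' ≤ m + 1 → ∀ s t : halfOpenCube d,
      ∑ j ∈ Finset.range m', Var[fun ω => ψ j s ω - ψ j t ω; P] ≤
        (C * ((b:ℝ) ^ m * ‖s.1 - t.1‖) ^ α) ^ 2 := by
  obtain ⟨C, hC⟩ := h.increments
  have hb1 : (1:ℝ) < b := by exact_mod_cast hb
  have hb0 : (0:ℝ) < b := by linarith
  set ρ : ℝ := (b:ℝ) ^ (2 * α) with hρ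
  have hρ1 : 1 < ρ := Real.one_lt_rpow hb1 (by linarith)
  set A : ℝ := |C| * (ρ / (ρ - 1)) with hA
  have hA0 : 0 ≤ A := by have : 0 < ρ - 1 := by linarith
                         positivity
  -- The added one keeps the constant strictly positive, as later divisions by σ require.
  refine ⟨√A + 1, by positivity, fun m m' hm s t => ?_⟩
  set r := ‖s.1 - t.1‖ with hr
  have hr0 : 0 ≤ r := norm_nonneg _
  have hpow : ∀ j : ℕ, ((b:ℝ) ^ j * r) ^ (2 * α) = ρ ^ j * r ^ (2 * α) := by
    intro j
    rw [Real.mul_rpow (by positivity) hr0, hρ, ← Real.rpow_natCast, ← Real.rpow_natCast,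
      ← Real.rpow_mul hb0.le, ← Real.rpow_mul hb0.le]
    congr 2; ring
  have hgeom : ∑ j ∈ Finset.range m', ρ ^ j ≤ ρ / (ρ - 1) * ρ ^ m := by
    rw [geom_sum_eq hρ1.ne', div_mul_eq_mul_div]
    have : 0 < ρ - 1 := by linarith
    gcongr
    have h1 : ρ ^ m' ≤ ρ ^ (m + 1) := pow_le_pow_right₀ hρ1.le hm
    rw [pow_succ] at h1
    linarith
  have hx : 0 ≤ ((b:ℝ) ^ m * r) ^ α := by positivity
  calc ∑ j ∈ Finset.range m', Var[fun ω => ψ j s ω - ψ j t ω; P]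
      ≤ ∑ j ∈ Finset.range m', |C| * (ρ ^ j * r ^ (2 * α)) := by
        refine Finset.sum_le_sum fun j _ => (hC j s t).trans ?_
        rw [hpow]
        gcongr
        exact le_abs_self C
    _ = |C| * r ^ (2 * α) * ∑ j ∈ Finset.range m', ρ ^ j := by
        rw [Finset.mul_sum]; exact Finset.sum_congr rfl fun j _ => by ring
    _ ≤ |C| * r ^ (2 * α) * (ρ / (ρ - 1) * ρ ^ m) := by gcongr
    _ = A * (((b:ℝ) ^ m * r) ^ α) ^ 2 := by
        have e : (((b:ℝ) ^ m * r) ^ α) ^ 2 = ((b:ℝ) ^ m * r) ^ (2 * α) := by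
          rw [← Real.rpow_natCast, ← Real.rpow_mul (by positivity)]
          congr 1; push_cast; ring
        rw [e, hpow]; ring
    _ ≤ ((√A + 1) * ((b:ℝ) ^ m * r) ^ α) ^ 2 := by
        rw [mul_pow]
        gcongr
        nlinarith [Real.sq_sqrt hA0, Real.sqrt_nonneg A]

lemma hasGaussianMgf_mul_sum_increments (h : IsRegularField P ψ v b α) (γ : ℝ) (m : ℕ)
    (t t' : halfOpenCube d) :
    HasGaussianMgf (fun ω => γ * ∑ j ∈ Finset.range m, (ψ j t ω - ψ j t' ω)) P
      (γ ^ 2 * ∑ j ∈ Finset.range m, Var[fun ω => ψ j t ω - ψ j t' ω; P]) :=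
  (h.hasGaussianMgf_sum_increments _ t t').const_mul γ

end IsRegularField

/-! ### Chaos densities and their local ratios -/

section Density

variable {d : ℕ} {Ω : Type*} [MeasurableSpace Ω]

/-- The density of the approximating measure built from the fields `ψ j` with `j < m`. -/
noncomputable def chaosDensity (P : Measure Ω) (ψ : ℕ → halfOpenCube d → Ω → ℝ) (γ : ℝ) (m : ℕ)
    (t : halfOpenCube d) (ω : Ω) : ℝ :=
  ∏ j ∈ Finset.range m, expProcess P ψ γ j t ω

/-- The ratio `(D_{m+1}(t) - D_m(t)) / D_m(t₀)` of chaos densities. -/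
noncomputable def localIncrement (P : Measure Ω) (ψ : ℕ → halfOpenCube d → Ω → ℝ) (γ : ℝ) (m : ℕ)
    (t₀ t : halfOpenCube d) (ω : Ω) : ℝ :=
  Real.exp (γ * ∑ j ∈ Finset.range m, (ψ j t ω - ψ j t₀ ω)) * (expProcess P ψ γ m t ω - 1)

end Density

namespace IsRegularField

variable {d : ℕ} {Ω : Type*} [MeasurableSpace Ω] {P : Measure Ω} [IsProbabilityMeasure P]
  {ψ : ℕ → halfOpenCube d → Ω → ℝ} {v : ℕ → ℝ} {b : ℕ} {α : ℝ}

section NoProb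
omit [IsProbabilityMeasure P]

lemma expFactor_eq (h : IsRegularField P ψ v b α) (γ : ℝ) (j : ℕ) (t : halfOpenCube d) (ω : Ω) :
    expProcess P ψ γ j t ω = Real.exp (γ * ψ j t ω - γ ^ 2 / 2 * v j) := by
  rw [expProcess, h.second_moment]

lemma chaosDensity_eq (h : IsRegularField P ψ v b α) (γ : ℝ) (m : ℕ) (t : halfOpenCube d) (ω : Ω) :
    chaosDensity P ψ γ m t ω =
      Real.exp (γ * ∑ j ∈ Finset.range m, ψ j t ω - γ ^ 2 / 2 * ∑ j ∈ Finset.range m, v j) := by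
  rw [chaosDensity, Finset.prod_congr rfl fun j _ => h.expFactor_eq γ j t ω, ← Real.exp_sum,
    Finset.sum_sub_distrib, ← Finset.mul_sum, ← Finset.mul_sum]

/-- The variances do not depend on the point, so the normalisations cancel and the ratio of
densities involves only increments of the fields. -/
lemma chaosDensity_mul_sub_one (h : IsRegularField P ψ v b α) (γ : ℝ) (m : ℕ)
    (t₀ t : halfOpenCube d) (ω : Ω) :
    chaosDensity P ψ γ m t ω * (expProcess P ψ γ m t ω - 1) =
      chaosDensity P ψ γ m t₀ ω * localIncrement P ψ γ m t₀ t ω := by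
  rw [localIncrement, ← mul_assoc, h.chaosDensity_eq, h.chaosDensity_eq, ← Real.exp_add,
    Finset.sum_sub_distrib]
  congr 2; ring

lemma measurable_expFactor (h : IsRegularField P ψ v b α) (γ : ℝ) (j : ℕ) :
    Measurable fun p : halfOpenCube d × Ω => expProcess P ψ γ j p.1 p.2 := by
  simp_rw [h.expFactor_eq]
  have := h.measurable j
  fun_prop

lemma measurable_chaosDensity (h : IsRegularField P ψ v b α) (γ : ℝ) (m : ℕ) :
    Measurable fun p : halfOpenCube d × Ω => chaosDensity P ψ γ m p.1 p.2 := by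
  unfold chaosDensity
  exact Finset.measurable_fun_prod _ fun j _ => h.measurable_expFactor γ j

lemma measurable_localIncrement (h : IsRegularField P ψ v b α) (γ : ℝ) (m : ℕ)
    (t₀ : halfOpenCube d) :
    Measurable fun p : halfOpenCube d × Ω => localIncrement P ψ γ m t₀ p.1 p.2 := by
  unfold localIncrement
  have h1 := h.measurable_expFactor γ m
  have h2 : ∀ j, Measurable fun p : halfOpenCube d × Ω => ψ j p.1 p.2 - ψ j t₀ p.2 := fun j =>
    (h.measurable j).sub ((h.measurable_eval j t₀).comp measurable_snd)
  have h3 : Measurable fun p : halfOpenCube d × Ω =>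
      ∑ j ∈ Finset.range m, (ψ j p.1 p.2 - ψ j t₀ p.2) :=
    Finset.measurable_fun_sum _ fun j _ => h2 j
  fun_prop

end NoProb

/-- The log-normal moment formula, for every real exponent: exponents above one serve the Hölder
step on cells, and exponents 2 and −1 serve the comparison of masses behind the zero-one law. -/
lemma lintegral_chaosDensity_rpow (h : IsRegularField P ψ v b α) (γ : ℝ) (m : ℕ)
    (t : halfOpenCube d) (a : ℝ) :
    ∫⁻ ω, ENNReal.ofReal (chaosDensity P ψ γ m t ω ^ a) ∂P =
      ENNReal.ofReal (Real.exp (γ ^ 2 / 2 * (a ^ 2 - a) * ∑ j ∈ Finset.range m, v j)) := by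
  have h1 := (h.hasGaussianMgf_sum (Finset.range m) t).lintegral_exp (a * γ)
  set V := ∑ j ∈ Finset.range m, v j
  have e : ∀ ω, ENNReal.ofReal (chaosDensity P ψ γ m t ω ^ a) =
      ENNReal.ofReal (Real.exp (-(a * (γ ^ 2 / 2 * V)))) *
        ENNReal.ofReal (Real.exp (a * γ * ∑ j ∈ Finset.range m, ψ j t ω)) := by
    intro ω
    rw [h.chaosDensity_eq, ← Real.exp_mul, ← ENNReal.ofReal_mul (Real.exp_pos _).le, ← Real.exp_add]
    congr 2; ring
  simp_rw [e]
  rw [lintegral_const_mul' _ _ ENNReal.ofReal_ne_top, h1,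
    ← ENNReal.ofReal_mul (Real.exp_pos _).le, ← Real.exp_add]
  congr 2; ring

lemma eLpNorm_expFactor_le (h : IsRegularField P ψ v b α) (γ : ℝ) {n : ℕ} (hn : 1 ≤ n) :
    ∃ C : ℝ, 0 ≤ C ∧ ∀ (j : ℕ) (t : halfOpenCube d),
      eLpNorm (fun ω => expProcess P ψ γ j t ω) n P ≤ ENNReal.ofReal C := by
  obtain ⟨V, hV⟩ := h.bounded
  refine ⟨Real.exp (γ ^ 2 * |V| * n / 2), by positivity, fun j t => ?_⟩
  have h1 := ((h.hasGaussianMgf j t).const_mul γ).eLpNorm_exp_le hn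
  have h0 := h.variance_nonneg t j
  calc eLpNorm (fun ω => expProcess P ψ γ j t ω) n P
      ≤ eLpNorm (fun ω => Real.exp (γ * ψ j t ω)) n P := by
        refine eLpNorm_mono_real fun ω => ?_
        rw [h.expFactor_eq, Real.norm_of_nonneg (Real.exp_pos _).le]
        refine Real.exp_le_exp.2 ?_
        have : 0 ≤ γ ^ 2 / 2 * v j := by positivity
        linarith
    _ ≤ _ := h1.trans (ENNReal.ofReal_le_ofReal (Real.exp_le_exp.2 (by
        gcongr; exact (hV j).trans (le_abs_self V))))

/-- Moments and regularity of the chaos density of fixed level. -/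
lemma eLpNorm_chaosDensity_le (h : IsRegularField P ψ v b α) (hb : 2 ≤ b) (hα : 0 < α) (γ : ℝ)
    (m : ℕ) {n : ℕ} (hn : 1 ≤ n) (L : ℝ) :
    ∃ C : ℝ, 0 ≤ C ∧
      (∀ t : halfOpenCube d, eLpNorm (chaosDensity P ψ γ m t) n P ≤ ENNReal.ofReal C) ∧
      ∀ t t' : halfOpenCube d, ‖t.1 - t'.1‖ ≤ L →
        eLpNorm (fun ω => chaosDensity P ψ γ m t ω - chaosDensity P ψ γ m t' ω) n P ≤
          ENNReal.ofReal (C * ‖t.1 - t'.1‖ ^ α) := by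
  have hb0 : (0:ℝ) < b := by positivity
  set V := ∑ j ∈ Finset.range m, v j with hVdef
  have hmom : ∀ (n : ℕ), 1 ≤ n → ∀ t : halfOpenCube d, eLpNorm (chaosDensity P ψ γ m t) n P ≤
      ENNReal.ofReal (Real.exp (γ ^ 2 * V * n / 2)) := by
    intro n hn t
    have hV0 : 0 ≤ V := Finset.sum_nonneg fun j _ => h.variance_nonneg t j
    have h1 := ((h.hasGaussianMgf_sum (Finset.range m) t).const_mul γ).eLpNorm_exp_le hn
    refine le_trans (eLpNorm_mono_real fun ω => ?_) h1
    rw [h.chaosDensity_eq, Real.norm_of_nonneg (Real.exp_pos _).le]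
    refine Real.exp_le_exp.2 ?_
    have : 0 ≤ γ ^ 2 / 2 * V := by positivity
    linarith
  obtain ⟨C₀, hC₀, hvar⟩ := h.sum_variance_increments_le hb hα
  set B := (|γ| + 1) * C₀ * ((b:ℝ) ^ m) ^ α with hB
  have hB0 : 0 < B := by positivity
  set C₁ := Real.exp (γ ^ 2 * V * (2 * n : ℕ) / 2) with hC₁
  set S := B * L ^ α with hS
  refine ⟨max (Real.exp (γ ^ 2 * V * n / 2)) (C₁ * (2 * Real.exp (n * (1 + S) ^ 2)) * B),
    le_max_of_le_left (by positivity), fun t => (hmom n hn t).trans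
      (ENNReal.ofReal_le_ofReal (le_max_left _ _)), fun t t' htt => ?_⟩
  rcases eq_or_ne t t' with rfl | hne
  · simp
  have hr : 0 < ‖t.1 - t'.1‖ := norm_pos_iff.2 (sub_ne_zero.2 fun e => hne (Subtype.ext e))
  set r := ‖t.1 - t'.1‖
  have hσ : 0 < B * r ^ α := by positivity
  have hv : γ ^ 2 * ∑ j ∈ Finset.range m, Var[fun ω => ψ j t ω - ψ j t' ω; P] ≤
      (B * r ^ α) ^ 2 := by
    have e : B * r ^ α = (|γ| + 1) * (C₀ * ((b:ℝ) ^ m * r) ^ α) := by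
      rw [hB, Real.mul_rpow (by positivity) hr.le]; ring
    rw [e, mul_pow]
    have h1 : γ ^ 2 ≤ (|γ| + 1) ^ 2 := by
      rw [← sq_abs]; gcongr; linarith
    have h2 := hvar m m (by omega) t t'
    have h3 : 0 ≤ ∑ j ∈ Finset.range m, Var[fun ω => ψ j t ω - ψ j t' ω; P] :=
      Finset.sum_nonneg fun j _ => ProbabilityTheory.variance_nonneg _ _
    gcongr
  have hdiff : HasGaussianMgf (fun ω => (γ * ∑ j ∈ Finset.range m, ψ j t ω - γ ^ 2 / 2 * V) -
      (γ * ∑ j ∈ Finset.range m, ψ j t' ω - γ ^ 2 / 2 * V)) P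
      (γ ^ 2 * ∑ j ∈ Finset.range m, Var[fun ω => ψ j t ω - ψ j t' ω; P]) := by
    convert h.hasGaussianMgf_mul_sum_increments γ m t t' using 2 with ω
    rw [Finset.sum_sub_distrib]; ring
  have hYm : AEMeasurable (fun ω => γ * ∑ j ∈ Finset.range m, ψ j t' ω - γ ^ 2 / 2 * V) P := by
    have := fun j => h.measurable_eval j t'
    fun_prop
  have key := eLpNorm_exp_sub_exp_le hYm hdiff hn hσ (S := S) (by rw [hS]; gcongr) hv
    (C := C₁) (by positivity) (by
      have := hmom (2 * n) (by omega) t'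
      refine le_trans (le_of_eq ?_) this
      congr 1; funext ω; rw [h.chaosDensity_eq])
  refine le_trans (le_of_eq ?_) (key.trans (ENNReal.ofReal_le_ofReal ?_))
  · congr 1; funext ω; rw [h.chaosDensity_eq, h.chaosDensity_eq]
  · rw [← mul_assoc]
    gcongr
    exact le_max_right _ _

/-- Uniform moments and regularity, at scale `b⁻ᵐ`, of the local increments of level `m`. -/
lemma eLpNorm_localIncrement_le (h : IsRegularField P ψ v b α) (hb : 2 ≤ b) (hα : 0 < α) (γ : ℝ)
    {n : ℕ} (hn : 1 ≤ n) (L : ℝ) :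
    ∃ C : ℝ, 0 ≤ C ∧ ∀ (m : ℕ) (t₀ : halfOpenCube d),
      (∀ t : halfOpenCube d, (b:ℝ) ^ m * ‖t.1 - t₀.1‖ ≤ L →
        eLpNorm (localIncrement P ψ γ m t₀ t) n P ≤ ENNReal.ofReal C) ∧
      ∀ t t' : halfOpenCube d, (b:ℝ) ^ m * ‖t.1 - t₀.1‖ ≤ L → (b:ℝ) ^ m * ‖t'.1 - t₀.1‖ ≤ L →
        eLpNorm (fun ω => localIncrement P ψ γ m t₀ t ω - localIncrement P ψ γ m t₀ t' ω) n P ≤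
          ENNReal.ofReal (C * ((b:ℝ) ^ m * ‖t.1 - t'.1‖) ^ α) := by
  have hb0 : (0:ℝ) < b := by positivity
  obtain ⟨C₀, hC₀, hvar⟩ := h.sum_variance_increments_le hb hα
  set B := (|γ| + 1) * C₀ with hB
  have hB0 : 0 < B := by positivity
  have hvar' : ∀ (m m' : ℕ), m' ≤ m + 1 → ∀ t t' : halfOpenCube d,
      γ ^ 2 * ∑ j ∈ Finset.range m', Var[fun ω => ψ j t ω - ψ j t' ω; P] ≤
        (B * ((b:ℝ) ^ m * ‖t.1 - t'.1‖) ^ α) ^ 2 := by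
    intro m m' hm t t'
    rw [hB, mul_assoc, mul_pow]
    have h1 : γ ^ 2 ≤ (|γ| + 1) ^ 2 := by
      rw [← sq_abs]; gcongr; linarith
    have h3 : 0 ≤ ∑ j ∈ Finset.range m', Var[fun ω => ψ j t ω - ψ j t' ω; P] :=
      Finset.sum_nonneg fun j _ => ProbabilityTheory.variance_nonneg _ _
    have := hvar m m' hm t t'
    gcongr
  -- moments of the ratio of densities
  have hR : ∀ n : ℕ, 1 ≤ n → ∃ C : ℝ, 0 ≤ C ∧ ∀ (m : ℕ) (t₀ t : halfOpenCube d),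
      (b:ℝ) ^ m * ‖t.1 - t₀.1‖ ≤ L →
      eLpNorm (fun ω => Real.exp (γ * ∑ j ∈ Finset.range m, (ψ j t ω - ψ j t₀ ω))) n P ≤
        ENNReal.ofReal C := by
    intro n hn
    refine ⟨Real.exp ((B * L ^ α) ^ 2 * n / 2), by positivity, fun m t₀ t ht => ?_⟩
    refine ((h.hasGaussianMgf_mul_sum_increments γ m t t₀).eLpNorm_exp_le hn).trans ?_
    refine ENNReal.ofReal_le_ofReal (Real.exp_le_exp.2 ?_)
    have := hvar' m m (by omega) t t₀
    have h2 : (B * ((b:ℝ) ^ m * ‖t.1 - t₀.1‖) ^ α) ^ 2 ≤ (B * L ^ α) ^ 2 := by gcongr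
    have := this.trans h2
    gcongr
  have hmR : ∀ (m : ℕ) (t₀ t : halfOpenCube d),
      Measurable fun ω => γ * ∑ j ∈ Finset.range m, (ψ j t ω - ψ j t₀ ω) := by
    intro m t₀ t
    have h1 := fun j => h.measurable_eval j t
    have h2 := fun j => h.measurable_eval j t₀
    fun_prop
  have hmE : ∀ (m : ℕ) (t : halfOpenCube d), Measurable fun ω => expProcess P ψ γ m t ω :=
    fun m t => (h.measurable_expFactor γ m).comp measurable_prodMk_left
  have hU : ∀ n : ℕ, 1 ≤ n → ∃ C : ℝ, 0 ≤ C ∧ ∀ (m : ℕ) (t₀ t : halfOpenCube d),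
      (b:ℝ) ^ m * ‖t.1 - t₀.1‖ ≤ L →
      eLpNorm (fun ω => Real.exp (γ * ∑ j ∈ Finset.range m, (ψ j t ω - ψ j t₀ ω)) *
        expProcess P ψ γ m t ω) n P ≤ ENNReal.ofReal C := by
    intro n hn
    obtain ⟨C₁, h1, h1'⟩ := hR (2 * n) (by omega)
    obtain ⟨C₂, h2, h2'⟩ := h.eLpNorm_expFactor_le γ (n := 2 * n) (by omega)
    refine ⟨C₁ * C₂, by positivity, fun m t₀ t ht => ?_⟩
    exact eLpNorm_mul_le_two_mul (hmR m t₀ t).exp.aemeasurable (hmE m t).aemeasurable h1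
      (h1' m t₀ t ht) (h2' m t)
  obtain ⟨C₁, h1, h1'⟩ := hR n hn
  obtain ⟨C₂, h2, h2'⟩ := hU n hn
  obtain ⟨C₃, h3, h3'⟩ := hR (2 * n) (by omega)
  obtain ⟨C₄, h4, h4'⟩ := hU (2 * n) (by omega)
  -- Two points at rescaled distance at most L from t₀ are at rescaled distance at most 2L from each
  -- other.
  set S := B * (2 * L) ^ α with hS
  set E := 2 * Real.exp (n * (1 + S) ^ 2) with hE
  have hE0 : 0 ≤ E := by positivity
  have hn1 : (1:ℝ≥0∞) ≤ n := by exact_mod_cast hn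
  -- Written as a difference of two exponentials, each half falls under `eLpNorm_exp_sub_exp_le`.
  have eW : ∀ m t₀ t, localIncrement P ψ γ m t₀ t =
      (fun ω => Real.exp (γ * ∑ j ∈ Finset.range m, (ψ j t ω - ψ j t₀ ω)) *
        expProcess P ψ γ m t ω) -
      fun ω => Real.exp (γ * ∑ j ∈ Finset.range m, (ψ j t ω - ψ j t₀ ω)) := by
    intro m t₀ t; funext ω
    simp only [localIncrement, Pi.sub_apply]; ring
  refine ⟨max (C₂ + C₁) (C₄ * E * B + C₃ * E * B), le_max_of_le_left (by positivity),
    fun m t₀ => ⟨fun t ht => ?_, fun t t' ht ht' => ?_⟩⟩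
  · rw [eW]
    refine (eLpNorm_sub_le ((hmR m t₀ t).exp.mul (hmE m t)).aestronglyMeasurable
      (hmR m t₀ t).exp.aestronglyMeasurable hn1).trans ?_
    refine (add_le_add (h2' m t₀ t ht) (h1' m t₀ t ht)).trans ?_
    rw [← ENNReal.ofReal_add h2 h1]
    exact ENNReal.ofReal_le_ofReal (le_max_left _ _)
  · rcases eq_or_ne t t' with rfl | hne
    · simp
    have hr : 0 < ‖t.1 - t'.1‖ := norm_pos_iff.2 (sub_ne_zero.2 fun e => hne (Subtype.ext e))
    set σ := B * ((b:ℝ) ^ m * ‖t.1 - t'.1‖) ^ α with hσdef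
    have hσ : 0 < σ := by positivity
    have hσS : σ ≤ S := by
      have : ‖t.1 - t'.1‖ ≤ ‖t.1 - t₀.1‖ + ‖t'.1 - t₀.1‖ := by
        rw [norm_sub_rev t'.1]; exact norm_sub_le_norm_sub_add_norm_sub _ _ _
      have h5 : (b:ℝ) ^ m * ‖t.1 - t'.1‖ ≤ 2 * L := by
        have := mul_le_mul_of_nonneg_left this (by positivity : 0 ≤ (b:ℝ) ^ m)
        linarith
      rw [hσdef, hS]
      gcongr
    have d1 : eLpNorm (fun ω => Real.exp (γ * ∑ j ∈ Finset.range m, (ψ j t ω - ψ j t₀ ω)) -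
        Real.exp (γ * ∑ j ∈ Finset.range m, (ψ j t' ω - ψ j t₀ ω))) n P ≤
        ENNReal.ofReal (C₃ * E * σ) := by
      refine eLpNorm_exp_sub_exp_le (hmR m t₀ t').aemeasurable ?_ hn hσ hσS
        (hvar' m m (by omega) t t') h3 (h3' m t₀ t' ht')
      convert h.hasGaussianMgf_mul_sum_increments γ m t t' using 2 with ω
      simp only [Finset.sum_sub_distrib]; ring
    -- The half containing the factor of level m: the exponents at t and t' differ by increments of
    -- m + 1 fields, and the drift terms cancel.
    have d2 : eLpNorm (fun ω => Real.exp (γ * ∑ j ∈ Finset.range m, (ψ j t ω - ψ j t₀ ω) +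
        (γ * ψ m t ω - γ ^ 2 / 2 * v m)) -
        Real.exp (γ * ∑ j ∈ Finset.range m, (ψ j t' ω - ψ j t₀ ω) +
        (γ * ψ m t' ω - γ ^ 2 / 2 * v m))) n P ≤
        ENNReal.ofReal (C₄ * E * σ) := by
      refine eLpNorm_exp_sub_exp_le ?_ ?_ hn hσ hσS (hvar' m (m + 1) le_rfl t t') h4 ?_
      · have := hmR m t₀ t'
        have := h.measurable_eval m t'
        fun_prop
      · convert h.hasGaussianMgf_mul_sum_increments γ (m + 1) t t' using 2 with ω
        simp only [Finset.sum_sub_distrib, Finset.sum_range_succ]; ring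
      · refine le_trans (le_of_eq ?_) (h4' m t₀ t' ht')
        congr 1; funext ω; rw [Real.exp_add, h.expFactor_eq]
    have e : (fun ω => localIncrement P ψ γ m t₀ t ω - localIncrement P ψ γ m t₀ t' ω) =
        (fun ω => Real.exp (γ * ∑ j ∈ Finset.range m, (ψ j t ω - ψ j t₀ ω) +
        (γ * ψ m t ω - γ ^ 2 / 2 * v m)) -
        Real.exp (γ * ∑ j ∈ Finset.range m, (ψ j t' ω - ψ j t₀ ω) +
        (γ * ψ m t' ω - γ ^ 2 / 2 * v m))) -
        fun ω => Real.exp (γ * ∑ j ∈ Finset.range m, (ψ j t ω - ψ j t₀ ω)) -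
          Real.exp (γ * ∑ j ∈ Finset.range m, (ψ j t' ω - ψ j t₀ ω)) := by
      funext ω
      simp only [localIncrement, Pi.sub_apply, h.expFactor_eq, Real.exp_add]; ring
    rw [e]
    refine (eLpNorm_sub_le ?_ ?_ hn1).trans ((add_le_add d2 d1).trans ?_)
    · have := hmR m t₀ t
      have := hmR m t₀ t'
      have := h.measurable_eval m t
      have := h.measurable_eval m t'
      fun_prop
    · have := hmR m t₀ t
      have := hmR m t₀ t'
      fun_prop
    · rw [← ENNReal.ofReal_add (by positivity) (by positivity)]
      refine ENNReal.ofReal_le_ofReal ?_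
      have : C₄ * E * σ + C₃ * E * σ =
          (C₄ * E * B + C₃ * E * B) * ((b:ℝ) ^ m * ‖t.1 - t'.1‖) ^ α := by
        rw [hσdef]; ring
      rw [this]
      gcongr
      exact le_max_right _ _

end IsRegularField

/-! ### Boxes, and cancellation against antiperiodic functions -/

section Minkowski

variable {Ω T : Type*} [MeasurableSpace Ω] [MeasurableSpace T] {P : Measure Ω}
  [IsProbabilityMeasure P] {ν : Measure T} [SFinite ν]

/-- Minkowski's integral inequality under a uniform bound, deduced from Jensen in the parameter and
Tonelli. -/
lemma eLpNorm_parameter_integral_le {G : T → Ω → ℝ} (hG : Measurable (Function.uncurry G)) {n : ℕ}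
    (hn : 2 ≤ n) {C : ℝ≥0∞} (hC : ∀ᵐ t ∂ν, eLpNorm (G t) n P ≤ C) :
    eLpNorm (fun ω => ∫ t, G t ω ∂ν) n P ≤ ν Set.univ * C := by
  have hn0 : (n:ℝ≥0∞) ≠ 0 := by exact_mod_cast (by omega : n ≠ 0)
  have hnr : (1:ℝ) < n := by exact_mod_cast (by omega : 1 < n)
  have hpow : ∀ t, eLpNorm (G t) n P ≤ C → ∫⁻ ω, ‖G t ω‖ₑ ^ (n:ℝ) ∂P ≤ C ^ (n:ℝ) := by
    intro t ht
    rw [eLpNorm_eq_lintegral_rpow_enorm_toReal hn0 (ENNReal.natCast_ne_top n)] at ht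
    simp only [ENNReal.toReal_natCast] at ht
    rwa [one_div, ENNReal.rpow_inv_le_iff (by linarith)] at ht
  rw [eLpNorm_eq_lintegral_rpow_enorm_toReal hn0 (ENNReal.natCast_ne_top n)]
  simp only [ENNReal.toReal_natCast]
  rw [one_div, ENNReal.rpow_inv_le_iff (by linarith)]
  have hm : Measurable fun z : T × Ω => ‖G z.1 z.2‖ₑ ^ (n:ℝ) := hG.enorm.pow_const _
  calc ∫⁻ ω, ‖∫ t, G t ω ∂ν‖ₑ ^ (n:ℝ) ∂P
      ≤ ∫⁻ ω, ν Set.univ ^ ((n:ℝ) - 1) * ∫⁻ t, ‖G t ω‖ₑ ^ (n:ℝ) ∂ν ∂P := by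
        refine lintegral_mono fun ω => ?_
        refine (ENNReal.rpow_le_rpow (enorm_integral_le_lintegral_enorm _) (by linarith)).trans ?_
        exact lintegral_rpow_le_measure_univ_mul
          (hG.comp measurable_prodMk_right).enorm.aemeasurable hnr
    _ = ν Set.univ ^ ((n:ℝ) - 1) * ∫⁻ t, ∫⁻ ω, ‖G t ω‖ₑ ^ (n:ℝ) ∂P ∂ν := by
        rw [lintegral_const_mul _ hm.lintegral_prod_left', lintegral_lintegral_swap]
        exact (hm.comp measurable_swap).aemeasurable
    _ ≤ ν Set.univ ^ ((n:ℝ) - 1) * ∫⁻ _, C ^ (n:ℝ) ∂ν := by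
        gcongr 1
        refine lintegral_mono_ae ?_
        filter_upwards [hC] with t ht using hpow t ht
    _ = (ν Set.univ * C) ^ (n:ℝ) := by
        rw [lintegral_const, ENNReal.mul_rpow_of_nonneg _ _ (by linarith), mul_comm (C ^ (n:ℝ)),
          ← mul_assoc]
        congr 1
        nth_rw 2 [← ENNReal.rpow_one (ν Set.univ)]
        rw [← ENNReal.rpow_add_of_nonneg _ _ (by linarith) zero_le_one]
        congr 1; ring

omit [SFinite ν] in
lemma memLp_uncurry_of_eLpNorm_le [IsFiniteMeasure ν] {G : T → Ω → ℝ}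
    (hG : Measurable (Function.uncurry G)) {n : ℕ} (hn : 1 ≤ n) {C : ℝ≥0∞} (hCt : C ≠ ∞)
    (hC : ∀ᵐ t ∂ν, eLpNorm (G t) n P ≤ C) : MemLp (Function.uncurry G) n (ν.prod P) := by
  have hn0 : (n:ℝ≥0∞) ≠ 0 := by exact_mod_cast (by omega : n ≠ 0)
  have hnr : (0:ℝ) < n := by exact_mod_cast hn
  refine ⟨hG.aestronglyMeasurable, ?_⟩
  rw [eLpNorm_lt_top_iff_lintegral_rpow_enorm_lt_top hn0 (ENNReal.natCast_ne_top n)]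
  simp only [ENNReal.toReal_natCast]
  rw [lintegral_prod _ (hG.enorm.pow_const _).aemeasurable]
  calc ∫⁻ t, ∫⁻ ω, ‖G t ω‖ₑ ^ (n:ℝ) ∂P ∂ν ≤ ∫⁻ _, C ^ (n:ℝ) ∂ν := by
        refine lintegral_mono_ae ?_
        filter_upwards [hC] with t ht
        rw [eLpNorm_eq_lintegral_rpow_enorm_toReal hn0 (ENNReal.natCast_ne_top n)] at ht
        simp only [ENNReal.toReal_natCast] at ht
        rwa [one_div, ENNReal.rpow_inv_le_iff hnr] at ht
    _ < ∞ := by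
        rw [lintegral_const]
        exact ENNReal.mul_lt_top (ENNReal.rpow_lt_top_of_nonneg hnr.le hCt) (measure_lt_top _ _)

end Minkowski

section Box

variable {d : ℕ}

/-- The half-open box with corners `a` and `c`. -/
def halfOpenBox (a c : Fin d → ℝ) : Set (EuclideanSpace ℝ (Fin d)) :=
  {t | ∀ i, t i ∈ Set.Ico (a i) (c i)}

lemma measurableSet_halfOpenBox (a c : Fin d → ℝ) : MeasurableSet (halfOpenBox a c) := by
  have : halfOpenBox a c = ⋂ i, (fun t : EuclideanSpace ℝ (Fin d) => t i) ⁻¹' Set.Ico (a i) (c i) := by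
    ext t; simp [halfOpenBox]
  rw [this]
  refine MeasurableSet.iInter fun i => measurableSet_Ico.preimage ?_
  fun_prop

lemma volume_halfOpenBox (a c : Fin d → ℝ) :
    volume (halfOpenBox a c) = ∏ i, ENNReal.ofReal (c i - a i) := by
  have h := (EuclideanSpace.volume_preserving_symm_measurableEquiv_toLp (Fin d)).measure_preimage
    (MeasurableSet.univ_pi fun i => measurableSet_Ico (a := a i) (b := c i)).nullMeasurableSet
  rw [Real.volume_pi_Ico] at h
  rw [← h]
  congr 1
  ext t
  simp [halfOpenBox, Set.mem_pi]

lemma volume_halfOpenBox_of_side {a c : Fin d → ℝ} {ℓ : ℝ} (hℓ : 0 ≤ ℓ) (h : ∀ i, c i - a i = ℓ) :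
    volume (halfOpenBox a c) = ENNReal.ofReal (ℓ ^ d) := by
  rw [volume_halfOpenBox]
  simp [h, ENNReal.ofReal_pow hℓ]

lemma volume_halfOpenBox_of_thin {a c : Fin d → ℝ} {ℓ η : ℝ} (hℓ : 0 < ℓ) (hη : 0 ≤ η) (i : Fin d)
    (h : ∀ j, c j - a j = if j = i then η else ℓ) :
    volume (halfOpenBox a c) = ENNReal.ofReal (ℓ ^ d * (η / ℓ)) := by
  rw [volume_halfOpenBox]
  simp_rw [h]
  rw [← ENNReal.ofReal_prod_of_nonneg (fun j _ => by split_ifs <;> positivity)]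
  congr 1
  have : ∀ j, (if j = i then η else ℓ) = ℓ * if j = i then η / ℓ else 1 := by
    intro j; split_ifs <;> field_simp
  simp_rw [this]
  rw [Finset.prod_mul_distrib]
  simp

variable {Ω : Type*} [MeasurableSpace Ω] {P : Measure Ω} [IsProbabilityMeasure P]

/-- The integral over a box `I` of side `ℓ` of a random field that is bounded and `α`-Hölder in
`L^n` against a function that is antiperiodic with antiperiod `η` is small. -/
lemma eLpNorm_integral_halfOpenBox_le {a : Fin d → ℝ} {ℓ : ℝ} (hℓ : 0 < ℓ)
    {F : EuclideanSpace ℝ (Fin d) → Ω → ℝ} (hF : Measurable (Function.uncurry F))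
    {g : EuclideanSpace ℝ (Fin d) → ℝ} (hg : Measurable g) (hg1 : ∀ t, |g t| ≤ 1) {i : Fin d}
    {η : ℝ} (hη : 0 < η) (hanti : ∀ t, g (t + EuclideanSpace.single i η) = -g t) {n : ℕ}
    (hn : 2 ≤ n) {C α δ : ℝ} (hδ : 0 ≤ δ) (hδα : δ ≤ α) (hα : α ≤ 1) (hC : 0 ≤ C)
    (hFb : ∀ t ∈ halfOpenBox a fun j => a j + ℓ, eLpNorm (F t) n P ≤ ENNReal.ofReal C)
    (hFh : ∀ t ∈ halfOpenBox a fun j => a j + ℓ, ∀ t' ∈ halfOpenBox a fun j => a j + ℓ,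
      eLpNorm (fun ω => F t ω - F t' ω) n P ≤ ENNReal.ofReal (C * (‖t - t'‖ / ℓ) ^ α)) :
    eLpNorm (fun ω => ∫ t in halfOpenBox a fun j => a j + ℓ, g t * F t ω) n P ≤
      ENNReal.ofReal (2 * C * ℓ ^ d * (η / ℓ) ^ δ) := by
  set I := halfOpenBox a fun j => a j + ℓ with hI
  set h : EuclideanSpace ℝ (Fin d) := EuclideanSpace.single i η with hh
  have hIm : MeasurableSet I := measurableSet_halfOpenBox _ _
  have hvolI : volume I = ENNReal.ofReal (ℓ ^ d) := volume_halfOpenBox_of_side hℓ.le (by simp)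
  have hgF : Measurable (Function.uncurry fun t ω => g t * F t ω) :=
    (hg.comp measurable_fst).mul hF
  have hn1 : (1:ℝ≥0∞) ≤ n := by exact_mod_cast (by omega : 1 ≤ n)
  have hgFb : ∀ t ∈ I, eLpNorm (fun ω => g t * F t ω) n P ≤ ENNReal.ofReal C := by
    intro t ht
    refine (eLpNorm_mono fun ω => ?_).trans (hFb t ht)
    rw [norm_mul]
    have := hg1 t
    exact mul_le_of_le_one_left (norm_nonneg _) this
  -- integrals over subsets
  have hsub : ∀ A ⊆ I, MeasurableSet A →
      eLpNorm (fun ω => ∫ t in A, g t * F t ω) n P ≤ volume A * ENNReal.ofReal C := by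
    intro A hA hAm
    have := eLpNorm_parameter_integral_le (P := P) (ν := volume.restrict A) hgF hn
      (C := ENNReal.ofReal C) ((ae_restrict_iff' hAm).2 (ae_of_all _ fun t ht => hgFb t (hA ht)))
    simpa using this
  -- When the antiperiod exceeds the side there is no cancellation, but then (η/ℓ)^δ ≥ 1 and the
  -- size bound suffices.
  rcases lt_or_ge ℓ η with hlt | hle
  · refine (hsub I subset_rfl hIm).trans ?_
    rw [hvolI, ← ENNReal.ofReal_mul (by positivity)]
    refine ENNReal.ofReal_le_ofReal ?_
    have h1 : 1 ≤ (η / ℓ) ^ δ := Real.one_le_rpow (by rw [le_div_iff₀ hℓ]; linarith) hδ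
    have h2 : 0 ≤ C * ℓ ^ d := by positivity
    nlinarith
  have hx0 : 0 < η / ℓ := by positivity
  have hx1 : η / ℓ ≤ 1 := by rw [div_le_one hℓ]; exact hle
  have hδx : (η / ℓ) ^ α ≤ (η / ℓ) ^ δ := Real.rpow_le_rpow_of_exponent_ge hx0 hx1 hδα
  have hδx1 : η / ℓ ≤ (η / ℓ) ^ δ := by
    have := Real.rpow_le_rpow_of_exponent_ge hx0 hx1 (hδα.trans hα)
    rwa [Real.rpow_one] at this
  -- A₁ collects the points whose translate stays in the box. A₂ and A₃ are slabs of thickness η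
  -- along the two opposite faces that the translation crosses.
  set A₁ := I ∩ {t | t + h ∈ I} with hA₁
  set A₂ := I \ {t | t + h ∈ I} with hA₂
  set A₃ := I \ {t | t - h ∈ I} with hA₃
  have hplus : Measurable fun t : EuclideanSpace ℝ (Fin d) => t + h := by fun_prop
  have hminus : Measurable fun t : EuclideanSpace ℝ (Fin d) => t - h := by fun_prop
  have hA₁m : MeasurableSet A₁ := hIm.inter (hplus hIm)
  have hA₂m : MeasurableSet A₂ := hIm.diff (hplus hIm)
  have hA₃m : MeasurableSet A₃ := hIm.diff (hminus hIm)
  have hcoord : ∀ (t : EuclideanSpace ℝ (Fin d)) j, (t + h) j = t j + if j = i then η else 0 := by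
    intro t j
    simp [hh, PiLp.add_apply]
  have hcoord' : ∀ (t : EuclideanSpace ℝ (Fin d)) j, (t - h) j = t j - if j = i then η else 0 := by
    intro t j
    simp [hh, PiLp.sub_apply]
  have hv₂ : volume A₂ ≤ ENNReal.ofReal (ℓ ^ d * (η / ℓ)) := by
    rw [← volume_halfOpenBox_of_thin (a := fun j => if j = i then a j + ℓ - η else a j)
      (c := fun j => a j + ℓ) hℓ hη.le i (fun j => by split_ifs <;> ring)]
    refine measure_mono fun t ht => ?_
    have h1 := ht.1
    intro j
    have hj := h1 j
    by_cases hji : j = i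
    · subst hji
      simp only [if_true]
      refine ⟨?_, hj.2⟩
      by_contra hcon
      refine ht.2 fun k => ?_
      rw [hcoord]
      have hk := h1 k
      by_cases hkj : k = j
      · subst hkj
        simp only [if_true]
        constructor <;> linarith [hk.1, hk.2]
      · simpa [hkj] using hk
    · simpa [hji] using hj
  have hv₃ : volume A₃ ≤ ENNReal.ofReal (ℓ ^ d * (η / ℓ)) := by
    rw [← volume_halfOpenBox_of_thin (a := a)
      (c := fun j => if j = i then a j + η else a j + ℓ) hℓ hη.le i
      (fun j => by split_ifs <;> ring)]
    refine measure_mono fun t ht => ?_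
    have h1 := ht.1
    intro j
    have hj := h1 j
    by_cases hji : j = i
    · subst hji
      simp only [if_true]
      refine ⟨hj.1, ?_⟩
      by_contra hcon
      refine ht.2 fun k => ?_
      rw [hcoord']
      have hk := h1 k
      by_cases hkj : k = j
      · subst hkj
        simp only [if_true]
        constructor <;> linarith [hk.1, hk.2]
      · simpa [hkj] using hk
    · simpa [hji] using hj
  have hIfin : IsFiniteMeasure (volume.restrict I) :=
    ⟨by rw [Measure.restrict_apply_univ, hvolI]; exact ENNReal.ofReal_lt_top⟩
  have hint : ∀ᵐ ω ∂P, IntegrableOn (fun t => g t * F t ω) I := by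
    have h1 := memLp_uncurry_of_eLpNorm_le (P := P) (ν := volume.restrict I) hgF
      (n := n) (by omega) ENNReal.ofReal_ne_top
      ((ae_restrict_iff' hIm).2 (ae_of_all _ fun t ht => hgFb t ht))
    exact (h1.integrable hn1).prod_left_ae
  -- The integral is split in two ways. The part over I ∩ (I + h) is pulled back by the translation,
  -- where antiperiodicity flips the sign. Adding the two splittings leaves a difference of the
  -- field plus the slabs.
  have hid : ∀ᵐ ω ∂P, 2 * ∫ t in I, g t * F t ω =
      (∫ t in A₁, g t * (F t ω - F (t + h) ω)) + (∫ t in A₂, g t * F t ω) +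
        ∫ t in A₃, g t * F t ω := by
    filter_upwards [hint] with ω hω
    have s1 : ∫ t in I, g t * F t ω = (∫ t in A₁, g t * F t ω) + ∫ t in A₂, g t * F t ω :=
      (integral_inter_add_sdiff (hplus hIm) hω).symm
    have s2 : ∫ t in I, g t * F t ω =
        (∫ t in I ∩ {t | t - h ∈ I}, g t * F t ω) + ∫ t in A₃, g t * F t ω :=
      (integral_inter_add_sdiff (hminus hIm) hω).symm
    have hpre : (fun t => t + h) ⁻¹' (I ∩ {t | t - h ∈ I}) = A₁ := by
      ext t; simp [hA₁, and_comm]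
    have hmp : MeasurePreserving (fun t : EuclideanSpace ℝ (Fin d) => t + h) volume volume :=
      measurePreserving_add_right volume h
    have hme : MeasurableEmbedding (fun t : EuclideanSpace ℝ (Fin d) => t + h) :=
      measurableEmbedding_addRight h
    have s3 : ∫ t in I ∩ {t | t - h ∈ I}, g t * F t ω = ∫ t in A₁, -(g t * F (t + h) ω) := by
      rw [← hmp.setIntegral_preimage_emb hme, hpre]
      refine setIntegral_congr_fun hA₁m fun t _ => ?_
      rw [hanti t]; ring
    have i1 : IntegrableOn (fun t => g t * F t ω) A₁ := hω.mono_set Set.inter_subset_left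
    have i2 : IntegrableOn (fun t => g t * F (t + h) ω) A₁ := by
      have : IntegrableOn (fun t => g t * F t ω) (I ∩ {t | t - h ∈ I}) :=
        hω.mono_set Set.inter_subset_left
      rw [← hmp.integrableOn_comp_preimage hme, hpre] at this
      refine this.neg.congr_fun (fun t _ => ?_) hA₁m
      simp only [Pi.neg_apply, Function.comp]
      rw [hanti t]; ring
    have s4 : ∫ t in A₁, g t * (F t ω - F (t + h) ω) =
        (∫ t in A₁, g t * F t ω) + ∫ t in A₁, -(g t * F (t + h) ω) := by
      rw [integral_neg, ← sub_eq_add_neg, ← integral_sub i1 i2]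
      refine integral_congr_ae (ae_of_all _ fun t => ?_)
      exact mul_sub _ _ _
    rw [two_mul]
    nth_rw 1 [s1]
    rw [s2, s3, s4]; ring
  have hFshift : Measurable (Function.uncurry fun t ω => g t * (F t ω - F (t + h) ω)) := by
    refine (hg.comp measurable_fst).mul (hF.sub ?_)
    exact hF.comp ((hplus.comp measurable_fst).prodMk measurable_snd)
  have b1 : eLpNorm (fun ω => ∫ t in A₁, g t * (F t ω - F (t + h) ω)) n P ≤
      ENNReal.ofReal (C * ℓ ^ d * (η / ℓ) ^ δ) := by
    have hpt : ∀ t ∈ A₁, eLpNorm (fun ω => g t * (F t ω - F (t + h) ω)) n P ≤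
        ENNReal.ofReal (C * (η / ℓ) ^ δ) := by
      intro t ht
      refine (eLpNorm_mono (g := fun ω => F t ω - F (t + h) ω) fun ω => ?_).trans
        ((hFh t ht.1 _ ht.2).trans (ENNReal.ofReal_le_ofReal ?_))
      · rw [norm_mul]
        exact mul_le_of_le_one_left (norm_nonneg _) (hg1 t)
      · have e : ‖t - (t + h)‖ = η := by
          rw [sub_add_cancel_left, norm_neg, hh, PiLp.norm_single, Real.norm_of_nonneg hη.le]
        rw [e]
        gcongr
    have := eLpNorm_parameter_integral_le (P := P) (ν := volume.restrict A₁) hFshift hn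
      ((ae_restrict_iff' hA₁m).2 (ae_of_all _ hpt))
    refine this.trans ?_
    rw [Measure.restrict_apply_univ]
    calc volume A₁ * ENNReal.ofReal (C * (η / ℓ) ^ δ)
        ≤ ENNReal.ofReal (ℓ ^ d) * ENNReal.ofReal (C * (η / ℓ) ^ δ) := by
          rw [← hvolI]; gcongr; exact Set.inter_subset_left
      _ = ENNReal.ofReal (C * ℓ ^ d * (η / ℓ) ^ δ) := by
          rw [← ENNReal.ofReal_mul (by positivity)]; congr 1; ring
  have bthin : ∀ A ⊆ I, MeasurableSet A → volume A ≤ ENNReal.ofReal (ℓ ^ d * (η / ℓ)) →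
      eLpNorm (fun ω => ∫ t in A, g t * F t ω) n P ≤
        ENNReal.ofReal (C * ℓ ^ d * (η / ℓ) ^ δ) := by
    intro A hA hAm hv
    refine (hsub A hA hAm).trans ?_
    calc volume A * ENNReal.ofReal C
        ≤ ENNReal.ofReal (ℓ ^ d * (η / ℓ)) * ENNReal.ofReal C := by gcongr
      _ ≤ ENNReal.ofReal (C * ℓ ^ d * (η / ℓ) ^ δ) := by
          rw [← ENNReal.ofReal_mul (by positivity)]
          refine ENNReal.ofReal_le_ofReal ?_
          have : 0 ≤ C * ℓ ^ d := by positivity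
          nlinarith
  have b2 := bthin A₂ Set.sdiff_subset hA₂m hv₂
  have b3 := bthin A₃ Set.sdiff_subset hA₃m hv₃
  have m1 : StronglyMeasurable fun ω => ∫ t in A₁, g t * (F t ω - F (t + h) ω) :=
    hFshift.stronglyMeasurable.integral_prod_left
  have m2 : ∀ A, StronglyMeasurable fun ω => ∫ t in A, g t * F t ω := fun A =>
    hgF.stronglyMeasurable.integral_prod_left
  set R := C * ℓ ^ d * (η / ℓ) ^ δ with hR
  have hR0 : 0 ≤ R := by positivity
  have e : (fun ω => ∫ t in I, g t * F t ω) =ᵐ[P] (2:ℝ)⁻¹ • (fun ω =>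
      (∫ t in A₁, g t * (F t ω - F (t + h) ω)) + (∫ t in A₂, g t * F t ω) +
        ∫ t in A₃, g t * F t ω) := by
    filter_upwards [hid] with ω hω
    simp only [Pi.smul_apply, smul_eq_mul]
    rw [← hω]; ring
  rw [eLpNorm_congr_ae e, eLpNorm_const_smul]
  have hsum : eLpNorm (fun ω => (∫ t in A₁, g t * (F t ω - F (t + h) ω)) +
      (∫ t in A₂, g t * F t ω) + ∫ t in A₃, g t * F t ω) n P ≤
      ENNReal.ofReal R + ENNReal.ofReal R + ENNReal.ofReal R := by
    refine (eLpNorm_add_le (m1.add (m2 A₂)).aestronglyMeasurable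
      (m2 A₃).aestronglyMeasurable hn1).trans (add_le_add ?_ b3)
    exact (eLpNorm_add_le m1.aestronglyMeasurable (m2 A₂).aestronglyMeasurable hn1).trans
      (add_le_add b1 b2)
  -- Three contributions of size R, halved, give 3R/2, which fits under 2R.
  calc ‖(2:ℝ)⁻¹‖ₑ * _ ≤ ‖(2:ℝ)⁻¹‖ₑ * (ENNReal.ofReal R + ENNReal.ofReal R + ENNReal.ofReal R) := by
        gcongr
    _ = ENNReal.ofReal (3 / 2 * R) := by
        rw [Real.enorm_eq_ofReal (by norm_num), ← ENNReal.ofReal_add hR0 hR0,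
          ← ENNReal.ofReal_add (by positivity) hR0, ← ENNReal.ofReal_mul (by norm_num)]
        congr 1; ring
    _ ≤ ENNReal.ofReal (2 * C * ℓ ^ d * (η / ℓ) ^ δ) := by
        refine ENNReal.ofReal_le_ofReal ?_
        have : 2 * C * ℓ ^ d * (η / ℓ) ^ δ = 2 * R := by rw [hR]; ring
        linarith

end Box

/-! ### The cells of level `m` -/

section Cells

variable {d : ℕ}

lemma halfOpenCube_eq_box : halfOpenCube d = halfOpenBox (fun _ => 0) fun _ => 1 := rfl

lemma measurableSet_halfOpenCube : MeasurableSet (halfOpenCube d) :=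
  measurableSet_halfOpenBox _ _

/-- Lebesgue measure on the half-open unit cube. -/
noncomputable def cubeMeasure (d : ℕ) : Measure (halfOpenCube d) := Measure.comap Subtype.val volume

instance : IsProbabilityMeasure (cubeMeasure d) := by
  constructor
  rw [cubeMeasure, comap_subtype_coe_apply measurableSet_halfOpenCube]
  simp [halfOpenCube_eq_box, volume_halfOpenBox]

/-- The half-open cell of level `m` and index `k`, a cube of side `b⁻ᵐ`. -/
def levelCell (b m : ℕ) (k : Fin d → Fin (b ^ m)) : Set (halfOpenCube d) :=
  Subtype.val ⁻¹' halfOpenBox (fun i => (k i : ℝ) * ((b:ℝ) ^ m)⁻¹)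
    fun i => (k i : ℝ) * ((b:ℝ) ^ m)⁻¹ + ((b:ℝ) ^ m)⁻¹

lemma measurableSet_levelCell (b m : ℕ) (k : Fin d → Fin (b ^ m)) :
    MeasurableSet (levelCell b m k) :=
  measurable_subtype_coe (measurableSet_halfOpenBox _ _)

variable {b m : ℕ}

lemma mem_levelCell_iff (hb : 2 ≤ b) {k : Fin d → Fin (b ^ m)} {t : halfOpenCube d} :
    t ∈ levelCell b m k ↔ ∀ i, ⌊(b:ℝ) ^ m * t.1 i⌋₊ = k i := by
  have hbm : (0:ℝ) < (b:ℝ) ^ m := by positivity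
  refine forall_congr' fun i => ?_
  have h0 : 0 ≤ (b:ℝ) ^ m * t.1 i := mul_nonneg hbm.le (t.2 i).1
  rw [Nat.floor_eq_iff h0, Set.mem_Ico]
  beta_reduce
  rw [mul_inv_le_iff₀ hbm, ← add_one_mul, lt_mul_inv_iff₀ hbm, mul_comm _ (t.1 i)]

lemma halfOpenBox_subset_halfOpenCube (hb : 2 ≤ b) (k : Fin d → Fin (b ^ m)) :
    (halfOpenBox (fun i => (k i : ℝ) * ((b:ℝ) ^ m)⁻¹)
      fun i => (k i : ℝ) * ((b:ℝ) ^ m)⁻¹ + ((b:ℝ) ^ m)⁻¹) ⊆ halfOpenCube d := by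
  have hbm : (0:ℝ) < (b:ℝ) ^ m := by positivity
  intro t ht i
  have h1 := ht i
  have h2 : (k i : ℝ) + 1 ≤ (b:ℝ) ^ m := by exact_mod_cast (k i).2
  refine ⟨le_trans (by positivity) h1.1, h1.2.trans_le ?_⟩
  beta_reduce
  rw [← add_one_mul, mul_inv_le_iff₀ hbm]; linarith

/-- The corner of a cell. -/
noncomputable def cellCorner (b m : ℕ) (hb : 2 ≤ b) (k : Fin d → Fin (b ^ m)) : halfOpenCube d :=
  ⟨WithLp.toLp 2 fun i => (k i : ℝ) * ((b:ℝ) ^ m)⁻¹,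
    halfOpenBox_subset_halfOpenCube hb k fun i => by
      have hbm : (0:ℝ) < (b:ℝ) ^ m := by positivity
      exact ⟨le_rfl, by simpa using hbm⟩⟩

lemma norm_sub_cellCorner_le (hb : 2 ≤ b) (k : Fin d → Fin (b ^ m)) {t : halfOpenCube d}
    (ht : t ∈ levelCell b m k) :
    (b:ℝ) ^ m * ‖t.1 - (cellCorner b m hb k).1‖ ≤ √d + 1 := by
  have hbm : (0:ℝ) < (b:ℝ) ^ m := by positivity
  have h1 : ‖t.1 - (cellCorner b m hb k).1‖ ≤ √d * ((b:ℝ) ^ m)⁻¹ := by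
    rw [EuclideanSpace.norm_eq]
    have : ∑ i, ‖(t.1 - (cellCorner b m hb k).1) i‖ ^ 2 ≤ d * (((b:ℝ) ^ m)⁻¹) ^ 2 := by
      calc ∑ i, ‖(t.1 - (cellCorner b m hb k).1) i‖ ^ 2 ≤ ∑ _ : Fin d, (((b:ℝ) ^ m)⁻¹) ^ 2 := by
            refine Finset.sum_le_sum fun i _ => ?_
            have hi := ht i
            refine pow_le_pow_left₀ (norm_nonneg _) ?_ 2
            rw [PiLp.sub_apply, Real.norm_eq_abs]
            change |t.1 i - (k i : ℝ) * ((b:ℝ) ^ m)⁻¹| ≤ _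
            rw [abs_le]
            constructor <;> linarith [hi.1, hi.2, inv_pos.2 hbm]
        _ = _ := by simp
    calc √(∑ i, ‖(t.1 - (cellCorner b m hb k).1) i‖ ^ 2) ≤ √(d * (((b:ℝ) ^ m)⁻¹) ^ 2) :=
          Real.sqrt_le_sqrt this
      _ = √d * ((b:ℝ) ^ m)⁻¹ := by
          rw [Real.sqrt_mul (Nat.cast_nonneg d), Real.sqrt_sq (by positivity)]
  calc (b:ℝ) ^ m * ‖t.1 - (cellCorner b m hb k).1‖ ≤ (b:ℝ) ^ m * (√d * ((b:ℝ) ^ m)⁻¹) := by gcongr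
    _ = √d := by field_simp
    _ ≤ √d + 1 := by linarith

lemma iUnion_levelCell (hb : 2 ≤ b) :
    (⋃ k : Fin d → Fin (b ^ m), levelCell b m k) = Set.univ := by
  have hbm : (0:ℝ) < (b:ℝ) ^ m := by positivity
  refine Set.eq_univ_of_forall fun t => Set.mem_iUnion.2 ?_
  refine ⟨fun i => ⟨⌊(b:ℝ) ^ m * t.1 i⌋₊, ?_⟩, (mem_levelCell_iff hb).2 fun i => rfl⟩
  have h0 : 0 ≤ (b:ℝ) ^ m * t.1 i := mul_nonneg hbm.le (t.2 i).1
  rw [Nat.floor_lt h0]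
  push_cast
  nlinarith [(t.2 i).2]

lemma pairwise_disjoint_levelCell (hb : 2 ≤ b) :
    Pairwise (Function.onFun Disjoint fun k : Fin d → Fin (b ^ m) => levelCell b m k) := by
  intro k k' hne
  refine Set.disjoint_left.2 fun t ht ht' => hne ?_
  rw [mem_levelCell_iff hb] at ht ht'
  funext i
  exact Fin.ext ((ht i).symm.trans (ht' i))

/-- In a coordinate where the indices differ they differ by at least two, so a full cell lies
between. The inequality is strict because cells are half-open, and it must be: covariances may
survive at distance exactly b⁻ᵐ. -/
lemma dist_levelCell_gt (hb : 2 ≤ b) {k k' : Fin d → Fin (b ^ m)} (hne : k ≠ k')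
    (hpar : ∀ i, (k i : ℕ) % 2 = (k' i : ℕ) % 2) {s t : halfOpenCube d} (hs : s ∈ levelCell b m k)
    (ht : t ∈ levelCell b m k') : ((b:ℝ) ^ m)⁻¹ < ‖s.1 - t.1‖ := by
  have hbm : (0:ℝ) < (b:ℝ) ^ m := by positivity
  obtain ⟨i, hi⟩ : ∃ i, k i ≠ k' i := by
    by_contra hcon
    push Not at hcon
    exact hne (funext hcon)
  have hi' : (k i : ℕ) ≠ k' i := fun h => hi (Fin.ext h)
  refine lt_of_lt_of_le ?_ (PiLp.norm_apply_le (s.1 - t.1) i)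
  rw [PiLp.sub_apply, Real.norm_eq_abs]
  have h1 := hs i
  have h2 := ht i
  have hp := hpar i
  have hinv : 0 < ((b:ℝ) ^ m)⁻¹ := inv_pos.2 hbm
  rcases lt_or_gt_of_ne hi' with h | h
  · have : (k i : ℕ) + 2 ≤ k' i := by omega
    have h3 : (k i : ℝ) + 2 ≤ k' i := by exact_mod_cast this
    rw [lt_abs]; right
    have := mul_le_mul_of_nonneg_right h3 hinv.le
    linarith [h1.2, h2.1]
  · have : (k' i : ℕ) + 2 ≤ k i := by omega
    have h3 : (k' i : ℝ) + 2 ≤ k i := by exact_mod_cast this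
    rw [lt_abs]; left
    have := mul_le_mul_of_nonneg_right h3 hinv.le
    linarith [h1.1, h2.2]

lemma setIntegral_cubeMeasure_preimage {A : Set (EuclideanSpace ℝ (Fin d))} (hA : MeasurableSet A)
    (hAc : A ⊆ halfOpenCube d) (f : EuclideanSpace ℝ (Fin d) → ℝ) :
    ∫ t in Subtype.val ⁻¹' A, f t.1 ∂(cubeMeasure d) = ∫ t in A, f t := by
  rw [cubeMeasure, ← (MeasurableEmbedding.subtype_coe measurableSet_halfOpenCube).setIntegral_map,
    map_comap_subtype_coe measurableSet_halfOpenCube, Measure.restrict_restrict hA,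
    Set.inter_eq_left.2 hAc]

lemma cubeMeasure_levelCell (hb : 2 ≤ b) (k : Fin d → Fin (b ^ m)) :
    cubeMeasure d (levelCell b m k) = ENNReal.ofReal ((((b:ℝ) ^ m)⁻¹) ^ d) := by
  rw [cubeMeasure, comap_subtype_coe_apply measurableSet_halfOpenCube, levelCell,
    Subtype.image_preimage_coe, Set.inter_eq_right.2 (halfOpenBox_subset_halfOpenCube hb k),
    volume_halfOpenBox_of_side (ℓ := ((b:ℝ) ^ m)⁻¹) (by positivity) (fun i => by simp)]

/-- Cancellation on a subset of the cube that is a box, for a field defined on the cube. -/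
lemma eLpNorm_integral_preimage_box_le {Ω : Type*} [MeasurableSpace Ω] {P : Measure Ω}
    [IsProbabilityMeasure P] {a : Fin d → ℝ} {ℓ : ℝ} (hℓ : 0 < ℓ)
    (hbox : (halfOpenBox a fun j => a j + ℓ) ⊆ halfOpenCube d)
    {F : halfOpenCube d → Ω → ℝ} (hF : Measurable (Function.uncurry F))
    {g : EuclideanSpace ℝ (Fin d) → ℝ} (hg : Measurable g) (hg1 : ∀ t, |g t| ≤ 1) {i : Fin d}
    {η : ℝ} (hη : 0 < η) (hanti : ∀ t, g (t + EuclideanSpace.single i η) = -g t) {n : ℕ}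
    (hn : 2 ≤ n) {C α δ : ℝ} (hδ : 0 ≤ δ) (hδα : δ ≤ α) (hα : α ≤ 1) (hC : 0 ≤ C)
    (hFb : ∀ t : halfOpenCube d, t.1 ∈ (halfOpenBox a fun j => a j + ℓ) →
      eLpNorm (F t) n P ≤ ENNReal.ofReal C)
    (hFh : ∀ t : halfOpenCube d, t.1 ∈ (halfOpenBox a fun j => a j + ℓ) →
      ∀ t' : halfOpenCube d, t'.1 ∈ (halfOpenBox a fun j => a j + ℓ) →
      eLpNorm (fun ω => F t ω - F t' ω) n P ≤ ENNReal.ofReal (C * (‖t.1 - t'.1‖ / ℓ) ^ α)) :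
    eLpNorm (fun ω => ∫ t in Subtype.val ⁻¹' (halfOpenBox a fun j => a j + ℓ),
      g t.1 * F t ω ∂(cubeMeasure d)) n P ≤ ENNReal.ofReal (2 * C * ℓ ^ d * (η / ℓ) ^ δ) := by
  classical
  -- Extension by zero only serves to have a field on the whole space. The box lies in the cube, so
  -- the added values are never integrated.
  set F' : EuclideanSpace ℝ (Fin d) → Ω → ℝ := fun t ω =>
    if h : t ∈ halfOpenCube d then F ⟨t, h⟩ ω else 0 with hF'
  have hF'm : Measurable (Function.uncurry F') := by
    have hs : MeasurableSet {z : EuclideanSpace ℝ (Fin d) × Ω | z.1 ∈ halfOpenCube d} :=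
      measurable_fst measurableSet_halfOpenCube
    refine Measurable.dite (s := {z : EuclideanSpace ℝ (Fin d) × Ω | z.1 ∈ halfOpenCube d})
      (f := fun z => F ⟨z.1.1, z.2⟩ z.1.2) (g := fun _ => 0) ?_ measurable_const hs
    exact hF.comp ((measurable_fst.comp measurable_subtype_coe).subtype_mk.prodMk
      (measurable_snd.comp measurable_subtype_coe))
  have hF'e : ∀ t : halfOpenCube d, F' t.1 = F t := fun t => by
    funext ω
    simp [hF']
  have e : (fun ω => ∫ t in Subtype.val ⁻¹' (halfOpenBox a fun j => a j + ℓ),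
      g t.1 * F t ω ∂(cubeMeasure d)) =
      fun ω => ∫ t in halfOpenBox a fun j => a j + ℓ, g t * F' t ω := by
    funext ω
    rw [← setIntegral_cubeMeasure_preimage (measurableSet_halfOpenBox _ _) hbox]
    refine integral_congr_ae (ae_of_all _ fun t => ?_)
    simp only [hF'e]
  rw [e]
  refine eLpNorm_integral_halfOpenBox_le hℓ hF'm hg hg1 hη hanti hn hδ hδα hα hC ?_ ?_
  · intro t ht
    have := hFb ⟨t, hbox ht⟩ ht
    rwa [← hF'e] at this
  · intro t ht t' ht'
    have := hFh ⟨t, hbox ht⟩ ht ⟨t', hbox ht'⟩ ht'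
    rwa [← hF'e, ← hF'e] at this

end Cells

lemma aestronglyMeasurable_finset_sum_of_le {Ω κ : Type*} {G mΩ : MeasurableSpace Ω} {P : Measure Ω}
    (s : Finset κ) {f : κ → Ω → ℝ} (hf : ∀ c ∈ s, AEStronglyMeasurable[G] (f c) P) :
    AEStronglyMeasurable[G] (fun ω => ∑ c ∈ s, f c ω) P := by
  classical
  induction s using Finset.induction_on with
  | empty => simpa using aestronglyMeasurable_const
  | insert c s hcs ih =>
    simp_rw [Finset.sum_insert hcs]
    exact (hf c (Finset.mem_insert_self _ _)).add
      (ih fun c' hc' => hf c' (Finset.mem_insert_of_mem hc'))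

lemma Measurable.comp_aestronglyMeasurable_pi {Ω ι : Type*} [Fintype ι] {G mΩ : MeasurableSpace Ω}
    {P : Measure Ω} {φ : (ι → ℝ) → ℝ} (hφ : Measurable φ) {S : ι → Ω → ℝ}
    (hS : ∀ i, AEStronglyMeasurable[G] (S i) P) :
    AEStronglyMeasurable[G] (fun ω => φ fun i => S i ω) P := by
  choose T hT hTe using hS
  refine ⟨fun ω => φ fun i => T i ω, ?_, ?_⟩
  · have h1 : Measurable[G] fun ω i => T i ω :=
      @measurable_pi_lambda Ω ι (fun _ => ℝ) G _ _ fun i => (hT i).measurable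
    exact (hφ.comp h1).stronglyMeasurable
  · filter_upwards [ae_all_iff.2 hTe] with ω hω
    congr 1; funext i; exact hω i

/-! ### Orthogonality of the contributions of distant cells -/

namespace IsRegularField

variable {d : ℕ} {Ω : Type*} [mΩ : MeasurableSpace Ω] {P : Measure Ω} [IsProbabilityMeasure P]
  {ψ : ℕ → halfOpenCube d → Ω → ℝ} {v : ℕ → ℝ} {b : ℕ} {α : ℝ}

/-- The σ-algebra generated by the fields `ψ j`, `j < m`, and the values of `ψ m` on `B`. -/
abbrev pastSigma (ψ : ℕ → halfOpenCube d → Ω → ℝ) (m : ℕ) (B : Set (halfOpenCube d)) :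
    MeasurableSpace Ω :=
  MeasurableSpace.comap (fun ω => ((fun (j : Finset.range m) (t : halfOpenCube d) => ψ j t ω),
        fun s : B => ψ m s ω)) inferInstance

/-- The increment of the chaos density from level `m` to level `m + 1`. -/
noncomputable def increment (P : Measure Ω) (ψ : ℕ → halfOpenCube d → Ω → ℝ) (γ : ℝ) (m : ℕ)
    (t : halfOpenCube d) (ω : Ω) : ℝ :=
  chaosDensity P ψ γ m t ω * (expProcess P ψ γ m t ω - 1)

omit [IsProbabilityMeasure P] in
lemma increment_eq_sub (γ : ℝ) (m : ℕ) (t : halfOpenCube d) (ω : Ω) :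
    increment P ψ γ m t ω = chaosDensity P ψ γ (m + 1) t ω - chaosDensity P ψ γ m t ω := by
  simp only [increment, chaosDensity, Finset.prod_range_succ]; ring

omit [IsProbabilityMeasure P] in
lemma measurable_increment (h : IsRegularField P ψ v b α) (γ : ℝ) (m : ℕ) :
    Measurable (Function.uncurry (increment P ψ γ m)) :=
  (h.measurable_chaosDensity γ m).mul ((h.measurable_expFactor γ m).sub measurable_const)

omit [IsProbabilityMeasure P] in
lemma pastSigma_le (h : IsRegularField P ψ v b α) (m : ℕ) (B : Set (halfOpenCube d)) :
    pastSigma ψ m B ≤ mΩ := by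
  refine Measurable.comap_le (Measurable.prodMk ?_ ?_)
  · exact measurable_pi_lambda _ fun j => h.measurable_path j
  · exact measurable_pi_lambda _ fun s => h.measurable_eval m s

omit [IsProbabilityMeasure P] mΩ in
lemma measurable_pastSigma_of_lt {m j : ℕ} (hj : j < m) (B : Set (halfOpenCube d))
    (t : halfOpenCube d) : Measurable[pastSigma ψ m B] (ψ j t) := by
  have h1 : Measurable fun q : ((Finset.range m) → halfOpenCube d → ℝ) × (B → ℝ) =>
      q.1 ⟨j, Finset.mem_range.2 hj⟩ t := by fun_prop
  exact h1.comp (comap_measurable _)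

omit [IsProbabilityMeasure P] mΩ in
lemma measurable_pastSigma_of_mem {m : ℕ} {B : Set (halfOpenCube d)} {t : halfOpenCube d}
    (ht : t ∈ B) : Measurable[pastSigma ψ m B] (ψ m t) := by
  have h1 : Measurable fun q : ((Finset.range m) → halfOpenCube d → ℝ) × (B → ℝ) =>
      q.2 ⟨t, ht⟩ := by fun_prop
  exact h1.comp (comap_measurable _)

omit [IsProbabilityMeasure P] in
lemma measurable_pastSigma_chaosDensity (h : IsRegularField P ψ v b α) (γ : ℝ) (m : ℕ)
    (B : Set (halfOpenCube d)) (t : halfOpenCube d) :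
    Measurable[pastSigma ψ m B] (chaosDensity P ψ γ m t) := by
  have e : chaosDensity P ψ γ m t = fun ω =>
    Real.exp (γ * ∑ j ∈ Finset.range m, ψ j t ω - γ ^ 2 / 2 * ∑ j ∈ Finset.range m, v j) :=
    funext fun ω => h.chaosDensity_eq γ m t ω
  rw [e]
  have : Measurable[pastSigma ψ m B] fun ω => ∑ j ∈ Finset.range m, ψ j t ω :=
    Finset.measurable_fun_sum _ fun j hj =>
      measurable_pastSigma_of_lt (Finset.mem_range.1 hj) B t
  exact Real.measurable_exp.comp ((this.const_mul γ).sub_const _)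

omit [IsProbabilityMeasure P] in
lemma measurable_pastSigma_increment (h : IsRegularField P ψ v b α) (γ : ℝ) (m : ℕ)
    {B : Set (halfOpenCube d)} {t : halfOpenCube d} (ht : t ∈ B) :
    Measurable[pastSigma ψ m B] (increment P ψ γ m t) := by
  have e : expProcess P ψ γ m t = fun ω => Real.exp (γ * ψ m t ω - γ ^ 2 / 2 * v m) :=
    funext fun ω => h.expFactor_eq γ m t ω
  have h2 : Measurable[pastSigma ψ m B] (expProcess P ψ γ m t) := by
    rw [e]
    exact Real.measurable_exp.comp (((measurable_pastSigma_of_mem ht).const_mul γ).sub_const _)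
  exact (h.measurable_pastSigma_chaosDensity γ m B t).mul (h2.sub_const _)

lemma integral_expFactor (h : IsRegularField P ψ v b α) (γ : ℝ) (m : ℕ) (t : halfOpenCube d) :
    Integrable (expProcess P ψ γ m t) P ∧ ∫ ω, expProcess P ψ γ m t ω ∂P = 1 := by
  have e : expProcess P ψ γ m t = fun ω =>
      Real.exp (-(γ ^ 2 / 2 * v m)) * Real.exp (γ * ψ m t ω) := by
    funext ω; rw [h.expFactor_eq, ← Real.exp_add]; congr 1; ring
  have hg := h.hasGaussianMgf m t
  rw [e]
  refine ⟨(hg.integrable_exp γ).const_mul _, ?_⟩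
  have := hg.2 γ
  rw [mgf] at this
  rw [integral_const_mul, this, ← Real.exp_add]
  simp only [Real.exp_eq_one_iff]; ring

/-- The product of H and the density at t is measurable with respect to the past and hence
independent of the centred factor E_m(t) − 1. The integral of the product factorises without any
integrability assumption on H. -/
lemma integral_mul_increment_eq_zero (h : IsRegularField P ψ v b α) (γ : ℝ) :
    ∃ j₀ : ℕ, ∀ m ≥ j₀, ∀ (t : halfOpenCube d) (B : Set (halfOpenCube d)),
      (∀ s ∈ B, ((b : ℝ) ^ m)⁻¹ < ‖s.1 - t.1‖) → ∀ H : Ω → ℝ,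
      AEStronglyMeasurable[pastSigma ψ m B] H P → ∫ ω, H ω * increment P ψ γ m t ω ∂P = 0 := by
  obtain ⟨j₀, hj₀⟩ := h.indepFun_past
  refine ⟨j₀, fun m hm t B hB H hH => ?_⟩
  obtain ⟨H', hH', hHH'⟩ := hH
  have hle := h.pastSigma_le m B
  have hind := hj₀ m hm t B hB
  set X : Ω → ℝ := fun ω => H' ω * chaosDensity P ψ γ m t ω with hX
  have hXm : Measurable[pastSigma ψ m B] X :=
    hH'.measurable.mul (h.measurable_pastSigma_chaosDensity γ m B t)
  have hXY : IndepFun X (ψ m t) P := by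
    rw [IndepFun_iff_Indep] at hind ⊢
    exact indep_of_indep_of_le_left hind hXm.comap_le
  have hYe : (fun ω => expProcess P ψ γ m t ω - 1) =
      (fun x => Real.exp (γ * x - γ ^ 2 / 2 * v m) - 1) ∘ ψ m t := by
    funext ω; simp [h.expFactor_eq]
  have hXY' : IndepFun X (fun ω => expProcess P ψ γ m t ω - 1) P := by
    rw [hYe]
    exact hXY.comp (φ := id) measurable_id (by fun_prop)
  have hEm : Measurable (expProcess P ψ γ m t) :=
    (h.measurable_expFactor γ m).comp measurable_prodMk_left
  calc ∫ ω, H ω * increment P ψ γ m t ω ∂P = ∫ ω, X ω * (expProcess P ψ γ m t ω - 1) ∂P := by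
        refine integral_congr_ae ?_
        filter_upwards [hHH'] with ω hω
        rw [hω, hX, increment]; ring
    _ = (∫ ω, X ω ∂P) * ∫ ω, (expProcess P ψ γ m t ω - 1) ∂P :=
        hXY'.integral_fun_mul_eq_mul_integral (hXm.mono hle le_rfl).aestronglyMeasurable
          (hEm.sub_const 1).aestronglyMeasurable
    _ = 0 := by
        obtain ⟨i1, i2⟩ := h.integral_expFactor γ m t
        rw [integral_sub i1 (integrable_const _), i2]; simp

lemma memLp_increment (h : IsRegularField P ψ v b α) (hb : 2 ≤ b) (hα : 0 < α) (γ : ℝ) (m : ℕ)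
    {g : halfOpenCube d → ℝ} (hg : Measurable g) (hg1 : ∀ t, |g t| ≤ 1)
    (A : Set (halfOpenCube d)) :
    MemLp (Function.uncurry fun t ω => g t * increment P ψ γ m t ω) 2
      (((cubeMeasure d).restrict A).prod P) := by
  have key : ∀ m, MemLp (Function.uncurry (chaosDensity P ψ γ m)) 2
      (((cubeMeasure d).restrict A).prod P) := by
    intro m
    obtain ⟨C, _, hC, _⟩ := h.eLpNorm_chaosDensity_le hb hα γ m (n := 2) (by norm_num) 1
    exact memLp_uncurry_of_eLpNorm_le (h.measurable_chaosDensity γ m) (n := 2) (by norm_num)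
      ENNReal.ofReal_ne_top (ae_of_all _ hC)
  refine ((key (m + 1)).sub (key m)).of_le
    ((hg.comp measurable_fst).mul (h.measurable_increment γ m)).aestronglyMeasurable
    (ae_of_all _ fun z => ?_)
  simp only [Function.uncurry, Pi.sub_apply]
  rw [norm_mul, increment_eq_sub]
  exact mul_le_of_le_one_left (norm_nonneg _) (hg1 _)

/-- Decoupling over cells: the `p`-th moment of the increment of level `m` is controlled by those
of its restrictions to cells. -/
lemma integral_powNorm_increment_le (h : IsRegularField P ψ v b α) (hb : 2 ≤ b) (hα : 0 < α)
    (γ : ℝ) : ∃ j₀ : ℕ, ∀ m ≥ j₀, ∀ {ι : Type} [Fintype ι] (g : ι → halfOpenCube d → ℝ),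
      (∀ i, Measurable (g i)) → (∀ i t, |g i t| ≤ 1) → ∀ {k : ℕ}, 1 ≤ k → ∀ {p : ℝ}, 1 < p → p ≤ 2 →
      ∫ ω, powNorm k p (fun i => ∫ t, g i t * increment P ψ γ m t ω ∂(cubeMeasure d)) ∂P ≤
        ((2:ℝ) ^ d) ^ 2 * (2 * 4 ^ k) * ∑ κ : Fin d → Fin (b ^ m),
          ∫ ω, powNorm k p (fun i => ∫ t in levelCell b m κ,
            g i t * increment P ψ γ m t ω ∂(cubeMeasure d)) ∂P := by
  classical
  obtain ⟨j₀, hj₀⟩ := h.integral_mul_increment_eq_zero γ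
  refine ⟨j₀, fun m hm ι _ g hgm hg1 k hk p hp hp2 => ?_⟩
  set f : ι → halfOpenCube d → Ω → ℝ := fun i t ω => g i t * increment P ψ γ m t ω with hf
  have hfL : ∀ i A, MemLp (Function.uncurry (f i)) 2 (((cubeMeasure d).restrict A).prod P) :=
    fun i A => h.memLp_increment hb hα γ m (hgm i) (hg1 i) A
  set Z : (Fin d → Fin (b ^ m)) → ι → Ω → ℝ := fun κ i ω =>
    ∫ t in levelCell b m κ, f i t ω ∂(cubeMeasure d) with hZ
  have hZL : ∀ κ i, MemLp (Z κ i) 2 P := fun κ i => memLp_two_parameter_integral (hfL i _)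
  -- splitting into cells and parity classes
  let par : (Fin d → Fin (b ^ m)) → (Fin d → Fin 2) := fun κ i => ⟨(κ i : ℕ) % 2, Nat.mod_lt _ two_pos⟩
  have hsplit : ∀ᵐ ω ∂P, (fun i => ∫ t, f i t ω ∂(cubeMeasure d)) =
      ∑ c : Fin d → Fin 2, fun i => ∑ κ with par κ = c, Z κ i ω := by
    have hint : ∀ᵐ ω ∂P, ∀ i, Integrable (fun t => f i t ω) (cubeMeasure d) := by
      rw [ae_all_iff]
      intro i
      have := hfL i Set.univ
      rw [Measure.restrict_univ] at this
      exact (this.integrable one_le_two).prod_left_ae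
    filter_upwards [hint] with ω hω
    funext i
    rw [Finset.sum_apply, Finset.sum_fiberwise]
    rw [← setIntegral_univ, ← iUnion_levelCell (m := m) hb]
    exact integral_iUnion_fintype (fun κ => measurableSet_levelCell b m κ)
      (pairwise_disjoint_levelCell hb) fun κ => (hω i).integrableOn
  -- the martingale inequality inside one class
  have hclass : ∀ c : Fin d → Fin 2,
      ∫ ω, powNorm k p (fun i => ∑ κ with par κ = c, Z κ i ω) ∂P ≤
        2 * 4 ^ k * ∑ κ with par κ = c, ∫ ω, powNorm k p (fun i => Z κ i ω) ∂P := by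
    intro c
    refine integral_powNorm_sum_le hk hp hp2 _ (fun κ _ i => hZL κ i) ?_
    intro s' hs' κ hκ hκs' φ hφm hφb i
    -- The cells already summed, through which the test function depends on ψ m. The new cell shares
    -- their parity, so each of its points is at distance more than b⁻ᵐ from all of B.
    set B : Set (halfOpenCube d) := ⋃ κ' ∈ s', levelCell b m κ' with hB
    have hSmeas : ∀ i, AEStronglyMeasurable[pastSigma ψ m B] (fun ω => ∑ κ' ∈ s', Z κ' i ω) P := by
      intro i
      refine aestronglyMeasurable_finset_sum_of_le s' fun κ' hκ' => ?_
      refine aestronglyMeasurable_integral_of_forall (h.pastSigma_le m B)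
        ((hfL i _).integrable one_le_two) ?_
      refine (ae_restrict_iff' (measurableSet_levelCell b m κ')).2 (ae_of_all _ fun t ht => ?_)
      have htB : t ∈ B := Set.mem_biUnion hκ' ht
      exact ((h.measurable_pastSigma_increment γ m htB).const_mul (g i t)).stronglyMeasurable
    have hHmeas : AEStronglyMeasurable[pastSigma ψ m B]
        (fun ω => φ fun i => ∑ κ' ∈ s', Z κ' i ω) P := hφm.comp_aestronglyMeasurable_pi hSmeas
    have hHL : MemLp (fun ω => φ fun i => ∑ κ' ∈ s', Z κ' i ω) 2 P :=
      memLp_two_comp_of_linear_growth (S := fun i ω => ∑ κ' ∈ s', Z κ' i ω) hφm hφb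
        fun i => memLp_finsetSum _ fun κ' _ => hZL κ' i
    refine integral_mul_parameter_integral_eq_zero hHL (hfL i _) ?_
    refine (ae_restrict_iff' (measurableSet_levelCell b m κ)).2 (ae_of_all _ fun t ht => ?_)
    have h0 := hj₀ m hm t B (fun s hs => ?_) _ hHmeas
    · calc ∫ ω, (φ fun i => ∑ κ' ∈ s', Z κ' i ω) * f i t ω ∂P
          = ∫ ω, g i t * ((φ fun i => ∑ κ' ∈ s', Z κ' i ω) * increment P ψ γ m t ω) ∂P := by
            congr 1; funext ω; simp only [hf]; ring
        _ = 0 := by rw [integral_const_mul, h0, mul_zero]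
    · obtain ⟨κ', hκ', hsκ'⟩ := Set.mem_iUnion₂.1 hs
      have hne : κ' ≠ κ := fun e => hκs' (e ▸ hκ')
      refine dist_levelCell_gt hb hne (fun j => ?_) hsκ' ht
      have e1 := (Finset.mem_filter.1 (hs' hκ')).2
      have e2 := (Finset.mem_filter.1 hκ).2
      have := congrFun (e1.trans e2.symm) j
      exact congrArg Fin.val this
  have hp0 : 0 < p := by linarith
  have hclassInt : ∀ c : Fin d → Fin 2,
      Integrable (fun ω => powNorm k p (fun i => ∑ κ with par κ = c, Z κ i ω)) P := fun c =>
    integrable_powNorm hk hp0.le hp2 (S := fun i ω => ∑ κ with par κ = c, Z κ i ω)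
      fun i => memLp_finsetSum _ fun κ _ => hZL κ i
  calc ∫ ω, powNorm k p (fun i => ∫ t, f i t ω ∂(cubeMeasure d)) ∂P
      ≤ ∫ ω, ((2:ℝ) ^ d) ^ 2 *
          ∑ c : Fin d → Fin 2, powNorm k p (fun i => ∑ κ with par κ = c, Z κ i ω) ∂P := by
        refine integral_mono_of_nonneg (ae_of_all _ fun ω => powNorm_nonneg _ _ _)
          ((integrable_finsetSum _ fun c _ => hclassInt c).const_mul _) ?_
        filter_upwards [hsplit] with ω hω
        rw [hω]
        -- No orthogonality holds between different parity classes, so the 2^d classes are merged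
        -- crudely, at the price of the square of their number.
        refine (powNorm_sum_le k hk hp0 hp2 _ _).trans (le_of_eq ?_)
        simp
    _ = ((2:ℝ) ^ d) ^ 2 * ∑ c : Fin d → Fin 2,
          ∫ ω, powNorm k p (fun i => ∑ κ with par κ = c, Z κ i ω) ∂P := by
        rw [integral_const_mul, integral_finsetSum _ fun c _ => hclassInt c]
    _ ≤ ((2:ℝ) ^ d) ^ 2 * ∑ c : Fin d → Fin 2,
          2 * 4 ^ k * ∑ κ with par κ = c, ∫ ω, powNorm k p (fun i => Z κ i ω) ∂P := by
        gcongr with c _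
        exact hclass c
    _ = _ := by
        rw [← Finset.mul_sum, Finset.sum_fiberwise, ← mul_assoc]

end IsRegularField

/-! ### The moment estimate for one level -/

section CellMoment

variable {Ω : Type*} [MeasurableSpace Ω] {P : Measure Ω} {ι : Type*} [Fintype ι]

lemma powNorm_const_mul (k : ℕ) (hk : 1 ≤ k) {p : ℝ} (c : ℝ) (hc : 0 ≤ c) (x : ι → ℝ) :
    powNorm k p (fun i => c * x i) = c ^ p * powNorm k p x := by
  have hk' : (0:ℝ) < k := by exact_mod_cast hk
  unfold powNorm
  simp_rw [mul_pow]
  rw [← Finset.mul_sum, Real.mul_rpow (by positivity) (sum_even_pow_nonneg k x),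
    ← Real.rpow_natCast, ← Real.rpow_mul hc]
  congr 2; push_cast; field_simp

lemma abs_rpow_le_powNorm (k : ℕ) (hk : 1 ≤ k) {p : ℝ} (hp : 0 ≤ p) (x : ι → ℝ) (i : ι) :
    |x i| ^ p ≤ powNorm k p x := by
  have hk' : (0:ℝ) < k := by exact_mod_cast hk
  have h1 : |x i| ^ (2 * k) ≤ ∑ i, x i ^ (2 * k) := by
    rw [(even_two_mul k).pow_abs]
    exact Finset.single_le_sum (f := fun i => x i ^ (2 * k))
      (fun i _ => by rw [pow_mul]; positivity) (Finset.mem_univ i)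
  calc |x i| ^ p = (|x i| ^ (2 * k)) ^ (p / (2 * k)) := by
        rw [← Real.rpow_natCast, ← Real.rpow_mul (abs_nonneg _)]
        congr 1; push_cast; field_simp
    _ ≤ powNorm k p x := Real.rpow_le_rpow (by positivity) h1 (by positivity)

/-- Hölder with exponents 2k/(2k − p) for D^p and 2k/p for the p-th power of the norm. The second
factor reduces to the sum of the 2k-th moments of the coordinates, so their number enters only to
the power p/(2k). -/
lemma lintegral_powNorm_mul_le {D : Ω → ℝ} (hD : Measurable D) (hD0 : ∀ ω, 0 ≤ D ω)
    {X : ι → Ω → ℝ} (hX : ∀ i, Measurable (X i)) {k : ℕ} (hk : 1 ≤ k) {p : ℝ} (hp : 0 < p)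
    (hpk : p < 2 * k) {A : ℝ} (hA : 0 ≤ A)
    (hXA : ∀ i, eLpNorm (X i) (2 * k : ℕ) P ≤ ENNReal.ofReal A) {E : ℝ}
    (hE : ∫⁻ ω, ENNReal.ofReal (D ω ^ (p * (2 * k / (2 * k - p)))) ∂P ≤
      ENNReal.ofReal (Real.exp E)) :
    ∫⁻ ω, ENNReal.ofReal (powNorm k p fun i => D ω * X i ω) ∂P ≤
      ENNReal.ofReal (Real.exp (E * ((2 * k - p) / (2 * k))) *
        ((Fintype.card ι : ℝ) ^ (p / (2 * k)) * A ^ p)) := by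
  have hk' : (0:ℝ) < k := by exact_mod_cast hk
  set q : ℝ := 2 * k / p with hq
  set r : ℝ := 2 * k / (2 * k - p) with hr
  have hkp : 0 < 2 * (k:ℝ) - p := by linarith
  have hq0 : 0 < q := by positivity
  have hr0 : 0 < r := by positivity
  have hrq : r.HolderConjugate q := by
    rw [Real.holderConjugate_iff]
    refine ⟨by rw [hr, lt_div_iff₀ hkp]; linarith, ?_⟩
    rw [hr, hq, inv_div, inv_div]; field_simp; ring
  have hS : ∀ ω, 0 ≤ ∑ i, X i ω ^ (2 * k) := fun ω => sum_even_pow_nonneg k _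
  have hSm : Measurable fun ω => ∑ i, X i ω ^ (2 * k) :=
    Finset.measurable_fun_sum _ fun i _ => (hX i).pow_const _
  have e1 : ∀ ω, ENNReal.ofReal (powNorm k p fun i => D ω * X i ω) =
      ENNReal.ofReal (D ω ^ p) * ENNReal.ofReal ((∑ i, X i ω ^ (2 * k)) ^ (p / (2 * k))) := by
    intro ω
    rw [powNorm_const_mul k hk _ (hD0 ω), ENNReal.ofReal_mul (Real.rpow_nonneg (hD0 ω) _)]
    rfl
  simp_rw [e1]
  have hol := ENNReal.lintegral_mul_le_Lp_mul_Lq P hrq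
    (f := fun ω => ENNReal.ofReal (D ω ^ p))
    (g := fun ω => ENNReal.ofReal ((∑ i, X i ω ^ (2 * k)) ^ (p / (2 * k))))
    (hD.pow_const p).ennreal_ofReal.aemeasurable (hSm.pow_const _).ennreal_ofReal.aemeasurable
  refine hol.trans ?_
  rw [ENNReal.ofReal_mul (Real.exp_pos _).le]
  gcongr ?_ * ?_
  · have e2 : ∀ ω, ENNReal.ofReal (D ω ^ p) ^ r = ENNReal.ofReal (D ω ^ (p * r)) := by
      intro ω
      rw [ENNReal.ofReal_rpow_of_nonneg (Real.rpow_nonneg (hD0 ω) _) hr0.le,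
        ← Real.rpow_mul (hD0 ω)]
    simp_rw [e2]
    refine (ENNReal.rpow_le_rpow hE (by positivity)).trans (le_of_eq ?_)
    rw [ENNReal.ofReal_rpow_of_nonneg (Real.exp_pos _).le (by positivity), ← Real.exp_mul]
    congr 3; rw [hr, one_div, inv_div]
  · have e3 : ∀ ω, ENNReal.ofReal ((∑ i, X i ω ^ (2 * k)) ^ (p / (2 * k))) ^ q =
        ∑ i, ‖X i ω‖ₑ ^ ((2 * k : ℕ) : ℝ) := by
      intro ω
      rw [ENNReal.ofReal_rpow_of_nonneg (Real.rpow_nonneg (hS ω) _) hq0.le, ← Real.rpow_mul (hS ω)]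
      have : p / (2 * k) * q = 1 := by rw [hq]; field_simp
      rw [this, Real.rpow_one, ENNReal.ofReal_sum_of_nonneg
        (fun i _ => by rw [pow_mul]; positivity)]
      refine Finset.sum_congr rfl fun i _ => ?_
      rw [ENNReal.rpow_natCast, Real.enorm_eq_ofReal_abs, ← ENNReal.ofReal_pow (abs_nonneg _),
        (even_two_mul k).pow_abs]
    simp_rw [e3]
    rw [lintegral_finsetSum _ fun i _ => (hX i).enorm.pow_const _]
    have hn0 : ((2 * k : ℕ):ℝ≥0∞) ≠ 0 := by exact_mod_cast (by omega : 2 * k ≠ 0)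
    have hnr : (0:ℝ) < ((2 * k : ℕ) : ℝ) := by push_cast; positivity
    have h4 : ∀ i, ∫⁻ ω, ‖X i ω‖ₑ ^ ((2 * k : ℕ) : ℝ) ∂P ≤ ENNReal.ofReal (A ^ (2 * k)) := by
      intro i
      have := hXA i
      rw [eLpNorm_eq_lintegral_rpow_enorm_toReal hn0 (ENNReal.natCast_ne_top _)] at this
      simp only [ENNReal.toReal_natCast] at this
      rw [one_div, ENNReal.rpow_inv_le_iff hnr] at this
      rwa [ENNReal.rpow_natCast _ (2 * k), ← ENNReal.ofReal_pow hA] at this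
    have h5 : ∑ i, ∫⁻ ω, ‖X i ω‖ₑ ^ ((2 * k : ℕ) : ℝ) ∂P ≤
        ENNReal.ofReal ((Fintype.card ι : ℝ) * A ^ (2 * k)) := by
      refine (Finset.sum_le_sum fun i _ => h4 i).trans (le_of_eq ?_)
      rw [Finset.sum_const, nsmul_eq_mul, ENNReal.ofReal_mul (Nat.cast_nonneg _),
        ENNReal.ofReal_natCast]
      rfl
    refine (ENNReal.rpow_le_rpow h5 (by positivity)).trans (le_of_eq ?_)
    rw [ENNReal.ofReal_rpow_of_nonneg (by positivity) (by positivity),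
      Real.mul_rpow (Nat.cast_nonneg _) (by positivity), ← Real.rpow_natCast, ← Real.rpow_mul hA]
    have : 1 / q = p / (2 * k) := by rw [hq, one_div, inv_div]
    rw [this]
    congr 3; push_cast; field_simp

end CellMoment

/-! ### Decay exponents and the moment bound for one level -/

/-- The exponent of decay of the `p`-th moments of the increments, in terms of the auxiliary
parameters `k` (for the `ℓ^{2k}` norm) and `ε` (for the growth of the variance). -/
noncomputable def levelExponent (d : ℕ) (γ p : ℝ) (k : ℕ) (ε : ℝ) : ℝ :=
  d * (p - 1) - γ ^ 2 / 2 * (p ^ 2 * (2 * k / (2 * k - p)) - p) * (1 + ε)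

lemma tendsto_levelExponent (d : ℕ) (γ p : ℝ) :
    Tendsto (fun k : ℕ => levelExponent d γ p k (1 / k)) atTop
      (𝓝 (d * (p - 1) - γ ^ 2 / 2 * (p ^ 2 - p))) := by
  have h1 : Tendsto (fun k : ℕ => 2 * (k:ℝ)) atTop atTop :=
    tendsto_natCast_atTop_atTop.const_mul_atTop (by norm_num)
  have h2 : Tendsto (fun k : ℕ => (2 * (k:ℝ)) / (2 * k - p)) atTop (𝓝 1) := by
    have h3 : Tendsto (fun k : ℕ => 1 - p / (2 * (k:ℝ))) atTop (𝓝 (1 - 0)) :=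
      tendsto_const_nhds.sub (tendsto_const_nhds.div_atTop h1)
    have h4 := h3.inv₀ (by norm_num)
    simp only [sub_zero, inv_one] at h4
    refine h4.congr' ?_
    filter_upwards [eventually_gt_atTop 0] with k hk
    have hk' : (0:ℝ) < k := by exact_mod_cast hk
    rw [← one_div, show 1 - p / (2 * (k:ℝ)) = (2 * k - p) / (2 * k) by field_simp, one_div_div]
  have h5 : Tendsto (fun k : ℕ => 1 / (k:ℝ)) atTop (𝓝 0) :=
    tendsto_const_nhds.div_atTop tendsto_natCast_atTop_atTop
  unfold levelExponent
  have := (tendsto_const_nhds (x := (d:ℝ) * (p - 1))).sub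
    ((((h2.const_mul (p ^ 2)).sub_const p).const_mul (γ ^ 2 / 2)).mul (h5.const_add 1))
  simpa using this

/-- The optimal choice of the moment `p`. -/
lemma exists_moment_exponent {d : ℕ} {γ : ℝ} (hγ : 0 < γ ∧ γ < √(2 * d)) :
    ∃ p : ℝ, 1 < p ∧ p ≤ 2 ∧
      d * (p - 1) - γ ^ 2 / 2 * (p ^ 2 - p) = p * (gmcExponent γ d / 2) := by
  have hs : √(2 * d) ^ 2 = 2 * (d:ℝ) := Real.sq_sqrt (by positivity)
  unfold gmcExponent
  split_ifs with h
  · exact ⟨2, by norm_num, le_rfl, by ring⟩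
  -- The quantity (p − 1)(d/p − γ²/2) has its maximum at p = √(2d)/γ, which lies in (1,2] exactly
  -- when √(2d)/2 ≤ γ < √(2d). For smaller γ the endpoint p = 2 is used.
  · have hγ0 := hγ.1
    refine ⟨√(2 * d) / γ, by rw [lt_div_iff₀ hγ0]; linarith [hγ.2],
      by rw [div_le_iff₀ hγ0]; linarith, ?_⟩
    set s := √(2 * (d:ℝ)) with hsdef
    have hd : (d:ℝ) = s ^ 2 / 2 := by rw [hs]; ring
    rw [hd]
    field_simp

lemma gmcExponent_pos {d : ℕ} {γ : ℝ} (hγ : 0 < γ ∧ γ < √(2 * d)) : 0 < gmcExponent γ d := by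
  have hs : √(2 * d) ^ 2 = 2 * (d:ℝ) := Real.sq_sqrt (by positivity)
  have hs0 : 0 ≤ √(2 * (d:ℝ)) := Real.sqrt_nonneg _
  unfold gmcExponent
  split_ifs with h
  · nlinarith [hγ.1]
  · have : 0 < √(2 * (d:ℝ)) - γ := by linarith [hγ.2]
    positivity

/-- Needed because the supremum defining the Fourier dimension runs over D < d only. -/
lemma gmcExponent_lt {d : ℕ} (hd : 1 ≤ d) {γ : ℝ} (hγ : 0 < γ ∧ γ < √(2 * d)) :
    gmcExponent γ d < d := by
  have hs : √(2 * d) ^ 2 = 2 * (d:ℝ) := Real.sq_sqrt (by positivity)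
  have hs0 : 0 ≤ √(2 * (d:ℝ)) := Real.sqrt_nonneg _
  have hd' : (1:ℝ) ≤ d := by exact_mod_cast hd
  unfold gmcExponent
  split_ifs with h
  · nlinarith [hγ.1]
  · nlinarith [hγ.1, hγ.2]

namespace IsRegularField

variable {d : ℕ} {Ω : Type*} [mΩ : MeasurableSpace Ω] {P : Measure Ω} [IsProbabilityMeasure P]
  {ψ : ℕ → halfOpenCube d → Ω → ℝ} {v : ℕ → ℝ} {b : ℕ} {α : ℝ}

omit [IsProbabilityMeasure P] in
lemma chaosDensity_nonneg (h : IsRegularField P ψ v b α) (γ : ℝ) (m : ℕ) (t : halfOpenCube d)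
    (ω : Ω) : 0 ≤ chaosDensity P ψ γ m t ω := by
  rw [h.chaosDensity_eq]; positivity

/-- There are b^{md} cells. Each contributes the p-th power of its volume b^{-md}, the moment of the
density at its corner, and a local integral that is assumed to be of relative size A. Counting
powers of b^m gives `levelExponent`. -/
lemma lintegral_powNorm_increment_le (h : IsRegularField P ψ v b α) (hb : 2 ≤ b) (hα : 0 < α)
    (γ : ℝ) {k : ℕ} (hk : 1 ≤ k) {p : ℝ} (hp : 1 < p) (hp2 : p ≤ 2) (hpk : p < 2 * k) {ε : ℝ}
    (hε : 0 < ε) :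
    ∃ (j₀ : ℕ) (C : ℝ), 0 ≤ C ∧ ∀ m ≥ j₀, ∀ {ι : Type} [Fintype ι] (g : ι → halfOpenCube d → ℝ),
      (∀ i, Measurable (g i)) → (∀ i t, |g i t| ≤ 1) → ∀ {A : ℝ}, 0 ≤ A →
      (∀ (κ : Fin d → Fin (b ^ m)) (i : ι), eLpNorm (fun ω => ∫ t in levelCell b m κ,
        g i t * localIncrement P ψ γ m (cellCorner b m hb κ) t ω ∂(cubeMeasure d)) (2 * k : ℕ) P ≤
          ENNReal.ofReal (A * (((b:ℝ) ^ m)⁻¹) ^ d)) →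
      ∫⁻ ω, ENNReal.ofReal (powNorm k p
        (fun i => ∫ t, g i t * increment P ψ γ m t ω ∂(cubeMeasure d))) ∂P ≤
        ENNReal.ofReal (C * ((Fintype.card ι : ℝ) ^ (p / (2 * k)) * A ^ p) *
          ((b:ℝ) ^ (-levelExponent d γ p k ε)) ^ m) := by
  have hb0 : (0:ℝ) < b := by positivity
  have hk' : (1:ℝ) ≤ k := by exact_mod_cast hk
  have hkp : 0 < 2 * (k:ℝ) - p := by linarith
  obtain ⟨j₀, hj₀⟩ := h.integral_powNorm_increment_le hb hα γ
  obtain ⟨G, hG⟩ := h.growth ε hε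
  set r : ℝ := 2 * k / (2 * k - p) with hr
  have hr1 : 1 ≤ r := by rw [hr, le_div_iff₀ hkp]; linarith
  set e : ℝ := γ ^ 2 / 2 * (p ^ 2 * r - p) with he
  have he0 : 0 ≤ e := by
    have : p ≤ p ^ 2 * r := by nlinarith
    have : 0 ≤ p ^ 2 * r - p := by linarith
    positivity
  set c₀ : ℝ := ((2:ℝ) ^ d) ^ 2 * (2 * 4 ^ k) with hc₀
  refine ⟨j₀, c₀ * Real.exp (e * G), by positivity, fun m hm ι _ g hg hg1 A hA hcell => ?_⟩
  set V := ∑ j ∈ Finset.range m, v j with hV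
  set N : ℝ := (b:ℝ) ^ m with hN
  have hN0 : 0 < N := by positivity
  set Q : ℝ := (Fintype.card ι : ℝ) ^ (p / (2 * k)) with hQ
  have hQ0 : 0 ≤ Q := by positivity
  have hmeasInc : ∀ i, Measurable fun ω => ∫ t, g i t * increment P ψ γ m t ω ∂(cubeMeasure d) := by
    intro i
    exact (((hg i).comp measurable_fst).mul
      (h.measurable_increment γ m)).stronglyMeasurable.integral_prod_left.measurable
  have hcellbound : ∀ κ : Fin d → Fin (b ^ m), ∫ ω, powNorm k p (fun i => ∫ t in levelCell b m κ,
      g i t * increment P ψ γ m t ω ∂(cubeMeasure d)) ∂P ≤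
      Real.exp (e * V) * (Q * (A * (N⁻¹) ^ d) ^ p) := by
    intro κ
    set t₀ := cellCorner b m hb κ
    have hXm : ∀ i, Measurable fun ω => ∫ t in levelCell b m κ,
        g i t * localIncrement P ψ γ m t₀ t ω ∂(cubeMeasure d) := fun i =>
      (((hg i).comp measurable_fst).mul
        (h.measurable_localIncrement γ m t₀)).stronglyMeasurable.integral_prod_left.measurable
    have hDm : Measurable (chaosDensity P ψ γ m t₀) :=
      (h.measurable_chaosDensity γ m).comp measurable_prodMk_left
    have key := lintegral_powNorm_mul_le (P := P) (ι := ι) hDm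
      (h.chaosDensity_nonneg γ m t₀) hXm hk (by linarith) hpk (A := A * (N⁻¹) ^ d)
      (by positivity) (hcell κ) (h.lintegral_chaosDensity_rpow γ m t₀ _).le
    have e1 : (fun ω => powNorm k p (fun i => ∫ t in levelCell b m κ,
        g i t * increment P ψ γ m t ω ∂(cubeMeasure d))) = fun ω => powNorm k p fun i =>
        chaosDensity P ψ γ m t₀ ω * ∫ t in levelCell b m κ,
          g i t * localIncrement P ψ γ m t₀ t ω ∂(cubeMeasure d) := by
      funext ω; congr 1; funext i
      rw [← integral_const_mul]
      refine integral_congr_ae (ae_of_all _ fun t => ?_)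
      simp only [increment]
      rw [h.chaosDensity_mul_sub_one γ m t₀]; ring
    rw [e1]
    have hpm : Measurable fun ω => powNorm k p fun i =>
        chaosDensity P ψ γ m t₀ ω * ∫ t in levelCell b m κ,
          g i t * localIncrement P ψ γ m t₀ t ω ∂(cubeMeasure d) :=
      (measurable_powNorm k p).comp (measurable_pi_lambda _ fun i => hDm.mul (hXm i))
    rw [integral_eq_lintegral_of_nonneg_ae (ae_of_all _ fun ω => powNorm_nonneg _ _ _)
      hpm.aestronglyMeasurable]
    refine ENNReal.toReal_le_of_le_ofReal (by positivity) (key.trans (le_of_eq ?_))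
    congr 3
    rw [he]
    -- The moment of order pr is taken to the power 1/r by Hölder, which turns (pr)² − pr into p²r −
    -- p.
    have : γ ^ 2 / 2 * ((p * r) ^ 2 - p * r) * V * ((2 * k - p) / (2 * k)) =
        γ ^ 2 / 2 * (p ^ 2 * r - p) * V := by
      have h1 : (2 * (k:ℝ) - p) / (2 * k) = r⁻¹ := by rw [hr, inv_div]
      have : r ≠ 0 := by linarith
      rw [h1]; field_simp
    exact this
  have hmain := hj₀ m hm g hg hg1 hk hp hp2
  have hint : Integrable (fun ω => powNorm k p
      (fun i => ∫ t, g i t * increment P ψ γ m t ω ∂(cubeMeasure d))) P := by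
    refine integrable_powNorm hk (by linarith) hp2
      (S := fun i ω => ∫ t, g i t * increment P ψ γ m t ω ∂(cubeMeasure d)) fun i => ?_
    have := h.memLp_increment hb hα γ m (hg i) (hg1 i) Set.univ
    rw [Measure.restrict_univ] at this
    exact memLp_two_parameter_integral this
  rw [← ofReal_integral_eq_lintegral_ofReal hint (ae_of_all _ fun ω => powNorm_nonneg _ _ _)]
  refine ENNReal.ofReal_le_ofReal ?_
  calc ∫ ω, powNorm k p (fun i => ∫ t, g i t * increment P ψ γ m t ω ∂(cubeMeasure d)) ∂P
      ≤ c₀ * ∑ κ : Fin d → Fin (b ^ m), ∫ ω, powNorm k p (fun i => ∫ t in levelCell b m κ,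
            g i t * increment P ψ γ m t ω ∂(cubeMeasure d)) ∂P := hmain
    _ ≤ c₀ * ∑ _ : Fin d → Fin (b ^ m), Real.exp (e * V) * (Q * (A * (N⁻¹) ^ d) ^ p) := by
        gcongr with κ _
        exact hcellbound κ
    _ = c₀ * (N ^ d * (Real.exp (e * V) * (Q * (A * (N⁻¹) ^ d) ^ p))) := by
        rw [Finset.sum_const, nsmul_eq_mul]
        simp [hN]
    _ ≤ c₀ * (N ^ d * (Real.exp (e * (G + (1 + ε) * (m * Real.log b))) *
          (Q * (A * (N⁻¹) ^ d) ^ p))) := by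
        have := hG m
        gcongr
    _ = c₀ * Real.exp (e * G) * (Q * A ^ p) * ((b:ℝ) ^ (-levelExponent d γ p k ε)) ^ m := by
        have hNd : ((N⁻¹) ^ d) ^ p = Real.exp (-(m * Real.log b * d * p)) := by
          have : N⁻¹ = Real.exp (-(m * Real.log b)) := by
            rw [Real.exp_neg, mul_comm, Real.exp_mul, Real.exp_log hb0, Real.rpow_natCast]
          rw [this, ← Real.exp_nat_mul, ← Real.exp_mul]
          congr 1; ring
        have hNd2 : N ^ d = Real.exp (m * Real.log b * d) := by
          have : N = Real.exp (m * Real.log b) := by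
            rw [mul_comm, Real.exp_mul, Real.exp_log hb0, Real.rpow_natCast]
          rw [this, ← Real.exp_nat_mul]
          congr 1; ring
        have hbm : ((b:ℝ) ^ (-levelExponent d γ p k ε)) ^ m =
            Real.exp (-(m * Real.log b * levelExponent d γ p k ε)) := by
          rw [Real.rpow_def_of_pos hb0, ← Real.exp_nat_mul]
          congr 1; ring
        rw [Real.mul_rpow hA (by positivity), hNd, hNd2, hbm]
        have hexp : Real.exp (m * Real.log b * d) *
            Real.exp (e * (G + (1 + ε) * (m * Real.log b))) *
            Real.exp (-(m * Real.log b * d * p)) =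
            Real.exp (e * G) * Real.exp (-(m * Real.log b * levelExponent d γ p k ε)) := by
          rw [← Real.exp_add, ← Real.exp_add, ← Real.exp_add]
          congr 1
          rw [levelExponent, ← hr, he]; ring
        linear_combination (c₀ * (Q * A ^ p)) * hexp

end IsRegularField

/-! ### Decay of the increments -/

namespace IsRegularField

variable {d : ℕ} {Ω : Type*} [mΩ : MeasurableSpace Ω] {P : Measure Ω} [IsProbabilityMeasure P]
  {ψ : ℕ → halfOpenCube d → Ω → ℝ} {v : ℕ → ℝ} {b : ℕ} {α : ℝ}

/-- One bounded test function and no oscillation: the local integrals have the trivial relative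
size, and Jensen passes from the p-th moment to the first. This drives both existence and
non-degeneracy. -/
lemma exists_lintegral_increment_le (h : IsRegularField P ψ v b α) (hb : 2 ≤ b) (hα : 0 < α)
    {γ : ℝ} (hγ : 0 < γ ∧ γ < √(2 * d)) :
    ∃ (j₀ : ℕ) (C ρ : ℝ), 0 ≤ C ∧ 0 < ρ ∧ ρ < 1 ∧ ∀ m ≥ j₀, ∀ g : halfOpenCube d → ℝ,
      Measurable g → (∀ t, |g t| ≤ 1) →
      ∫⁻ ω, ‖∫ t, g t * increment P ψ γ m t ω ∂(cubeMeasure d)‖ₑ ∂P ≤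
        ENNReal.ofReal (C * ρ ^ m) := by
  have hb1 : (1:ℝ) < b := by exact_mod_cast hb
  have hb0 : (0:ℝ) < b := by linarith
  obtain ⟨p, hp, hp2, hpe⟩ := exists_moment_exponent hγ
  have hp0 : 0 < p := by linarith
  have hlim := tendsto_levelExponent d γ p
  rw [hpe] at hlim
  have hpos : 0 < p * (gmcExponent γ d / 2) := by have := gmcExponent_pos hγ; positivity
  obtain ⟨k, hk0, hk2⟩ := ((hlim.eventually (lt_mem_nhds hpos)).and (eventually_ge_atTop 2)).exists
  have hk2' : (2:ℝ) ≤ k := by exact_mod_cast hk2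
  obtain ⟨j₀, C, hC, hmain⟩ := h.lintegral_powNorm_increment_le hb hα γ (k := k) (by omega) hp hp2
    (by linarith) (ε := 1 / k) (by positivity)
  obtain ⟨C₁, hC₁, hW⟩ := h.eLpNorm_localIncrement_le hb hα γ (n := 2 * k) (by omega)
    (√d + 1)
  set β := levelExponent d γ p k (1 / k) with hβ
  refine ⟨j₀, (C * C₁ ^ p) ^ (1 / p), ((b:ℝ) ^ (-β)) ^ (1 / p), by positivity, by positivity, ?_,
    fun m hm g hg hg1 => ?_⟩
  · refine Real.rpow_lt_one (by positivity) ?_ (by positivity)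
    exact Real.rpow_lt_one_of_one_lt_of_neg hb1 (by linarith)
  have h1 := hmain m hm (ι := Unit) (fun _ => g) (fun _ => hg) (fun _ => hg1) hC₁ (fun κ _ => by
    have hmeas : Measurable (Function.uncurry fun t ω =>
        g t * localIncrement P ψ γ m (cellCorner b m hb κ) t ω) :=
      (hg.comp measurable_fst).mul (h.measurable_localIncrement γ m _)
    refine (eLpNorm_parameter_integral_le (P := P) (ν := (cubeMeasure d).restrict (levelCell b m κ))
      hmeas (n := 2 * k) (by omega) (C := ENNReal.ofReal C₁) ?_).trans (le_of_eq ?_)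
    · refine (ae_restrict_iff' (measurableSet_levelCell b m κ)).2 (ae_of_all _ fun t ht => ?_)
      refine (eLpNorm_mono fun ω => ?_).trans ((hW m _).1 t (norm_sub_cellCorner_le hb κ ht))
      rw [norm_mul]
      exact mul_le_of_le_one_left (norm_nonneg _) (hg1 t)
    · rw [Measure.restrict_apply_univ, cubeMeasure_levelCell hb, mul_comm,
        ← ENNReal.ofReal_mul hC₁])
  simp only [Fintype.card_unit, Nat.cast_one, Real.one_rpow, one_mul] at h1
  have hmeas : Measurable fun ω => ∫ t, g t * increment P ψ γ m t ω ∂(cubeMeasure d) :=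
    ((hg.comp measurable_fst).mul
      (h.measurable_increment γ m)).stronglyMeasurable.integral_prod_left.measurable
  have h2 := lintegral_rpow_le_measure_univ_mul (ν := P) hmeas.enorm.aemeasurable hp
  simp only [measure_univ, ENNReal.one_rpow, one_mul] at h2
  have h3 : ∫⁻ ω, ‖∫ t, g t * increment P ψ γ m t ω ∂(cubeMeasure d)‖ₑ ^ p ∂P ≤
      ENNReal.ofReal (C * C₁ ^ p * ((b:ℝ) ^ (-β)) ^ m) := by
    refine le_trans (lintegral_mono fun ω => ?_) h1
    rw [Real.enorm_eq_ofReal_abs, ENNReal.ofReal_rpow_of_nonneg (abs_nonneg _) hp0.le]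
    refine ENNReal.ofReal_le_ofReal ?_
    exact abs_rpow_le_powNorm k (by omega) hp0.le
      (fun _ : Unit => ∫ t, g t * increment P ψ γ m t ω ∂(cubeMeasure d)) ()
  have h4 := h2.trans h3
  rw [← ENNReal.le_rpow_inv_iff hp0] at h4
  refine h4.trans (le_of_eq ?_)
  rw [ENNReal.ofReal_rpow_of_nonneg (by positivity) (by positivity),
    Real.mul_rpow (by positivity) (by positivity), ← one_div]
  congr 2
  simp only [← Real.rpow_natCast, ← Real.rpow_mul hb0.le]
  congr 1; ring

/-- `g` has an antiperiod of length at most `η` along a coordinate direction. -/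
def _root_.HasAntiperiod (g : EuclideanSpace ℝ (Fin d) → ℝ) (η : ℝ) : Prop :=
  ∃ (c : Fin d) (η' : ℝ), 0 < η' ∧ η' ≤ η ∧ ∀ t, g (t + EuclideanSpace.single c η') = -g t

omit mΩ in
lemma eLpNorm_integral_levelCell_le [MeasurableSpace Ω] {P : Measure Ω} [IsProbabilityMeasure P]
    (hb : 2 ≤ b) {m : ℕ} (κ : Fin d → Fin (b ^ m))
    {F : halfOpenCube d → Ω → ℝ} (hF : Measurable (Function.uncurry F))
    {g : EuclideanSpace ℝ (Fin d) → ℝ} (hg : Measurable g) (hg1 : ∀ t, |g t| ≤ 1)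
    {η : ℝ} (hanti : HasAntiperiod g η) {n : ℕ}
    (hn : 2 ≤ n) {C α δ : ℝ} (hδ : 0 ≤ δ) (hδα : δ ≤ α) (hα : α ≤ 1) (hC : 0 ≤ C)
    (hFb : ∀ t ∈ levelCell b m κ, eLpNorm (F t) n P ≤ ENNReal.ofReal C)
    (hFh : ∀ t ∈ levelCell b m κ, ∀ t' ∈ levelCell b m κ,
      eLpNorm (fun ω => F t ω - F t' ω) n P ≤
        ENNReal.ofReal (C * ((b:ℝ) ^ m * ‖t.1 - t'.1‖) ^ α)) :
    eLpNorm (fun ω => ∫ t in levelCell b m κ, g t.1 * F t ω ∂(cubeMeasure d)) n P ≤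
      ENNReal.ofReal (2 * C * (η * (b:ℝ) ^ m) ^ δ * (((b:ℝ) ^ m)⁻¹) ^ d) := by
  obtain ⟨c, η', hη', hle, hg'⟩ := hanti
  have hbm : (0:ℝ) < (b:ℝ) ^ m := by positivity
  have key := eLpNorm_integral_preimage_box_le (P := P)
    (a := fun i => (κ i : ℝ) * ((b:ℝ) ^ m)⁻¹) (ℓ := ((b:ℝ) ^ m)⁻¹) (inv_pos.2 hbm)
    (halfOpenBox_subset_halfOpenCube hb κ) hF hg hg1 hη' hg' hn hδ hδα hα hC hFb
    (fun t ht t' ht' => by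
      rw [div_inv_eq_mul, mul_comm ‖_‖]
      exact hFh t ht t' ht')
  refine key.trans (ENNReal.ofReal_le_ofReal ?_)
  rw [div_inv_eq_mul]
  calc 2 * C * (((b:ℝ) ^ m)⁻¹) ^ d * (η' * (b:ℝ) ^ m) ^ δ
      ≤ 2 * C * (((b:ℝ) ^ m)⁻¹) ^ d * (η * (b:ℝ) ^ m) ^ δ := by gcongr
    _ = _ := by ring

/-- At level zero the single cell is the cube, so the cell estimate also handles a density on the
whole cube. -/
lemma levelCell_zero (hb : 2 ≤ b) (κ : Fin d → Fin (b ^ 0)) :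
    levelCell b 0 κ = Set.univ := by
  rw [← iUnion_levelCell (m := 0) hb]
  refine subset_antisymm (Set.subset_iUnion _ κ) (Set.iUnion_subset fun κ' => ?_)
  have : κ' = κ := by
    funext i
    have h1 := (κ' i).2
    have h2 := (κ i).2
    simp only [pow_zero] at h1 h2
    exact Fin.ext (by omega)
  rw [this]

/-- Cancellation in each cell supplies the relative size A of order (η b^m)^δ. The Hölder exponent
is lowered to δ because the factor b^{mpδ} it costs must be compensated by the decay of the level.
-/
lemma lintegral_powNorm_increment_antiperiodic_le (h : IsRegularField P ψ v b α) (hb : 2 ≤ b)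
    (hα : 0 < α) (hα1 : α ≤ 1) (γ : ℝ) {k : ℕ} (hk : 1 ≤ k) {p : ℝ} (hp : 1 < p) (hp2 : p ≤ 2)
    (hpk : p < 2 * k) {ε : ℝ} (hε : 0 < ε) {δ : ℝ} (hδ : 0 ≤ δ) (hδα : δ ≤ α) :
    ∃ (j₀ : ℕ) (C : ℝ), 0 ≤ C ∧ ∀ m ≥ j₀, ∀ {ι : Type} [Fintype ι]
      (g : ι → EuclideanSpace ℝ (Fin d) → ℝ), (∀ i, Measurable (g i)) → (∀ i t, |g i t| ≤ 1) →
      ∀ {η : ℝ}, 0 < η → (∀ i, HasAntiperiod (g i) η) →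
      ∫⁻ ω, ENNReal.ofReal (powNorm k p
        (fun i => ∫ t : halfOpenCube d, g i t.1 * increment P ψ γ m t ω ∂(cubeMeasure d))) ∂P ≤
        ENNReal.ofReal (C * ((Fintype.card ι : ℝ) ^ (p / (2 * k)) * (η ^ δ) ^ p) *
          ((b:ℝ) ^ (p * δ - levelExponent d γ p k ε)) ^ m) := by
  have hb0 : (0:ℝ) < b := by positivity
  obtain ⟨j₀, C, hC, hmain⟩ := h.lintegral_powNorm_increment_le hb hα γ hk hp hp2 hpk hε
  obtain ⟨C₁, hC₁, hW⟩ := h.eLpNorm_localIncrement_le hb hα γ (n := 2 * k) (by omega)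
    (√d + 1)
  refine ⟨j₀, C * (2 * C₁) ^ p, by positivity, fun m hm ι _ g hg hg1 η hη hanti => ?_⟩
  have hA : 0 ≤ 2 * C₁ * (η * (b:ℝ) ^ m) ^ δ := by positivity
  have h1 := hmain m hm (fun i (t : halfOpenCube d) => g i t.1)
    (fun i => (hg i).comp measurable_subtype_coe) (fun i t => hg1 i t.1) hA fun κ i =>
      eLpNorm_integral_levelCell_le hb κ (h.measurable_localIncrement γ m _) (hg i) (hg1 i)
        (hanti i) (n := 2 * k) (by omega) hδ hδα hα1 hC₁
        (fun t ht => (hW m _).1 t (norm_sub_cellCorner_le hb κ ht))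
        (fun t ht t' ht' => (hW m _).2 t t' (norm_sub_cellCorner_le hb κ ht)
          (norm_sub_cellCorner_le hb κ ht'))
  refine h1.trans (le_of_eq ?_)
  congr 1
  have e1 : (2 * C₁ * (η * (b:ℝ) ^ m) ^ δ) ^ p =
      (2 * C₁) ^ p * (η ^ δ) ^ p * ((b:ℝ) ^ (p * δ)) ^ m := by
    rw [Real.mul_rpow (x := 2 * C₁) (by positivity) (by positivity),
      Real.mul_rpow hη.le (by positivity),
      Real.mul_rpow (x := η ^ δ) (by positivity) (by positivity), mul_assoc]
    simp only [← Real.rpow_natCast, ← Real.rpow_mul hb0.le]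
    congr 3; ring
  have e2 : ((b:ℝ) ^ (p * δ - levelExponent d γ p k ε)) ^ m =
      ((b:ℝ) ^ (p * δ)) ^ m * ((b:ℝ) ^ (-levelExponent d γ p k ε)) ^ m := by
    rw [← mul_pow, ← Real.rpow_add hb0, sub_eq_add_neg]
  rw [e1, e2]; ring

/-- The starting term of the telescoping sum. Decoupling is unavailable at the coarse levels, but
their number is fixed, so cancellation on the whole cube with an M-dependent constant suffices. -/
lemma lintegral_powNorm_chaosDensity_antiperiodic_le (h : IsRegularField P ψ v b α) (hb : 2 ≤ b)
    (hα : 0 < α) (hα1 : α ≤ 1) (γ : ℝ) {k : ℕ} (hk : 1 ≤ k) {p : ℝ} (hp : 1 < p)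
    (hpk : p < 2 * k) {δ : ℝ} (hδ : 0 ≤ δ) (hδα : δ ≤ α) (M : ℕ) :
    ∃ C : ℝ, 0 ≤ C ∧ ∀ {ι : Type} [Fintype ι]
      (g : ι → EuclideanSpace ℝ (Fin d) → ℝ), (∀ i, Measurable (g i)) → (∀ i t, |g i t| ≤ 1) →
      ∀ {η : ℝ}, 0 < η → (∀ i, HasAntiperiod (g i) η) →
      ∫⁻ ω, ENNReal.ofReal (powNorm k p
        (fun i => ∫ t : halfOpenCube d, g i t.1 * chaosDensity P ψ γ M t ω ∂(cubeMeasure d))) ∂P ≤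
        ENNReal.ofReal (C * ((Fintype.card ι : ℝ) ^ (p / (2 * k)) * (η ^ δ) ^ p)) := by
  obtain ⟨C₁, hC₁, hb1, hb2⟩ := h.eLpNorm_chaosDensity_le hb hα γ M (n := 2 * k) (by omega)
    (2 * (√d + 1))
  refine ⟨(2 * C₁) ^ p, by positivity, fun {ι} _ g hg hg1 η hη hanti => ?_⟩
  let κ : Fin d → Fin (b ^ 0) := fun _ => ⟨0, by simp⟩
  have hcell : levelCell b 0 κ = Set.univ := levelCell_zero hb κ
  have hdiam : ∀ t t' : halfOpenCube d, ‖t.1 - t'.1‖ ≤ 2 * (√d + 1) := by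
    intro t t'
    have h1 := norm_sub_cellCorner_le hb κ (t := t) (by rw [hcell]; trivial)
    have h2 := norm_sub_cellCorner_le hb κ (t := t') (by rw [hcell]; trivial)
    rw [pow_zero, one_mul] at h1 h2
    have := norm_sub_le_norm_sub_add_norm_sub t.1 (cellCorner b 0 hb κ).1 t'.1
    rw [norm_sub_rev (cellCorner b 0 hb κ).1 t'.1] at this
    linarith
  have hX : ∀ i, eLpNorm (fun ω => ∫ t : halfOpenCube d, g i t.1 * chaosDensity P ψ γ M t ω
      ∂(cubeMeasure d)) (2 * k : ℕ) P ≤ ENNReal.ofReal (2 * C₁ * η ^ δ) := by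
    intro i
    have := eLpNorm_integral_levelCell_le (P := P) hb κ
      (F := chaosDensity P ψ γ M) (h.measurable_chaosDensity γ M) (hg i)
      (hg1 i) (hanti i) (n := 2 * k) (by omega) hδ hδα hα1 hC₁ (fun t _ => hb1 t)
      (fun t _ t' _ => by simpa using hb2 t t' (hdiam t t'))
    simpa [hcell] using this
  have hXm : ∀ i, Measurable fun ω => ∫ t : halfOpenCube d, g i t.1 * chaosDensity P ψ γ M t ω
      ∂(cubeMeasure d) := fun i =>
    (((hg i).comp (measurable_subtype_coe.comp measurable_fst)).mul
        (h.measurable_chaosDensity γ M)).stronglyMeasurable.integral_prod_left.measurable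
  have key := lintegral_powNorm_mul_le (P := P) (D := fun _ => 1) measurable_const
    (fun _ => zero_le_one) hXm hk (by linarith) hpk (A := 2 * C₁ * η ^ δ) (by positivity) hX
    (E := 0) (by simp)
  simp only [one_mul, zero_mul, Real.exp_zero] at key
  refine key.trans (le_of_eq ?_)
  congr 1
  rw [Real.mul_rpow (by positivity) (by positivity)]; ring

omit [IsProbabilityMeasure P] in
lemma chaosDensity_eq_add_sum {j₀ M : ℕ} (hM : j₀ ≤ M) (γ : ℝ) (t : halfOpenCube d) (ω : Ω) :
    chaosDensity P ψ γ M t ω = chaosDensity P ψ γ j₀ t ω +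
      ∑ m ∈ Finset.Ico j₀ M, increment P ψ γ m t ω := by
  simp_rw [increment_eq_sub]
  rw [Finset.sum_Ico_sub (fun m => chaosDensity P ψ γ m t ω) hM]; ring

lemma ae_integrable_chaosDensity (h : IsRegularField P ψ v b α) (hb : 2 ≤ b) (hα : 0 < α) (γ : ℝ) :
    ∀ᵐ ω ∂P, ∀ m, Integrable (fun t => chaosDensity P ψ γ m t ω) (cubeMeasure d) := by
  rw [ae_all_iff]
  intro m
  obtain ⟨C, _, hC, _⟩ := h.eLpNorm_chaosDensity_le hb hα γ m (n := 2) (by norm_num) 1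
  have := memLp_uncurry_of_eLpNorm_le (P := P) (ν := cubeMeasure d)
    (G := chaosDensity P ψ γ m) (h.measurable_chaosDensity γ m)
    (n := 2) (by norm_num) ENNReal.ofReal_ne_top (ae_of_all _ hC)
  have h1 : Integrable (Function.uncurry (chaosDensity P ψ γ m)) ((cubeMeasure d).prod P) :=
    this.integrable (by norm_num)
  exact h1.prod_left_ae

omit [IsProbabilityMeasure P] in
lemma integral_chaosDensity_eq_add_sum {ω : Ω}
    {γ : ℝ} (hω : ∀ m, Integrable (fun t => chaosDensity P ψ γ m t ω) (cubeMeasure d))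
    {j₀ M : ℕ} (hM : j₀ ≤ M) {g : halfOpenCube d → ℝ} (hg : Measurable g) (hg1 : ∀ t, |g t| ≤ 1) :
    ∫ t, g t * chaosDensity P ψ γ M t ω ∂(cubeMeasure d) =
      ∫ t, g t * chaosDensity P ψ γ j₀ t ω ∂(cubeMeasure d) +
        ∑ m ∈ Finset.Ico j₀ M, ∫ t, g t * increment P ψ γ m t ω ∂(cubeMeasure d) := by
  have hgi : ∀ m, Integrable (fun t => g t * chaosDensity P ψ γ m t ω) (cubeMeasure d) := fun m =>
    (hω m).bdd_mul hg.aestronglyMeasurable (c := 1) (ae_of_all _ hg1)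
  have hgi' : ∀ m, Integrable (fun t => g t * increment P ψ γ m t ω) (cubeMeasure d) := fun m => by
    simp_rw [increment_eq_sub, mul_sub]
    exact (hgi (m + 1)).sub (hgi m)
  rw [← integral_finsetSum _ fun m _ => hgi' m, ← integral_add (hgi j₀)
    (integrable_finsetSum _ fun m _ => hgi' m)]
  refine integral_congr_ae (ae_of_all _ fun t => ?_)
  simp only
  rw [chaosDensity_eq_add_sum hM, mul_add, Finset.mul_sum]

end IsRegularField

/-! ### Almost sure decay of integrals against antiperiodic functions -/

lemma ae_exists_forall_le_of_tsum_lintegral_ne_top {Ω ι : Type*} [MeasurableSpace Ω] [Countable ι]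
    {P : Measure Ω} {f : ι → Ω → ℝ≥0∞} (hf : ∀ i, AEMeasurable (f i) P)
    (hfin : ∑' i, ∫⁻ ω, f i ω ∂P ≠ ∞) :
    ∀ᵐ ω ∂P, ∃ C : ℝ≥0, ∀ i, f i ω ≤ C := by
  rw [← lintegral_tsum hf] at hfin
  filter_upwards [ae_lt_top' (AEMeasurable.tsum hf) hfin] with ω hω
  lift (∑' i, f i ω) to ℝ≥0 using hω.ne with C hC
  exact ⟨C, fun i => hC ▸ ENNReal.le_tsum i⟩

/-- A Borel–Cantelli substitute: a weighted series of non-negative parts with finite expectation is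
almost surely finite, and its sum bounds every term. -/
lemma ae_exists_forall_le_mul_inv {Ω ι : Type*} [MeasurableSpace Ω] [Countable ι]
    {P : Measure Ω} {X : ι → Ω → ℝ} (hX : ∀ i, Measurable (X i)) {a w : ι → ℝ}
    (hw : ∀ i, 0 < w i) (ha : Summable fun i => a i * w i)
    (hXa : ∀ i, ∫⁻ ω, ENNReal.ofReal (X i ω) ∂P ≤ ENNReal.ofReal (a i)) :
    ∀ᵐ ω ∂P, ∃ C : ℝ, 0 ≤ C ∧ ∀ i, X i ω ≤ C * (w i)⁻¹ := by
  have h := ae_exists_forall_le_of_tsum_lintegral_ne_top (P := P)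
    (f := fun i ω => ENNReal.ofReal (X i ω) * ENNReal.ofReal (w i))
    (fun i => ((hX i).ennreal_ofReal.mul_const _).aemeasurable) (by
      refine ne_top_of_le_ne_top ha.tsum_ofReal_ne_top (ENNReal.tsum_le_tsum fun i => ?_)
      rw [lintegral_mul_const _ (hX i).ennreal_ofReal, ENNReal.ofReal_mul' (hw i).le]
      gcongr
      exact hXa i)
  filter_upwards [h] with ω ⟨C, hC⟩
  refine ⟨C, C.2, fun i => ?_⟩
  have := hC i
  rw [← ENNReal.ofReal_mul' (hw i).le, ← ENNReal.ofReal_coe_nnreal] at this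
  replace this := (ENNReal.ofReal_le_ofReal_iff C.2).1 this
  rwa [← div_eq_mul_inv, le_div_iff₀ (hw i)]

namespace IsRegularField

variable {d : ℕ} {Ω : Type*} [mΩ : MeasurableSpace Ω] {P : Measure Ω} [IsProbabilityMeasure P]
  {ψ : ℕ → halfOpenCube d → Ω → ℝ} {v : ℕ → ℝ} {b : ℕ} {α : ℝ}

/-- The scale n counts frequencies and m counts levels. The p-th moments decay geometrically in
both, so one almost sure constant bounds all of them, and the increments can then be summed over the
levels. -/
lemma ae_bound_integral_antiperiodic (h : IsRegularField P ψ v b α) (hb : 2 ≤ b)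
    (hα : 0 < α) (hα1 : α ≤ 1) {γ : ℝ} (hγ : 0 < γ ∧ γ < √(2 * d)) {δ' : ℝ} (hδ' : 0 < δ')
    (hδα : δ' < α) (hδγ : δ' < gmcExponent γ d / 2) {ι : ℕ → Type} [∀ n, Fintype (ι n)]
    {g : ∀ n, ι n → EuclideanSpace ℝ (Fin d) → ℝ} (hg : ∀ n i, Measurable (g n i))
    (hg1 : ∀ n i t, |g n i t| ≤ 1) {κ : ℕ} {C₀ : ℝ} (hC₀ : 0 ≤ C₀)
    (hcard : ∀ n, (Fintype.card (ι n) : ℝ) ≤ C₀ * (b ^ κ) ^ n) {C₁ : ℝ} (hC₁ : 0 < C₁)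
    (hanti : ∀ n i, HasAntiperiod (g n i) (C₁ * ((b:ℝ) ^ n)⁻¹)) :
    ∃ j₀ : ℕ, ∀ᵐ ω ∂P, ∃ C : ℝ, ∀ n i, ∀ M ≥ j₀,
      |∫ t : halfOpenCube d, g n i t.1 * chaosDensity P ψ γ M t ω ∂(cubeMeasure d)| ≤
        C * ((b:ℝ) ^ n) ^ (-δ') := by
  have hb1 : (1:ℝ) < b := by exact_mod_cast hb
  have hb0 : (0:ℝ) < b := by linarith
  -- The moment estimates run with a slightly larger δ. The gap δ − δ' pays for the number of test
  -- functions and for summability over scales.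
  obtain ⟨δ, hδ1, hδ2⟩ := exists_between (lt_min hδα hδγ)
  obtain ⟨hδ2, hδ3⟩ := lt_min_iff.1 hδ2
  have hδ : 0 < δ := hδ'.trans hδ1
  obtain ⟨p, hp, hp2, hpe⟩ := exists_moment_exponent hγ
  have hp0 : 0 < p := by linarith
  have hlim := tendsto_levelExponent d γ p
  rw [hpe] at hlim
  have hlt : p * δ < p * (gmcExponent γ d / 2) := by gcongr
  have hlim2 : Tendsto (fun k : ℕ => (κ : ℝ) / 2 / k) atTop (𝓝 0) :=
    tendsto_const_div_atTop_nhds_zero_nat _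
  -- A large k makes the level exponent exceed pδ, ensures p < 2k, and keeps the loss κ/(2k) from
  -- counting test functions below δ − δ'.
  obtain ⟨k, ⟨hk0, hk2⟩, hk3⟩ := (((hlim.eventually (lt_mem_nhds hlt)).and
    (eventually_ge_atTop 2)).and
    (hlim2.eventually (gt_mem_nhds (sub_pos.2 hδ1)))).exists
  have hk2' : (2:ℝ) ≤ k := by exact_mod_cast hk2
  obtain ⟨j₀, A, hA, hincr⟩ := h.lintegral_powNorm_increment_antiperiodic_le hb hα hα1 γ (k := k)
    (by omega) hp hp2 (by linarith) (ε := 1 / k) (by positivity) hδ.le hδ2.le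
  obtain ⟨B, hB, hbase⟩ := h.lintegral_powNorm_chaosDensity_antiperiodic_le hb hα hα1 γ (k := k)
    (by omega) hp (by linarith) hδ.le hδ2.le j₀
  set s : ℝ := (b:ℝ) ^ (p * δ - levelExponent d γ p k (1 / k)) with hs
  have hs0 : 0 < s := by positivity
  have hs1 : s < 1 := Real.rpow_lt_one_of_one_lt_of_neg hb1 (by linarith)
  have hsq0 : 0 < √s := Real.sqrt_pos.2 hs0
  have hsq1 : √s < 1 := by rw [Real.sqrt_lt' one_pos]; simpa using hs1
  set r : ℝ := (b:ℝ) ^ (κ * (p / (2 * k)) - p * δ) with hr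
  set w : ℝ := (b:ℝ) ^ (p * δ') with hw
  have hw0 : 0 < w := by positivity
  have hrw : r * w < 1 := by
    rw [hr, hw, ← Real.rpow_add hb0]
    refine Real.rpow_lt_one_of_one_lt_of_neg hb1 ?_
    have : (κ : ℝ) * (p / (2 * k)) = p * (κ / 2 / k) := by field_simp
    rw [this]
    nlinarith
  set C₂ : ℝ := C₀ ^ (p / (2 * k)) * (C₁ ^ δ) ^ p with hC₂
  have hsize : ∀ n, (Fintype.card (ι n) : ℝ) ^ (p / (2 * k)) *
      ((C₁ * ((b:ℝ) ^ n)⁻¹) ^ δ) ^ p ≤ C₂ * r ^ n := by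
    intro n
    have e1 : (Fintype.card (ι n) : ℝ) ^ (p / (2 * k)) ≤ (C₀ * (b ^ κ) ^ n) ^ (p / (2 * k)) :=
      Real.rpow_le_rpow (by positivity) (hcard n) (by positivity)
    refine (mul_le_mul_of_nonneg_right e1 (by positivity)).trans (le_of_eq ?_)
    rw [Real.mul_rpow hC₀ (by positivity), Real.mul_rpow hC₁.le (by positivity),
      Real.mul_rpow (x := C₁ ^ δ) (by positivity) (by positivity), hC₂, hr]
    have e2 : (((b:ℝ) ^ κ) ^ n) ^ (p / (2 * k)) * ((((b:ℝ) ^ n)⁻¹) ^ δ) ^ p =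
        ((b:ℝ) ^ (κ * (p / (2 * k)) - p * δ)) ^ n := by
      rw [← Real.rpow_neg_one]
      simp only [← Real.rpow_natCast, ← Real.rpow_mul hb0.le]
      rw [← Real.rpow_add hb0]
      congr 1; ring
    rw [← e2]; ring
  have hgm : ∀ n i, Measurable fun t : halfOpenCube d => g n i t.1 := fun n i =>
    (hg n i).comp measurable_subtype_coe
  have hmeasI : ∀ m n i, Measurable fun ω => ∫ t : halfOpenCube d, g n i t.1 *
      increment P ψ γ m t ω ∂(cubeMeasure d) := fun m n i =>
    (((hgm n i).comp measurable_fst).mul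
      (h.measurable_increment γ m)).stronglyMeasurable.integral_prod_left.measurable
  have hmeasD : ∀ m n i, Measurable fun ω => ∫ t : halfOpenCube d, g n i t.1 *
      chaosDensity P ψ γ m t ω ∂(cubeMeasure d) := fun m n i =>
    (((hgm n i).comp measurable_fst).mul
      (h.measurable_chaosDensity γ m)).stronglyMeasurable.integral_prod_left.measurable
  have hη : ∀ n : ℕ, 0 < C₁ * ((b:ℝ) ^ n)⁻¹ := fun n => by positivity
  -- The decay s^m in the level is shared: one factor √s makes the expectations summable, and the
  -- other stays in the almost sure bound, so that the increments form a geometric series.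
  have hI := ae_exists_forall_le_mul_inv (P := P) (ι := ℕ × ℕ)
    (X := fun q ω => powNorm k p fun i => ∫ t : halfOpenCube d, g q.1 i t.1 *
      increment P ψ γ (j₀ + q.2) t ω ∂(cubeMeasure d))
    (fun q => (measurable_powNorm k p).comp (measurable_pi_lambda _ fun i => hmeasI _ _ i))
    (a := fun q => A * (C₂ * r ^ q.1) * s ^ (j₀ + q.2)) (w := fun q => w ^ q.1 * (√s)⁻¹ ^ q.2)
    (fun q => by positivity) (by
      have := (summable_geometric_of_lt_one (by positivity) hrw).mul_of_nonneg
        (summable_geometric_of_lt_one hsq0.le hsq1) (fun _ => by positivity)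
        (fun _ => by positivity)
      refine (this.mul_left (A * C₂ * s ^ j₀)).congr fun q => ?_
      have e : s ^ q.2 * (√s)⁻¹ ^ q.2 = √s ^ q.2 := by
        rw [← mul_pow, ← div_eq_mul_inv, Real.div_sqrt]
      rw [mul_pow, pow_add, ← e]; ring) (fun q => by
      refine (hincr (j₀ + q.2) (by omega) (g q.1) (hg q.1) (hg1 q.1) (hη q.1)
        (hanti q.1)).trans (ENNReal.ofReal_le_ofReal ?_)
      exact mul_le_mul_of_nonneg_right (mul_le_mul_of_nonneg_left (hsize q.1) hA) (by positivity))
  have hD := ae_exists_forall_le_mul_inv (P := P) (ι := ℕ)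
    (X := fun n ω => powNorm k p fun i => ∫ t : halfOpenCube d, g n i t.1 *
      chaosDensity P ψ γ j₀ t ω ∂(cubeMeasure d))
    (fun n => (measurable_powNorm k p).comp (measurable_pi_lambda _ fun i => hmeasD _ _ i))
    (a := fun n => B * (C₂ * r ^ n)) (w := fun n => w ^ n)
    (fun n => by positivity) (by
      refine ((summable_geometric_of_lt_one (by positivity) hrw).mul_left (B * C₂)).congr
        fun n => ?_
      rw [mul_pow]; ring) (fun n => by
      refine (hbase (g n) (hg n) (hg1 n) (hη n) (hanti n)).trans (ENNReal.ofReal_le_ofReal ?_)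
      exact mul_le_mul_of_nonneg_left (hsize n) hB)
  have hwp : ∀ n : ℕ, ((w ^ n)⁻¹) ^ (1 / p) = ((b:ℝ) ^ n) ^ (-δ') := by
    intro n
    rw [← Real.rpow_neg_one, hw]
    simp only [← Real.rpow_natCast, ← Real.rpow_mul hb0.le]
    congr 1; field_simp
  have hroot : ∀ {x y : ℝ}, |x| ^ p ≤ y → |x| ≤ y ^ (1 / p) := fun {x y} hxy => by
    rw [← Real.rpow_le_rpow_iff (abs_nonneg x) (by
      exact Real.rpow_nonneg ((Real.rpow_nonneg (abs_nonneg x) p).trans hxy) _) hp0,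
      one_div, Real.rpow_inv_rpow ((Real.rpow_nonneg (abs_nonneg x) p).trans hxy) hp0.ne']
    exact hxy
  refine ⟨j₀, ?_⟩
  filter_upwards [hI, hD, h.ae_integrable_chaosDensity hb hα γ] with ω ⟨C, hC, hCI⟩ ⟨C', hC', hCD⟩
    hint
  set ρ : ℝ := (√s) ^ (1 / p) with hρ
  have hρ0 : 0 < ρ := by positivity
  have hρ1 : ρ < 1 := Real.rpow_lt_one hsq0.le hsq1 (by positivity)
  refine ⟨C' ^ (1 / p) + C ^ (1 / p) * (1 - ρ)⁻¹, fun n i M hM => ?_⟩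
  rw [integral_chaosDensity_eq_add_sum hint hM (hgm n i) (fun t => hg1 n i t.1)]
  refine (abs_add_le _ _).trans ?_
  rw [add_mul]
  refine add_le_add ?_ ?_
  · have e := hroot ((abs_rpow_le_powNorm k (by omega) hp0.le (fun i => ∫ t : halfOpenCube d,
      g n i t.1 * chaosDensity P ψ γ j₀ t ω ∂(cubeMeasure d)) i).trans (hCD n))
    rwa [Real.mul_rpow hC' (by positivity), hwp] at e
  · have e : ∀ m ≥ j₀, |∫ t : halfOpenCube d, g n i t.1 * increment P ψ γ m t ω ∂(cubeMeasure d)| ≤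
        C ^ (1 / p) * ((b:ℝ) ^ n) ^ (-δ') * ρ ^ (m - j₀) := by
      intro m hm
      obtain ⟨l, rfl⟩ := Nat.exists_eq_add_of_le hm
      have e := hroot ((abs_rpow_le_powNorm k (by omega) hp0.le (fun i => ∫ t : halfOpenCube d,
        g n i t.1 * increment P ψ γ (j₀ + l) t ω ∂(cubeMeasure d)) i).trans (hCI (n, l)))
      refine e.trans (le_of_eq ?_)
      rw [mul_inv, inv_pow, inv_inv, Real.mul_rpow hC (by positivity),
        Real.mul_rpow (by positivity) (by positivity), hwp, Nat.add_sub_cancel_left, hρ,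
        Real.rpow_pow_comm hsq0.le]
      ring
    calc _ ≤ ∑ m ∈ Finset.Ico j₀ M, C ^ (1 / p) * ((b:ℝ) ^ n) ^ (-δ') * ρ ^ (m - j₀) :=
          (Finset.abs_sum_le_sum_abs _ _).trans
            (Finset.sum_le_sum fun m hm => e m (Finset.mem_Ico.1 hm).1)
      _ = C ^ (1 / p) * ((b:ℝ) ^ n) ^ (-δ') * ∑ l ∈ Finset.range (M - j₀), ρ ^ l := by
          rw [← Finset.mul_sum, Finset.sum_Ico_eq_sum_range]; simp
      _ ≤ C ^ (1 / p) * ((b:ℝ) ^ n) ^ (-δ') * (1 - ρ)⁻¹ := by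
          gcongr
          rw [← tsum_geometric_of_lt_one hρ0.le hρ1]
          exact (summable_geometric_of_lt_one hρ0.le hρ1).sum_le_tsum _
            (fun _ _ => by positivity)
      _ = _ := by ring

end IsRegularField

/-! ### From a grid of frequencies to Fourier decay -/

section FrequencyGrid

variable {d : ℕ}

/-- The plane wave `t ↦ cos (2π ξ·t + φ)`. -/
noncomputable def planeWave (ξ : EuclideanSpace ℝ (Fin d)) (φ : ℝ) (t : EuclideanSpace ℝ (Fin d)) :
    ℝ :=
  Real.cos (2 * Real.pi * inner ℝ ξ t + φ)

lemma continuous_planeWave (ξ : EuclideanSpace ℝ (Fin d)) (φ : ℝ) :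
    Continuous (planeWave ξ φ) := by
  unfold planeWave
  fun_prop

lemma abs_planeWave_le (ξ : EuclideanSpace ℝ (Fin d)) (φ : ℝ) (t : EuclideanSpace ℝ (Fin d)) :
    |planeWave ξ φ t| ≤ 1 := Real.abs_cos_le_one _

lemma integrable_planeWave (ν : Measure (EuclideanSpace ℝ (Fin d))) [IsFiniteMeasure ν]
    (ξ : EuclideanSpace ℝ (Fin d)) (φ : ℝ) : Integrable (planeWave ξ φ) ν :=
  Integrable.of_bound (continuous_planeWave ξ φ).aestronglyMeasurable 1
    (ae_of_all _ fun t => abs_planeWave_le ξ φ t)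

lemma measureFourier_eq (ν : Measure (EuclideanSpace ℝ (Fin d))) [IsFiniteMeasure ν]
    (x : EuclideanSpace ℝ (Fin d)) :
    measureFourier ν x = ((∫ t, planeWave x 0 t ∂ν : ℝ) : ℂ) -
      ((∫ t, planeWave x (-(Real.pi / 2)) t ∂ν : ℝ) : ℂ) * Complex.I := by
  have e : ∀ t : EuclideanSpace ℝ (Fin d),
      Complex.exp (-2 * Real.pi * Complex.I * ((inner ℝ x t : ℝ) : ℂ)) =
      ((planeWave x 0 t : ℝ) : ℂ) - ((planeWave x (-(Real.pi / 2)) t : ℝ) : ℂ) * Complex.I := by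
    intro t
    have : (-2 * Real.pi * Complex.I * ((inner ℝ x t : ℝ) : ℂ)) =
        ((-(2 * Real.pi * inner ℝ x t) : ℝ) : ℂ) * Complex.I := by push_cast; ring
    rw [this, Complex.exp_mul_I, ← Complex.ofReal_cos, ← Complex.ofReal_sin, Real.cos_neg,
      Real.sin_neg, planeWave, planeWave, add_zero, ← sub_eq_add_neg, Real.cos_sub_pi_div_two]
    push_cast; ring
  rw [measureFourier]
  simp_rw [e]
  rw [integral_sub (integrable_planeWave _ _ _).ofReal
      ((integrable_planeWave _ _ _).ofReal.mul_const _), integral_mul_const,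
    integral_complex_ofReal, integral_complex_ofReal]

lemma exists_norm_le_sqrt_mul_abs (hd : 1 ≤ d) (ξ : EuclideanSpace ℝ (Fin d)) :
    ∃ c, ‖ξ‖ ≤ √d * |ξ c| := by
  have : Nonempty (Fin d) := ⟨⟨0, hd⟩⟩
  obtain ⟨c, -, hc⟩ := Finset.exists_max_image Finset.univ (fun i => |ξ i|) Finset.univ_nonempty
  refine ⟨c, ?_⟩
  rw [EuclideanSpace.norm_eq, ← Real.sqrt_sq (abs_nonneg (ξ c)), ← Real.sqrt_mul (by positivity)]
  refine Real.sqrt_le_sqrt ?_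
  calc ∑ i, ‖ξ i‖ ^ 2 ≤ ∑ _i : Fin d, |ξ c| ^ 2 := Finset.sum_le_sum fun i hi => by
        rw [Real.norm_eq_abs]
        exact pow_le_pow_left₀ (abs_nonneg _) (hc i hi) 2
    _ = _ := by simp

/-- Half a wavelength along the coordinate direction where |ξ_c| is largest, and hence at least
‖ξ‖/√d. -/
lemma hasAntiperiod_planeWave (hd : 1 ≤ d) {ξ : EuclideanSpace ℝ (Fin d)} (φ : ℝ) {A : ℝ}
    (hA : 0 < A) (hξ : A / 2 ≤ ‖ξ‖) : HasAntiperiod (planeWave ξ φ) (√d * A⁻¹) := by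
  obtain ⟨c, hc⟩ := exists_norm_le_sqrt_mul_abs hd ξ
  have hd' : (0:ℝ) < √d := Real.sqrt_pos.2 (by exact_mod_cast hd)
  have hpos : 0 < |ξ c| := by
    by_contra hcon
    have : |ξ c| = 0 := le_antisymm (not_lt.1 hcon) (abs_nonneg _)
    rw [this, mul_zero] at hc
    linarith
  refine ⟨c, (2 * |ξ c|)⁻¹, by positivity, ?_, fun t => ?_⟩
  · rw [← div_eq_mul_inv, inv_le_comm₀ (by positivity) (by positivity), inv_div,
      div_le_iff₀ hd']
    nlinarith
  · have e : inner ℝ ξ (EuclideanSpace.single c (2 * |ξ c|)⁻¹) = ξ c * (2 * |ξ c|)⁻¹ := by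
      rw [EuclideanSpace.inner_single_right]; simp [mul_comm]
    unfold planeWave
    rw [inner_add_right, e]
    rcases abs_cases (ξ c) with ⟨h1, h2⟩ | ⟨h1, h2⟩
    · have h3 : ξ c ≠ 0 := abs_pos.1 hpos
      rw [h1, ← Real.cos_add_pi]
      congr 1
      field_simp
      ring
    · have h3 : ξ c ≠ 0 := abs_pos.1 hpos
      rw [h1, ← Real.cos_sub_pi]
      congr 1
      field_simp
      ring

lemma abs_planeWave_sub_le (ξ ξ' : EuclideanSpace ℝ (Fin d)) (φ : ℝ)
    (t : EuclideanSpace ℝ (Fin d)) :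
    |planeWave ξ φ t - planeWave ξ' φ t| ≤ 2 * Real.pi * (‖ξ - ξ'‖ * ‖t‖) := by
  refine (Real.abs_cos_sub_cos_le _ _).trans ?_
  rw [add_sub_add_right_eq_sub, ← mul_sub, ← inner_sub_left, abs_mul,
    abs_of_nonneg (by positivity : 0 ≤ 2 * Real.pi)]
  gcongr
  exact abs_real_inner_le_norm _ _

lemma norm_le_sqrt_of_mem_halfOpenCube {t : EuclideanSpace ℝ (Fin d)} (ht : t ∈ halfOpenCube d) :
    ‖t‖ ≤ √d := by
  rw [EuclideanSpace.norm_eq]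
  refine Real.sqrt_le_sqrt ?_
  calc ∑ i, ‖t i‖ ^ 2 ≤ ∑ _i : Fin d, (1:ℝ) := Finset.sum_le_sum fun i _ => by
        rw [Real.norm_eq_abs, abs_of_nonneg (ht i).1]
        exact pow_le_one₀ (ht i).1 (ht i).2.le
    _ = _ := by simp

/-- The point of the lattice `b⁻ⁿ ℤ^d` with index `k`. -/
noncomputable def latticeFrequency (b n : ℕ) (k : Fin d → ℤ) : EuclideanSpace ℝ (Fin d) :=
  WithLp.toLp 2 fun i => (k i : ℝ) / (b:ℝ) ^ n

/-- Indices of the points of norm at least `bⁿ / 2` of the lattice `b⁻ⁿ ℤ^d` in a box of side of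
order `bⁿ⁺¹`, together with a phase. -/
abbrev FrequencyIndex (d b n : ℕ) : Type :=
  {k : Fin d → Finset.Icc (-(2 * b ^ (2 * n + 1) : ℤ)) (2 * b ^ (2 * n + 1)) //
    (b:ℝ) ^ n / 2 ≤ ‖latticeFrequency b n fun i => (k i : ℤ)‖} × Bool

noncomputable instance (b n : ℕ) : Fintype (FrequencyIndex d b n) := Fintype.ofFinite _

/-- With N = b^{2n+1}, each coordinate takes at most 4N + 1 ≤ 5N values, and there are two phases.
-/
lemma card_frequencyIndex_le {b : ℕ} (hb : 2 ≤ b) (n : ℕ) :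
    (Fintype.card (FrequencyIndex d b n) : ℝ) ≤ 2 * (5 * b) ^ d * ((b:ℝ) ^ (2 * d)) ^ n := by
  rw [← Nat.card_eq_fintype_card, Nat.card_prod]
  have h1 : Nat.card {k : Fin d → Finset.Icc (-(2 * b ^ (2 * n + 1) : ℤ)) (2 * b ^ (2 * n + 1)) //
      (b:ℝ) ^ n / 2 ≤ ‖latticeFrequency b n fun i => (k i : ℤ)‖} ≤ (5 * b ^ (2 * n + 1)) ^ d := by
    refine (Nat.card_le_card_of_injective _ Subtype.val_injective).trans ?_
    rw [Nat.card_fun, Nat.card_eq_fintype_card, Nat.card_eq_fintype_card, Fintype.card_fin,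
      Fintype.card_coe, Int.card_Icc]
    refine Nat.pow_le_pow_left ?_ d
    have : 0 < b ^ (2 * n + 1) := by positivity
    have e : (2 * (b:ℤ) ^ (2 * n + 1)) = ((2 * b ^ (2 * n + 1) : ℕ) : ℤ) := by push_cast; rfl
    rw [e]
    omega
  have h2 : Nat.card Bool = 2 := by simp
  rw [h2]
  calc _ ≤ (((5 * b ^ (2 * n + 1)) ^ d * 2 : ℕ) : ℝ) := by exact_mod_cast Nat.mul_le_mul_right 2 h1
    _ = _ := by
      push_cast
      rw [pow_succ, pow_mul, ← pow_mul (b:ℝ) (2 * d) n]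
      rw [show 2 * d * n = 2 * n * d by ring, pow_mul (b:ℝ) (2 * n) d, pow_mul (b:ℝ) 2 n]
      rw [mul_pow 5 (b:ℝ) d, mul_pow, mul_pow]
      ring

/-- The plane wave attached to a frequency index. -/
noncomputable def indexedWave (b n : ℕ) (i : FrequencyIndex d b n) :
    EuclideanSpace ℝ (Fin d) → ℝ :=
  planeWave (latticeFrequency b n fun c => (i.1.1 c : ℤ)) (if i.2 then 0 else -(Real.pi / 2))

/-- Round every coordinate down to the lattice. The error is at most √d, so the assumption 2√d ≤ bⁿ
keeps the norm of the lattice point above bⁿ/2. -/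
lemma exists_frequencyIndex (hd : 1 ≤ d) {b : ℕ} (hb : 2 ≤ b) {n : ℕ}
    {x : EuclideanSpace ℝ (Fin d)} (hx : (b:ℝ) ^ n ≤ ‖x‖) (hx' : ‖x‖ ≤ (b:ℝ) ^ (n + 1))
    (hn : 2 * √d ≤ (b:ℝ) ^ n) (s : Bool) :
    ∃ (i : FrequencyIndex d b n) (ξ : EuclideanSpace ℝ (Fin d)), ‖x - ξ‖ ≤ √d * ((b:ℝ) ^ n)⁻¹ ∧
      indexedWave b n i = planeWave ξ (if s then 0 else -(Real.pi / 2)) := by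
  have hb1 : (1:ℝ) ≤ b := by exact_mod_cast (by omega : 1 ≤ b)
  have hbn : (1:ℝ) ≤ (b:ℝ) ^ n := one_le_pow₀ hb1
  have hbn0 : (0:ℝ) < (b:ℝ) ^ n := by linarith
  set k : Fin d → ℤ := fun i => ⌊x i * (b:ℝ) ^ n⌋ with hk
  have hkb : ∀ i, k i ∈ Finset.Icc (-(2 * b ^ (2 * n + 1) : ℤ)) (2 * b ^ (2 * n + 1)) := by
    intro i
    have h1 : |x i| ≤ (b:ℝ) ^ (n + 1) := by
      have := PiLp.norm_apply_le x i
      rw [Real.norm_eq_abs] at this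
      exact this.trans hx'
    have h2 : |x i * (b:ℝ) ^ n| ≤ (b:ℝ) ^ (2 * n + 1) := by
      rw [abs_mul, abs_of_pos hbn0]
      calc |x i| * (b:ℝ) ^ n ≤ (b:ℝ) ^ (n + 1) * (b:ℝ) ^ n := by gcongr
        _ = _ := by ring
    have h3 : (1:ℝ) ≤ (b:ℝ) ^ (2 * n + 1) := one_le_pow₀ hb1
    have h4 := abs_le.1 h2
    rw [Finset.mem_Icc]
    constructor
    · rw [hk]
      refine Int.le_floor.2 ?_
      push_cast
      linarith
    · have : ((k i : ℤ) : ℝ) ≤ ((2 * (b:ℤ) ^ (2 * n + 1) : ℤ) : ℝ) := by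
        refine (Int.floor_le _).trans ?_
        push_cast
        linarith
      exact_mod_cast this
  have hdist : ‖x - latticeFrequency b n k‖ ≤ √d * ((b:ℝ) ^ n)⁻¹ := by
    rw [EuclideanSpace.norm_eq, ← Real.sqrt_sq (by positivity : 0 ≤ ((b:ℝ) ^ n)⁻¹),
      ← Real.sqrt_mul (by positivity)]
    refine Real.sqrt_le_sqrt ?_
    calc ∑ i, ‖(x - latticeFrequency b n k) i‖ ^ 2 ≤ ∑ _i : Fin d, (((b:ℝ) ^ n)⁻¹) ^ 2 :=
          Finset.sum_le_sum fun i _ => by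
            refine pow_le_pow_left₀ (norm_nonneg _) ?_ 2
            have e : (x - latticeFrequency b n k) i =
                (x i * (b:ℝ) ^ n - ⌊x i * (b:ℝ) ^ n⌋) * ((b:ℝ) ^ n)⁻¹ := by
              simp only [PiLp.sub_apply, latticeFrequency, hk]
              field_simp
            rw [e, norm_mul, Real.norm_of_nonneg (inv_pos.2 hbn0).le, Real.norm_eq_abs]
            refine mul_le_of_le_one_left (inv_pos.2 hbn0).le ?_
            rw [abs_le]
            have := Int.floor_le (x i * (b:ℝ) ^ n)
            have := Int.lt_floor_add_one (x i * (b:ℝ) ^ n)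
            constructor <;> linarith
      _ = _ := by simp
  have hnorm : (b:ℝ) ^ n / 2 ≤ ‖latticeFrequency b n k‖ := by
    have h1 := norm_sub_norm_le x (latticeFrequency b n k)
    have h2 : √d * ((b:ℝ) ^ n)⁻¹ ≤ √d := mul_le_of_le_one_right (by positivity)
      (inv_le_one_of_one_le₀ hbn)
    linarith
  exact ⟨⟨⟨fun i => ⟨k i, hkb i⟩, hnorm⟩, s⟩, latticeFrequency b n k, hdist, rfl⟩

/-- The weak limit may charge the boundary that the half-open cube omits, so the bound is
transferred from the approximating measures rather than read off from where ν lives. -/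
lemma abs_integral_le_of_tendsto {μs : ℕ → FiniteMeasure (EuclideanSpace ℝ (Fin d))}
    {ν : FiniteMeasure (EuclideanSpace ℝ (Fin d))} (hlim : Tendsto μs atTop (𝓝 ν))
    (hcube : ∀ m, ∀ᵐ t ∂(μs m : Measure (EuclideanSpace ℝ (Fin d))), t ∈ halfOpenCube d)
    {f : EuclideanSpace ℝ (Fin d) → ℝ} (hf : Continuous f) {B : ℝ} (hB : ∀ t, |f t| ≤ B) {A : ℝ}
    (hA : ∀ t ∈ halfOpenCube d, |f t| ≤ A) :
    |∫ t, f t ∂(ν : Measure (EuclideanSpace ℝ (Fin d)))| ≤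
      A * (ν : Measure (EuclideanSpace ℝ (Fin d))).real Set.univ := by
  have h1 := (FiniteMeasure.tendsto_iff_forall_integral_tendsto.1 hlim)
    (BoundedContinuousFunction.ofNormedAddCommGroup f hf B hB)
  have h2 := (FiniteMeasure.tendsto_iff_forall_integral_tendsto.1 hlim)
    (BoundedContinuousFunction.const _ 1)
  simp only [BoundedContinuousFunction.coe_ofNormedAddCommGroup,
    BoundedContinuousFunction.const_apply, integral_const, smul_eq_mul, mul_one] at h1 h2
  refine le_of_tendsto_of_tendsto' h1.abs (h2.const_mul A) fun m => ?_
  exact norm_integral_le_of_norm_le_const (f := f) (C := A) ((hcube m).mono hA)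

/-- A frequency of norm between bⁿ and bⁿ⁺¹ is within √d b⁻ⁿ of the grid, and the Fourier transform
of a measure carried by a bounded set is Lipschitz. The grid bound is assumed for large m separately
at each index, which suffices to pass to the limit. -/
lemma hasFourierDecay_of_tendsto (hd : 1 ≤ d) {b : ℕ} (hb : 2 ≤ b)
    {μs : ℕ → FiniteMeasure (EuclideanSpace ℝ (Fin d))}
    {ν : FiniteMeasure (EuclideanSpace ℝ (Fin d))} (hlim : Tendsto μs atTop (𝓝 ν))
    (hcube : ∀ m, ∀ᵐ t ∂(μs m : Measure (EuclideanSpace ℝ (Fin d))), t ∈ halfOpenCube d)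
    {δ C : ℝ} (hδ : 0 ≤ δ) (hδ1 : δ ≤ 1)
    (hC : ∀ n (i : FrequencyIndex d b n), ∀ᶠ m in atTop,
      |∫ t, indexedWave b n i t ∂(μs m : Measure (EuclideanSpace ℝ (Fin d)))| ≤
        C * ((b:ℝ) ^ n) ^ (-δ)) :
    HasFourierDecay (ν : Measure (EuclideanSpace ℝ (Fin d))) (2 * δ) := by
  have hb1 : (1:ℝ) < b := by exact_mod_cast hb
  have hb0 : (0:ℝ) < b := by linarith
  set ν' := (ν : Measure (EuclideanSpace ℝ (Fin d))) with hν'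
  set V : ℝ := ν'.real Set.univ with hV
  have hV0 : 0 ≤ V := measureReal_nonneg
  have hgrid : ∀ n (i : FrequencyIndex d b n),
      |∫ t, indexedWave b n i t ∂ν'| ≤ C * ((b:ℝ) ^ n) ^ (-δ) := fun n i => by
    have h1 := (FiniteMeasure.tendsto_iff_forall_integral_tendsto.1 hlim)
      (BoundedContinuousFunction.ofNormedAddCommGroup (indexedWave b n i)
        (continuous_planeWave _ _) 1 (abs_planeWave_le _ _))
    exact le_of_tendsto h1.abs (hC n i)
  set A : ℝ := C + 2 * Real.pi * d * V with hA
  have hwave : ∀ (n : ℕ) (x : EuclideanSpace ℝ (Fin d)), (b:ℝ) ^ n ≤ ‖x‖ → ‖x‖ ≤ (b:ℝ) ^ (n + 1) →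
      2 * √d ≤ (b:ℝ) ^ n → ∀ s : Bool,
      |∫ t, planeWave x (if s then 0 else -(Real.pi / 2)) t ∂ν'| ≤ A * ((b:ℝ) ^ n) ^ (-δ) := by
    intro n x hx hx' hn s
    obtain ⟨i, ξ, hξ, hi⟩ := exists_frequencyIndex hd hb hx hx' hn s
    set φ : ℝ := if s then 0 else -(Real.pi / 2)
    have h1 := hgrid n i
    rw [hi] at h1
    have h2 : |∫ t, (planeWave x φ t - planeWave ξ φ t) ∂ν'| ≤
        (2 * Real.pi * d * ((b:ℝ) ^ n)⁻¹) * V :=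
      abs_integral_le_of_tendsto hlim hcube
        ((continuous_planeWave x φ).sub (continuous_planeWave ξ φ)) (B := 2)
        (fun t => by
          have h3 := abs_planeWave_le x φ t
          have h4 := abs_planeWave_le ξ φ t
          exact (abs_sub _ _).trans (by linarith)) fun t ht => by
          refine (abs_planeWave_sub_le x ξ φ t).trans ?_
          calc 2 * Real.pi * (‖x - ξ‖ * ‖t‖)
              ≤ 2 * Real.pi * (√d * ((b:ℝ) ^ n)⁻¹ * √d) := by
                gcongr
                exact norm_le_sqrt_of_mem_halfOpenCube ht
            _ = 2 * Real.pi * (√d * √d) * ((b:ℝ) ^ n)⁻¹ := by ring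
            _ = _ := by rw [Real.mul_self_sqrt (by positivity)]
    rw [integral_sub (integrable_planeWave _ _ _) (integrable_planeWave _ _ _)] at h2
    -- The interpolation error b⁻ⁿ is absorbed because δ ≤ 1.
    have h3 : ((b:ℝ) ^ n)⁻¹ ≤ ((b:ℝ) ^ n) ^ (-δ) := by
      rw [← Real.rpow_neg_one]
      exact Real.rpow_le_rpow_of_exponent_le (one_le_pow₀ hb1.le) (by linarith)
    calc _ ≤ |∫ t, planeWave x φ t ∂ν' - ∫ t, planeWave ξ φ t ∂ν'| +
          |∫ t, planeWave ξ φ t ∂ν'| := by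
            have := abs_add_le (∫ t, planeWave x φ t ∂ν' - ∫ t, planeWave ξ φ t ∂ν')
              (∫ t, planeWave ξ φ t ∂ν')
            rwa [sub_add_cancel] at this
      _ ≤ (2 * Real.pi * d * ((b:ℝ) ^ n)⁻¹) * V + C * ((b:ℝ) ^ n) ^ (-δ) := add_le_add h2 h1
      _ ≤ (2 * Real.pi * d * ((b:ℝ) ^ n) ^ (-δ)) * V + C * ((b:ℝ) ^ n) ^ (-δ) := by gcongr
      _ = _ := by rw [hA]; ring
  have hfourier : ∀ x : EuclideanSpace ℝ (Fin d), ‖measureFourier ν' x‖ ≤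
      |∫ t, planeWave x 0 t ∂ν'| + |∫ t, planeWave x (-(Real.pi / 2)) t ∂ν'| := by
    intro x
    rw [measureFourier_eq]
    refine (norm_sub_le _ _).trans ?_
    simp
  rw [HasFourierDecay]
  refine Asymptotics.IsBigO.of_bound ((2 * A * (b:ℝ) ^ δ) ^ 2) ?_
  -- This threshold yields ‖x‖ ≥ 1, so that n exists, and bⁿ > ‖x‖/b ≥ 2√d, so that rounding is
  -- allowed.
  filter_upwards [eventually_cobounded_le_norm (1 + 2 * √d * b)] with x hx
  have hx1 : 1 ≤ ‖x‖ := le_trans (by have : 0 ≤ 2 * √d * b := by positivity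
                                     linarith) hx
  have hx0 : 0 < ‖x‖ := by linarith
  obtain ⟨n, hn, hn'⟩ := exists_nat_pow_near hx1 hb1
  have hn2 : 2 * √d ≤ (b:ℝ) ^ n := by
    have : 2 * √d * b ≤ (b:ℝ) ^ n * b := by rw [← pow_succ]; linarith
    exact le_of_mul_le_mul_right this hb0
  have h1 := hwave n x hn hn'.le hn2 true
  have h2 := hwave n x hn hn'.le hn2 false
  simp only [if_true, Bool.false_eq_true, if_false] at h1 h2
  have hA0 : 0 ≤ A := by
    have : 0 ≤ A * ((b:ℝ) ^ n) ^ (-δ) := (abs_nonneg _).trans h1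
    exact nonneg_of_mul_nonneg_left this (by positivity)
  have h3 : ((b:ℝ) ^ n) ^ (-δ) ≤ (b:ℝ) ^ δ * ‖x‖ ^ (-δ) := by
    have : ‖x‖ / b ≤ (b:ℝ) ^ n := by
      rw [div_le_iff₀ hb0, ← pow_succ]; exact hn'.le
    calc ((b:ℝ) ^ n) ^ (-δ) ≤ (‖x‖ / b) ^ (-δ) :=
          Real.rpow_le_rpow_of_nonpos (by positivity) this (by linarith)
      _ = _ := by
        rw [Real.div_rpow hx0.le hb0.le, Real.rpow_neg hb0.le, div_inv_eq_mul, mul_comm]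
  have h4 : ‖measureFourier ν' x‖ ≤ 2 * A * (b:ℝ) ^ δ * ‖x‖ ^ (-δ) := by
    refine (hfourier x).trans ((add_le_add h1 h2).trans ?_)
    have := mul_le_mul_of_nonneg_left h3 hA0
    linarith
  rw [Real.norm_of_nonneg (by positivity), Real.norm_of_nonneg (by positivity)]
  calc ‖measureFourier ν' x‖ ^ 2 ≤ (2 * A * (b:ℝ) ^ δ * ‖x‖ ^ (-δ)) ^ 2 := by gcongr
    _ = _ := by
      rw [mul_pow, ← Real.rpow_natCast (‖x‖ ^ (-δ)), ← Real.rpow_mul hx0.le]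
      congr 2; push_cast; ring

end FrequencyGrid

/-! ### Fourier decay of the chaos measure -/

namespace IsRegularField

variable {d : ℕ} {Ω : Type*} [mΩ : MeasurableSpace Ω] {P : Measure Ω} [IsProbabilityMeasure P]
  {ψ : ℕ → halfOpenCube d → Ω → ℝ} {v : ℕ → ℝ} {b : ℕ} {α : ℝ}

omit [IsProbabilityMeasure P] in
lemma approxGMC_eq (γ : ℝ) (m : ℕ) (ω : Ω) : approxGMC P ψ γ m ω =
    ((cubeMeasure d).withDensity fun t =>
      ENNReal.ofReal (chaosDensity P ψ γ (m + 1) t ω)).map Subtype.val := rfl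

omit [IsProbabilityMeasure P] in
lemma measurable_chaosDensity_left (h : IsRegularField P ψ v b α) (γ : ℝ) (m : ℕ) (ω : Ω) :
    Measurable fun t => chaosDensity P ψ γ m t ω :=
  (h.measurable_chaosDensity γ m).comp (measurable_id.prodMk measurable_const)

omit [IsProbabilityMeasure P] in
lemma ae_mem_halfOpenCube_approxGMC (γ : ℝ) (m : ℕ) (ω : Ω) :
    ∀ᵐ t ∂(approxGMC P ψ γ m ω), t ∈ halfOpenCube d := by
  rw [approxGMC_eq]
  exact (ae_map_iff (p := fun t => t ∈ halfOpenCube d) measurable_subtype_coe.aemeasurable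
    measurableSet_halfOpenCube).2 (ae_of_all _ fun t => t.2)

omit [IsProbabilityMeasure P] in
lemma lintegral_approxGMC (h : IsRegularField P ψ v b α) (γ : ℝ) (m : ℕ) (ω : Ω)
    {f : EuclideanSpace ℝ (Fin d) → ℝ≥0∞} (hf : Measurable f) :
    ∫⁻ t, f t ∂(approxGMC P ψ γ m ω) =
      ∫⁻ t, ENNReal.ofReal (chaosDensity P ψ γ (m + 1) t ω) * f t.1 ∂(cubeMeasure d) := by
  rw [approxGMC_eq, lintegral_map hf measurable_subtype_coe]
  exact lintegral_withDensity_eq_lintegral_mul _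
    (h.measurable_chaosDensity_left γ (m + 1) ω).ennreal_ofReal
    (hf.comp measurable_subtype_coe)

omit [IsProbabilityMeasure P] in
lemma integral_approxGMC (h : IsRegularField P ψ v b α) (γ : ℝ) (m : ℕ) (ω : Ω)
    {f : EuclideanSpace ℝ (Fin d) → ℝ} (hf : Measurable f) :
    ∫ t, f t ∂(approxGMC P ψ γ m ω) =
      ∫ t, f t.1 * chaosDensity P ψ γ (m + 1) t ω ∂(cubeMeasure d) := by
  rw [approxGMC_eq, integral_map measurable_subtype_coe.aemeasurable hf.aestronglyMeasurable,
    integral_withDensity_eq_integral_toReal_smul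
      (h.measurable_chaosDensity_left γ (m + 1) ω).ennreal_ofReal
      (ae_of_all _ fun _ => ENNReal.ofReal_lt_top)]
  refine integral_congr_ae (ae_of_all _ fun t => ?_)
  simp only [smul_eq_mul]
  rw [ENNReal.toReal_ofReal (h.chaosDensity_nonneg _ _ _ _), mul_comm]

omit [IsProbabilityMeasure P] in
lemma isFiniteMeasure_approxGMC {γ : ℝ} {ω : Ω} {m : ℕ}
    (hω : Integrable (fun t => chaosDensity P ψ γ (m + 1) t ω) (cubeMeasure d)) :
    IsFiniteMeasure (approxGMC P ψ γ m ω) := by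
  have := isFiniteMeasure_withDensity_ofReal hω.2
  rw [approxGMC_eq]
  infer_instance

lemma ae_hasFourierDecay (h : IsRegularField P ψ v b α) (hd : 1 ≤ d) (hb : 2 ≤ b)
    (hα : 0 < α) (hα1 : α ≤ 1) {γ : ℝ} (hγ : 0 < γ ∧ γ < √(2 * d))
    {M : Ω → Measure (EuclideanSpace ℝ (Fin d))} (hM : IsGMC P ψ γ M) {D : ℝ} (hD : 0 < D)
    (hDα : D < 2 * α) (hDγ : D < gmcExponent γ d) :
    ∀ᵐ ω ∂P, HasFourierDecay (M ω) D := by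
  obtain ⟨j₀, hj₀⟩ := h.ae_bound_integral_antiperiodic hb hα hα1 hγ (δ' := D / 2)
    (by positivity) (by linarith) (by linarith) (ι := FrequencyIndex d b)
    (g := fun n i => indexedWave b n i) (fun n i => (continuous_planeWave _ _).measurable)
    (fun n i => abs_planeWave_le _ _) (κ := 2 * d) (C₀ := 2 * (5 * b) ^ d) (by positivity)
    (card_frequencyIndex_le hb) (C₁ := √d) (Real.sqrt_pos.2 (by exact_mod_cast hd))
    (fun n i => hasAntiperiod_planeWave hd _ (by positivity) i.1.2)
  filter_upwards [hj₀, h.ae_integrable_chaosDensity hb hα γ, hM.finite, hM.tendsto] with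
    ω ⟨C, hC⟩ hint hfin hlim
  have := fun m => isFiniteMeasure_approxGMC (hint (m + 1))
  let μs : ℕ → FiniteMeasure (EuclideanSpace ℝ (Fin d)) := fun m => ⟨approxGMC P ψ γ m ω, this m⟩
  let ν : FiniteMeasure (EuclideanSpace ℝ (Fin d)) := ⟨M ω, hfin⟩
  have hlim' : Tendsto μs atTop (𝓝 ν) :=
    FiniteMeasure.tendsto_iff_forall_lintegral_tendsto.2 hlim
  have key := hasFourierDecay_of_tendsto hd hb hlim'
    (fun m => ae_mem_halfOpenCube_approxGMC γ m ω) (δ := D / 2) (C := C) (by positivity)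
    (by linarith) (fun n i => by
      filter_upwards [eventually_ge_atTop j₀] with m hm
      change |∫ t, indexedWave b n i t ∂(approxGMC P ψ γ m ω)| ≤ _
      rw [h.integral_approxGMC γ m ω (f := indexedWave b n i) (continuous_planeWave _ _).measurable]
      -- The approximating measure of index m includes level m, so its density is the one built from
      -- m + 1 fields.
      exact hC n i (m + 1) (by omega))
  rwa [mul_div_cancel₀ _ (two_ne_zero' ℝ)] at key

/-- The decay at a given exponent holds off a null set depending on that exponent, so exponents
increase to the minimum along a sequence and only countably many null sets are discarded. -/
lemma ae_min_le_fourierDim (h : IsRegularField P ψ v b α) (hd : 1 ≤ d) (hb : 2 ≤ b)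
    (hα : 0 < α) (hα1 : α ≤ 1) {γ : ℝ} (hγ : 0 < γ ∧ γ < √(2 * d))
    {M : Ω → Measure (EuclideanSpace ℝ (Fin d))} (hM : IsGMC P ψ γ M) :
    ∀ᵐ ω ∂P, min (2 * α) (gmcExponent γ d) ≤ fourierDim (M ω) := by
  obtain ⟨u, -, hu, hlim⟩ := exists_seq_strictMono_tendsto'
    (lt_min (by positivity : 0 < 2 * α) (gmcExponent_pos hγ))
  have hu' : ∀ n, u n < 2 * α ∧ u n < gmcExponent γ d := fun n => lt_min_iff.1 (hu n).2
  have hall : ∀ᵐ ω ∂P, ∀ n, HasFourierDecay (M ω) (u n) := ae_all_iff.2 fun n =>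
    h.ae_hasFourierDecay hd hb hα hα1 hγ hM (hu n).1 (hu' n).1 (hu' n).2
  filter_upwards [hall] with ω hω
  refine le_of_tendsto' hlim fun n => le_csSup ⟨d, fun D hD => hD.2.1.le⟩
    ⟨(hu n).1.le, (hu' n).2.trans (gmcExponent_lt hd hγ), hω n⟩

end IsRegularField

/-! ### Existence of the chaos measure -/

section WeakLimit

variable {d : ℕ}

lemma isCompact_closedCube (d : ℕ) : IsCompact (closedCube d) := by
  have h : IsCompact (Set.pi Set.univ fun _ : Fin d => Set.Icc (0:ℝ) 1) :=
    isCompact_univ_pi fun _ => isCompact_Icc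
  have e : closedCube d = (EuclideanSpace.equiv (Fin d) ℝ).symm ''
      (Set.pi Set.univ fun _ : Fin d => Set.Icc (0:ℝ) 1) := by
    ext t
    constructor
    · intro ht
      exact ⟨EuclideanSpace.equiv (Fin d) ℝ t, fun i _ => ht i, by simp⟩
    · rintro ⟨s, hs, rfl⟩ i
      exact hs i trivial
  rw [e]
  exact h.image (ContinuousLinearEquiv.continuous _)

lemma continuous_measureFourier (ν : Measure (EuclideanSpace ℝ (Fin d))) [IsFiniteMeasure ν] :
    Continuous (measureFourier ν) := by
  refine continuous_of_dominated (bound := fun _ => 1) (fun x => by fun_prop)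
    (fun x => ae_of_all _ fun t => ?_) (integrable_const 1) (ae_of_all _ fun t => by fun_prop)
  rw [Complex.norm_exp]
  simp

lemma Measure.ext_of_measureFourier_eq {ν ν' : Measure (EuclideanSpace ℝ (Fin d))}
    [IsFiniteMeasure ν] [IsFiniteMeasure ν'] (h : measureFourier ν = measureFourier ν') :
    ν = ν' := by
  have key : ∀ (ρ : Measure (EuclideanSpace ℝ (Fin d))) (t : EuclideanSpace ℝ (Fin d)),
      charFun ρ t = measureFourier ρ (-(2 * Real.pi)⁻¹ • t) := by
    intro ρ t
    rw [charFun_apply, measureFourier]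
    refine integral_congr_ae (ae_of_all _ fun x => ?_)
    have hpi : (Real.pi : ℂ) ≠ 0 := by exact_mod_cast Real.pi_ne_zero
    simp only
    congr 1
    rw [real_inner_comm, inner_smul_left]
    push_cast
    simp only [conj_trivial, Complex.ofReal_neg, Complex.ofReal_inv, Complex.ofReal_mul,
      Complex.ofReal_ofNat]
    field_simp
  refine Measure.ext_of_charFun (funext fun t => ?_)
  rw [key, key, h]

/-- Measures of bounded mass carried by a compact set form a compact family, so only uniqueness of
the cluster point is at stake. Two cluster points have Fourier transforms that agree on a dense set,
hence everywhere by continuity. -/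
lemma exists_tendsto_of_planeWave {μs : ℕ → FiniteMeasure (EuclideanSpace ℝ (Fin d))}
    {K : Set (EuclideanSpace ℝ (Fin d))} (hK : IsCompact K) (hμK : ∀ m, μs m Kᶜ = 0)
    {D : Set (EuclideanSpace ℝ (Fin d))} (hD : Dense D)
    (hmass : ∃ l : ℝ, Tendsto (fun m =>
      ∫ _, (1:ℝ) ∂(μs m : Measure (EuclideanSpace ℝ (Fin d)))) atTop (𝓝 l))
    (hlim : ∀ ξ ∈ D, ∀ s : Bool, ∃ l : ℝ, Tendsto (fun m => ∫ t, planeWave ξ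
      (if s then 0 else -(Real.pi / 2)) t ∂(μs m : Measure (EuclideanSpace ℝ (Fin d))))
      atTop (𝓝 l)) :
    ∃ ν : FiniteMeasure (EuclideanSpace ℝ (Fin d)), Tendsto μs atTop (𝓝 ν) := by
  obtain ⟨l, hl⟩ := hmass
  obtain ⟨B, hB⟩ := hl.bddAbove_range
  have hBm : ∀ m, (μs m).mass ≤ B.toNNReal := by
    intro m
    have h1 := hB ⟨m, rfl⟩
    simp only [integral_const, smul_eq_mul, mul_one] at h1
    rw [← NNReal.coe_le_coe]
    exact le_trans h1 (Real.le_coe_toNNReal B)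
  have hS := isCompact_setOfPred_finiteMeasure_le_of_isCompact B.toNNReal hK
  set S := {μ : FiniteMeasure (EuclideanSpace ℝ (Fin d)) | μ.mass ≤ B.toNNReal ∧ μ Kᶜ = 0}
  have hmem : ∀ m, μs m ∈ S := fun m => ⟨hBm m, hμK m⟩
  have hmap : S ∈ map μs atTop := mem_map.2 (univ_mem' hmem)
  obtain ⟨ν, hνS, hν⟩ := hS (f := map μs atTop) (le_principal_iff.2 hmap)
  refine ⟨ν, hS.le_nhds_of_unique_clusterPt hmap fun (ν' : FiniteMeasure _) _ hν' => ?_⟩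
  have hint : ∀ ξ ∈ D, ∀ s : Bool, ∫ t, planeWave ξ (if s then 0 else -(Real.pi / 2)) t
      ∂(ν' : Measure (EuclideanSpace ℝ (Fin d))) =
      ∫ t, planeWave ξ (if s then 0 else -(Real.pi / 2)) t
      ∂(ν : Measure (EuclideanSpace ℝ (Fin d))) := by
    intro ξ hξ s
    obtain ⟨l, hl⟩ := hlim ξ hξ s
    set φ : ℝ := if s then 0 else -(Real.pi / 2)
    have hcont : Continuous fun ρ : FiniteMeasure (EuclideanSpace ℝ (Fin d)) =>
        ∫ t, planeWave ξ φ t ∂(ρ : Measure (EuclideanSpace ℝ (Fin d))) :=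
      continuous_iff_continuousAt.2 fun ρ =>
        (FiniteMeasure.tendsto_iff_forall_integral_tendsto.1 tendsto_id)
          (BoundedContinuousFunction.ofNormedAddCommGroup (planeWave ξ φ)
            (continuous_planeWave _ _) 1 (abs_planeWave_le _ _))
    have hval : ∀ ρ, ClusterPt ρ (map μs atTop) →
        ∫ t, planeWave ξ φ t ∂(ρ : Measure (EuclideanSpace ℝ (Fin d))) = l := fun ρ hρ => by
      have h1 : MapClusterPt ρ atTop μs := hρ
      have h2 := h1.continuousAt_comp hcont.continuousAt
      exact eq_of_nhds_neBot (h2.clusterPt.mono hl)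
    rw [hval ν' hν', hval ν hν]
  have hfour : measureFourier (ν' : Measure (EuclideanSpace ℝ (Fin d))) =
      measureFourier (ν : Measure (EuclideanSpace ℝ (Fin d))) := by
    refine Continuous.ext_on hD (continuous_measureFourier _) (continuous_measureFourier _) ?_
    intro ξ hξ
    have h1 := hint ξ hξ true
    have h2 := hint ξ hξ false
    simp only [if_true, Bool.false_eq_true, if_false] at h1 h2
    rw [measureFourier_eq, measureFourier_eq, h1, h2]
  exact FiniteMeasure.toMeasure_injective (Measure.ext_of_measureFourier_eq hfour)

/-- Closed sets form a generating π-system, and thickened indicators are bounded continuous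
functions converging to their indicators. -/
lemma measurable_of_measurable_lintegral {Ω : Type*} [MeasurableSpace Ω]
    {M : Ω → Measure (EuclideanSpace ℝ (Fin d))} [∀ ω, IsFiniteMeasure (M ω)]
    (h : ∀ f : BoundedContinuousFunction (EuclideanSpace ℝ (Fin d)) ℝ≥0,
      Measurable fun ω => ∫⁻ t, (f t : ℝ≥0∞) ∂(M ω)) : Measurable M := by
  have hclosed : ∀ F : Set (EuclideanSpace ℝ (Fin d)), IsClosed F → Measurable fun ω => M ω F := by
    intro F hF
    have hpos : ∀ n : ℕ, (0:ℝ) < 1 / (n + 1) := fun n => by positivity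
    refine measurable_of_tendsto_metrizable
      (f := fun n ω => ∫⁻ t, (thickenedIndicator (hpos n) F t : ℝ≥0∞) ∂(M ω)) (fun n => h _) ?_
    rw [tendsto_pi_nhds]
    intro ω
    exact tendsto_lintegral_thickenedIndicator_of_isClosed (M ω) hF hpos
      tendsto_one_div_add_atTop_nhds_zero_nat
  refine Measurable.measure_of_isPiSystem (S := {F | IsClosed F})
    ((BorelSpace.measurable_eq).trans borel_eq_generateFrom_isClosed) isPiSystem_isClosed
    hclosed (hclosed _ isClosed_univ)

end WeakLimit

namespace IsRegularField

variable {d : ℕ} {Ω : Type*} [mΩ : MeasurableSpace Ω] {P : Measure Ω} [IsProbabilityMeasure P]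
  {ψ : ℕ → halfOpenCube d → Ω → ℝ} {v : ℕ → ℝ} {b : ℕ} {α : ℝ}

omit [IsProbabilityMeasure P] in
lemma measurable_integral_increment (h : IsRegularField P ψ v b α) (γ : ℝ) (m : ℕ)
    {g : halfOpenCube d → ℝ} (hg : Measurable g) :
    Measurable fun ω => ∫ t, g t * increment P ψ γ m t ω ∂(cubeMeasure d) :=
  ((hg.comp measurable_fst).mul
    (h.measurable_increment γ m)).stronglyMeasurable.integral_prod_left.measurable

/-- The expected absolute increments are summable, so the telescoping series converges absolutely
almost surely. No martingale convergence theorem is involved. -/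
lemma ae_exists_tendsto_integral (h : IsRegularField P ψ v b α) (hb : 2 ≤ b) (hα : 0 < α)
    {γ : ℝ} (hγ : 0 < γ ∧ γ < √(2 * d)) {g : halfOpenCube d → ℝ} (hg : Measurable g)
    (hg1 : ∀ t, |g t| ≤ 1) :
    ∀ᵐ ω ∂P, ∃ l, Tendsto (fun m => ∫ t, g t * chaosDensity P ψ γ m t ω ∂(cubeMeasure d))
      atTop (𝓝 l) := by
  obtain ⟨j₀, C, ρ, hC, hρ0, hρ1, hmain⟩ := h.exists_lintegral_increment_le hb hα hγ
  have hfin : ∑' m, ∫⁻ ω, ‖∫ t, g t * increment P ψ γ (j₀ + m) t ω ∂(cubeMeasure d)‖ₑ ∂P ≠ ∞ := by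
    refine ne_top_of_le_ne_top (((summable_geometric_of_lt_one hρ0.le hρ1).mul_left
      (C * ρ ^ j₀)).tsum_ofReal_ne_top) (ENNReal.tsum_le_tsum fun m => ?_)
    refine (hmain (j₀ + m) (by omega) g hg hg1).trans (le_of_eq ?_)
    rw [pow_add, mul_assoc]
  have hme : ∀ m, Measurable fun ω =>
      ‖∫ t, g t * increment P ψ γ (j₀ + m) t ω ∂(cubeMeasure d)‖ₑ := fun m =>
    (h.measurable_integral_increment γ _ hg).enorm
  rw [← lintegral_tsum fun m => (hme m).aemeasurable] at hfin
  filter_upwards [ae_lt_top (Measurable.tsum hme) hfin,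
    h.ae_integrable_chaosDensity hb hα γ] with ω hω hint
  have hsum := (Summable.of_enorm hω.ne).hasSum.tendsto_sum_nat.const_add
    (∫ t, g t * chaosDensity P ψ γ j₀ t ω ∂(cubeMeasure d))
  refine ⟨_, (tendsto_add_atTop_iff_nat j₀).1 (hsum.congr fun m => ?_)⟩
  rw [integral_chaosDensity_eq_add_sum hint (Nat.le_add_left j₀ m) hg hg1,
    Finset.sum_Ico_eq_sum_range, Nat.add_sub_cancel]

lemma exists_isGMC (h : IsRegularField P ψ v b α) (hb : 2 ≤ b) (hα : 0 < α)
    {γ : ℝ} (hγ : 0 < γ ∧ γ < √(2 * d)) :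
    ∃ M : Ω → Measure (EuclideanSpace ℝ (Fin d)), IsGMC P ψ γ M := by
  have hshift : ∀ {f : EuclideanSpace ℝ (Fin d) → ℝ}, Continuous f → (∀ t, |f t| ≤ 1) →
      ∀ᵐ ω ∂P, ∃ l, Tendsto (fun m => ∫ t, f t ∂(approxGMC P ψ γ m ω)) atTop (𝓝 l) := by
    intro f hf hf1
    filter_upwards [h.ae_exists_tendsto_integral hb hα hγ
      (hf.measurable.comp measurable_subtype_coe) (fun t => hf1 t.1)] with ω ⟨l, hl⟩
    refine ⟨l, ((tendsto_add_atTop_iff_nat 1).2 hl).congr fun m => ?_⟩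
    rw [h.integral_approxGMC γ m ω hf.measurable]
    rfl
  obtain ⟨D, hDc, hDd⟩ := TopologicalSpace.exists_countable_dense (EuclideanSpace ℝ (Fin d))
  have hgood : ∀ᵐ ω ∂P, ∃ ν : Measure (EuclideanSpace ℝ (Fin d)), IsFiniteMeasure ν ∧
      ∀ f : BoundedContinuousFunction (EuclideanSpace ℝ (Fin d)) ℝ≥0,
        Tendsto (fun m => ∫⁻ t, (f t : ℝ≥0∞) ∂(approxGMC P ψ γ m ω)) atTop
          (𝓝 (∫⁻ t, (f t : ℝ≥0∞) ∂ν)) := by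
    have h1 := hshift (f := fun _ => 1) continuous_const (by simp)
    have h2 : ∀ᵐ ω ∂P, ∀ ξ ∈ D, ∀ s : Bool, ∃ l, Tendsto (fun m => ∫ t, planeWave ξ
        (if s then 0 else -(Real.pi / 2)) t ∂(approxGMC P ψ γ m ω)) atTop (𝓝 l) :=
      (ae_ball_iff hDc).2 fun ξ _ => ae_all_iff.2 fun s =>
        hshift (continuous_planeWave _ _) (abs_planeWave_le _ _)
    filter_upwards [h1, h2, h.ae_integrable_chaosDensity hb hα γ] with ω hω1 hω2 hint
    have := fun m => isFiniteMeasure_approxGMC (hint (m + 1))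
    let μs : ℕ → FiniteMeasure (EuclideanSpace ℝ (Fin d)) := fun m => ⟨approxGMC P ψ γ m ω, this m⟩
    have hcarry : ∀ m, μs m (closedCube d)ᶜ = 0 := fun m => by
      rw [FiniteMeasure.null_iff_toMeasure_null]
      refine measure_mono_null (Set.compl_subset_compl.2 fun t ht i => ?_)
        (ae_mem_halfOpenCube_approxGMC (P := P) (ψ := ψ) γ m ω)
      exact Set.Ico_subset_Icc_self (ht i)
    obtain ⟨ν, hν⟩ := exists_tendsto_of_planeWave (μs := μs) (isCompact_closedCube d) hcarry hDd
      hω1 hω2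
    exact ⟨ν, inferInstance, FiniteMeasure.tendsto_iff_forall_lintegral_tendsto.1 hν⟩
  -- The set where no limit exists need not be measurable. It is enclosed in a measurable null set,
  -- on which M is set to zero so that M is measurable.
  obtain ⟨N, hN, hNm, hN0⟩ := exists_measurable_superset_of_null hgood
  have hNgood : ∀ ω, ω ∉ N → ∃ ν : Measure (EuclideanSpace ℝ (Fin d)), IsFiniteMeasure ν ∧
      ∀ f : BoundedContinuousFunction (EuclideanSpace ℝ (Fin d)) ℝ≥0,
        Tendsto (fun m => ∫⁻ t, (f t : ℝ≥0∞) ∂(approxGMC P ψ γ m ω)) atTop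
          (𝓝 (∫⁻ t, (f t : ℝ≥0∞) ∂ν)) := fun ω hω => by
    by_contra hcon
    exact hω (hN hcon)
  have hae : ∀ᵐ ω ∂P, ω ∉ N := measure_eq_zero_iff_ae_notMem.1 hN0
  classical
  choose! M₀ hM₀f hM₀ using hNgood
  let M : Ω → Measure (EuclideanSpace ℝ (Fin d)) := fun ω => if ω ∈ N then 0 else M₀ ω
  have hMN : ∀ ω, ω ∉ N → M ω = M₀ ω := fun ω hω => if_neg hω
  have hMfin : ∀ ω, IsFiniteMeasure (M ω) := fun ω => by
    by_cases hω : ω ∈ N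
    · have : M ω = 0 := if_pos hω
      rw [this]; infer_instance
    · rw [hMN ω hω]; exact hM₀f ω hω
  refine ⟨M, measurable_of_measurable_lintegral fun f => ?_, ae_of_all _ hMfin, ?_⟩
  · refine measurable_of_tendsto_metrizable
      (f := fun m => Nᶜ.indicator fun ω => ∫⁻ t, (f t : ℝ≥0∞) ∂(approxGMC P ψ γ m ω))
      (fun m => Measurable.indicator ?_ hNm.compl) ?_
    · have hf : Measurable fun t => (f t : ℝ≥0∞) := f.continuous.measurable.coe_nnreal_ennreal
      simp_rw [h.lintegral_approxGMC γ m _ hf]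
      refine Measurable.lintegral_prod_left' (f := fun p : halfOpenCube d × Ω =>
        ENNReal.ofReal (chaosDensity P ψ γ (m + 1) p.1 p.2) * (f p.1.1 : ℝ≥0∞)) ?_
      exact (h.measurable_chaosDensity γ (m + 1)).ennreal_ofReal.mul
        (hf.comp (measurable_subtype_coe.comp measurable_fst))
    · rw [tendsto_pi_nhds]
      intro ω
      by_cases hω : ω ∈ N
      · have : M ω = 0 := if_pos hω
        simp [this, hω]
      · simp only [Set.indicator_of_mem (Set.mem_compl hω), hMN ω hω]
        exact hM₀ ω hω f
  · filter_upwards [hae] with ω hω f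
    rw [hMN ω hω]
    exact hM₀ ω hω f

end IsRegularField

/-! ### The total mass is almost surely positive -/

/-- Fatou makes the lower limit of H finite almost surely, so H stays below some c at infinitely
many indices. There F is at most L·G plus c/L. Let G tend to zero and then L to infinity. Since F
has a limit, infinitely many indices decide it. -/
lemma ae_tendsto_zero_of_le_add {Ω : Type*} [MeasurableSpace Ω] {P : Measure Ω}
    {F G H : ℕ → Ω → ℝ≥0∞} (hH : ∀ m, Measurable (H m)) {K : ℝ≥0∞} (hK : K ≠ ∞)
    (hHK : ∀ᶠ m in atTop, ∫⁻ ω, H m ω ∂P ≤ K)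
    (hFG : ∀ᶠ m in atTop, ∀ (L : ℕ) ω, 1 ≤ L → F m ω ≤ L * G m ω + (L : ℝ≥0∞)⁻¹ * H m ω)
    (hF : ∀ᵐ ω ∂P, ∃ x, Tendsto (fun m => F m ω) atTop (𝓝 x)) :
    ∀ᵐ ω ∂P, Tendsto (fun m => G m ω) atTop (𝓝 0) → Tendsto (fun m => F m ω) atTop (𝓝 0) := by
  have h1 : ∫⁻ ω, liminf (fun m => H m ω) atTop ∂P ≤ K := by
    refine (lintegral_liminf_le hH).trans ?_
    exact liminf_le_of_frequently_le' hHK.frequently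
  filter_upwards [hF, ae_lt_top (Measurable.liminf hH) (ne_top_of_le_ne_top hK h1)] with
    ω ⟨x, hx⟩ hω hG
  obtain ⟨c, hc1, hc2⟩ := exists_between hω
  have hfreq := frequently_lt_of_liminf_lt (by isBoundedDefault) hc1
  have hle : ∀ L : ℕ, 1 ≤ L → x ≤ (L : ℝ≥0∞)⁻¹ * (c + 1) := by
    intro L hL
    have hL0 : (L : ℝ≥0∞) ≠ 0 := by exact_mod_cast (by omega : L ≠ 0)
    have hLt : (L : ℝ≥0∞) ≠ ∞ := ENNReal.natCast_ne_top L
    have h2 : Tendsto (fun m => (L : ℝ≥0∞) * G m ω) atTop (𝓝 0) := by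
      have := ENNReal.Tendsto.const_mul hG (Or.inr hLt)
      rwa [mul_zero] at this
    have h3 : ∀ᶠ m in atTop, (L : ℝ≥0∞) * G m ω ≤ (L : ℝ≥0∞)⁻¹ :=
      (h2.eventually (gt_mem_nhds (ENNReal.inv_pos.2 hLt))).mono fun m hm => le_of_lt hm
    refine le_of_tendsto_of_frequently hx ((hfreq.and_eventually (h3.and hFG)).mono ?_)
    rintro m ⟨hm1, hm2, hm3⟩
    calc F m ω ≤ L * G m ω + (L : ℝ≥0∞)⁻¹ * H m ω := hm3 L ω hL
      _ ≤ (L : ℝ≥0∞)⁻¹ + (L : ℝ≥0∞)⁻¹ * c := by gcongr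
      _ = _ := by ring
  have h4 : Tendsto (fun L : ℕ => (L : ℝ≥0∞)⁻¹ * (c + 1)) atTop (𝓝 0) := by
    have := ENNReal.Tendsto.mul_const ENNReal.tendsto_inv_nat_nhds_zero
      (b := c + 1) (Or.inr (by simp [hc2.ne]))
    rwa [zero_mul] at this
  have hx0 : x ≤ 0 := ge_of_tendsto h4 ((eventually_ge_atTop 1).mono hle)
  rwa [nonpos_iff_eq_zero.1 hx0] at hx

namespace IsRegularField

variable {d : ℕ} {Ω : Type*} [mΩ : MeasurableSpace Ω] {P : Measure Ω} [IsProbabilityMeasure P]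
  {ψ : ℕ → halfOpenCube d → Ω → ℝ} {v : ℕ → ℝ} {b : ℕ} {α : ℝ}

lemma _root_.le_mul_div_add_inv_mul {x y l : ℝ} (hx : 0 < x) (hy : 0 < y) (hl : 0 < l) :
    x ≤ l * (x / y) + l⁻¹ * (x * y) := by
  have h1 : l * (x / y) + l⁻¹ * (x * y) - x = x * ((l - y) ^ 2 + l * y) / (l * y) := by
    field_simp
    ring
  have h2 : 0 ≤ x * ((l - y) ^ 2 + l * y) / (l * y) := by positivity
  linarith

/-- The total mass of the chaos density of level `m`. -/
noncomputable def totalMass (P : Measure Ω) (ψ : ℕ → halfOpenCube d → Ω → ℝ) (γ : ℝ) (m : ℕ)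
    (ω : Ω) : ℝ≥0∞ :=
  ∫⁻ t, ENNReal.ofReal (chaosDensity P ψ γ m t ω) ∂(cubeMeasure d)

lemma lintegral_chaosDensity (h : IsRegularField P ψ v b α) (γ : ℝ) (m : ℕ) (t : halfOpenCube d) :
    ∫⁻ ω, ENNReal.ofReal (chaosDensity P ψ γ m t ω) ∂P = 1 := by
  simpa using h.lintegral_chaosDensity_rpow γ m t 1

lemma lintegral_totalMass (h : IsRegularField P ψ v b α) (γ : ℝ) (m : ℕ) :
    ∫⁻ ω, totalMass P ψ γ m ω ∂P = 1 := by
  unfold totalMass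
  rw [lintegral_lintegral_swap (f := fun ω t => ENNReal.ofReal (chaosDensity P ψ γ m t ω))
    ((h.measurable_chaosDensity γ m).ennreal_ofReal.comp measurable_swap).aemeasurable]
  simp [h.lintegral_chaosDensity γ m]

omit [IsProbabilityMeasure P] in
lemma totalMass_eq (h : IsRegularField P ψ v b α) {γ : ℝ} {m : ℕ} {ω : Ω}
    (hω : Integrable (fun t => chaosDensity P ψ γ m t ω) (cubeMeasure d)) :
    totalMass P ψ γ m ω = ENNReal.ofReal (∫ t, chaosDensity P ψ γ m t ω ∂(cubeMeasure d)) :=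
  (ofReal_integral_eq_lintegral_ofReal hω
    (ae_of_all _ fun t => h.chaosDensity_nonneg γ m t ω)).symm

lemma ae_exists_tendsto_totalMass (h : IsRegularField P ψ v b α) (hb : 2 ≤ b) (hα : 0 < α)
    {γ : ℝ} (hγ : 0 < γ ∧ γ < √(2 * d)) :
    ∀ᵐ ω ∂P, ∃ x, Tendsto (fun m => totalMass P ψ γ m ω) atTop (𝓝 x) := by
  filter_upwards [h.ae_integrable_chaosDensity hb hα γ, h.ae_exists_tendsto_integral hb hα hγ
    (g := fun _ => 1) measurable_const (by simp)] with ω hint ⟨l, hl⟩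
  simp only [one_mul] at hl
  refine ⟨ENNReal.ofReal l, ?_⟩
  simp_rw [h.totalMass_eq (hint _)]
  exact ENNReal.tendsto_ofReal hl

/-- If the masses tended to zero, the mass at level M would be bounded by the sum of the later
absolute increments. Taking expectations gives 1 ≤ Cρ^M/(1 − ρ), false for large M. -/
lemma not_ae_tendsto_totalMass_zero (h : IsRegularField P ψ v b α) (hb : 2 ≤ b) (hα : 0 < α)
    {γ : ℝ} (hγ : 0 < γ ∧ γ < √(2 * d)) :
    ¬ ∀ᵐ ω ∂P, Tendsto (fun m => totalMass P ψ γ m ω) atTop (𝓝 0) := by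
  intro hzero
  obtain ⟨j₀, C, ρ, hC, hρ0, hρ1, hmain⟩ := h.exists_lintegral_increment_le hb hα hγ
  have hlim : Tendsto (fun M : ℕ => C * (1 - ρ)⁻¹ * ρ ^ M) atTop (𝓝 0) := by
    have := (tendsto_pow_atTop_nhds_zero_of_lt_one hρ0.le hρ1).const_mul (C * (1 - ρ)⁻¹)
    rwa [mul_zero] at this
  obtain ⟨M, hM, hMj⟩ := ((hlim.eventually (gt_mem_nhds one_pos)).and
    (eventually_ge_atTop j₀)).exists
  have hbound : ∀ᵐ ω ∂P, totalMass P ψ γ M ω ≤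
      ∑' k, ‖∫ t, 1 * increment P ψ γ (M + k) t ω ∂(cubeMeasure d)‖ₑ := by
    filter_upwards [hzero, h.ae_integrable_chaosDensity hb hα γ] with ω hω hint
    have hN : ∀ k, totalMass P ψ γ M ω ≤ totalMass P ψ γ (M + k) ω +
        ∑' k, ‖∫ t, 1 * increment P ψ γ (M + k) t ω ∂(cubeMeasure d)‖ₑ := by
      intro k
      have e := integral_chaosDensity_eq_add_sum hint (Nat.le_add_right M k)
        (g := fun _ => 1) measurable_const (by simp)
      rw [Finset.sum_Ico_eq_sum_range, Nat.add_sub_cancel_left] at e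
      simp only [one_mul] at e ⊢
      have hnn : ∀ m, 0 ≤ ∫ t, chaosDensity P ψ γ m t ω ∂(cubeMeasure d) := fun m =>
        integral_nonneg fun t => h.chaosDensity_nonneg γ m t ω
      have e2 : totalMass P ψ γ M ω =
          ‖∫ t, chaosDensity P ψ γ (M + k) t ω ∂(cubeMeasure d) -
            ∑ i ∈ Finset.range k, ∫ t, increment P ψ γ (M + i) t ω ∂(cubeMeasure d)‖ₑ := by
        rw [e, add_sub_cancel_right, Real.enorm_of_nonneg (hnn M), h.totalMass_eq (hint M)]
      rw [e2, h.totalMass_eq (hint (M + k)), ← Real.enorm_of_nonneg (hnn (M + k))]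
      refine (enorm_sub_le).trans (add_le_add le_rfl ?_)
      exact (enorm_sum_le _ _).trans (ENNReal.sum_le_tsum _)
    have hlim2 : Tendsto (fun k => totalMass P ψ γ (M + k) ω +
        ∑' k, ‖∫ t, 1 * increment P ψ γ (M + k) t ω ∂(cubeMeasure d)‖ₑ) atTop
        (𝓝 (0 + ∑' k, ‖∫ t, 1 * increment P ψ γ (M + k) t ω ∂(cubeMeasure d)‖ₑ)) := by
      refine Tendsto.add ?_ tendsto_const_nhds
      have := (tendsto_add_atTop_iff_nat M).2 hω
      simpa only [add_comm M] using this
    rw [zero_add] at hlim2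
    exact ge_of_tendsto' hlim2 hN
  have hle := lintegral_mono_ae hbound
  rw [h.lintegral_totalMass, lintegral_tsum fun k =>
    (h.measurable_integral_increment γ _ measurable_const).enorm.aemeasurable] at hle
  have hsum : ∑' k, ∫⁻ ω, ‖∫ t, 1 * increment P ψ γ (M + k) t ω ∂(cubeMeasure d)‖ₑ ∂P ≤
      ENNReal.ofReal (C * (1 - ρ)⁻¹ * ρ ^ M) := by
    have hs := (summable_geometric_of_lt_one hρ0.le hρ1).mul_left (C * ρ ^ M)
    have e : C * (1 - ρ)⁻¹ * ρ ^ M = ∑' k, C * ρ ^ M * ρ ^ k := by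
      rw [tsum_mul_left, tsum_geometric_of_lt_one hρ0.le hρ1]; ring
    rw [e, ENNReal.ofReal_tsum_of_nonneg (fun k => by positivity) hs]
    refine ENNReal.tsum_le_tsum fun k => ?_
    refine (hmain (M + k) (by omega) (fun _ => 1) measurable_const (by simp)).trans (le_of_eq ?_)
    rw [pow_add, mul_assoc]
  have := hle.trans hsum
  rw [← not_lt] at this
  exact this ((ENNReal.ofReal_lt_one).2 hM)

/-! ### Insensitivity of the vanishing of the mass to finitely many levels -/

/-- The field obtained by removing the levels below `n`. -/
def dropBelow (n : ℕ) (ψ : ℕ → halfOpenCube d → Ω → ℝ) : ℕ → halfOpenCube d → Ω → ℝ :=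
  fun j t ω => if j < n then 0 else ψ j t ω

omit [IsProbabilityMeasure P] in
lemma chaosDensity_dropBelow (γ : ℝ) (n m : ℕ) (t : halfOpenCube d) (ω : Ω) :
    chaosDensity P (dropBelow n ψ) γ m t ω =
      ∏ j ∈ (Finset.range m).filter (fun j => ¬ j < n), expProcess P ψ γ j t ω := by
  rw [Finset.prod_filter, chaosDensity]
  refine Finset.prod_congr rfl fun j _ => ?_
  by_cases hj : j < n
  · simp [expProcess, dropBelow, hj]
  · simp [expProcess, dropBelow, hj]

omit [IsProbabilityMeasure P] in
lemma chaosDensity_eq_mul_dropBelow (γ : ℝ) {n m : ℕ} (hnm : n ≤ m) (t : halfOpenCube d) (ω : Ω) :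
    chaosDensity P ψ γ m t ω =
      chaosDensity P ψ γ n t ω * chaosDensity P (dropBelow n ψ) γ m t ω := by
  rw [chaosDensity_dropBelow, chaosDensity, chaosDensity,
    ← Finset.prod_filter_mul_prod_filter_not (Finset.range m) (fun j => j < n)]
  congr 2
  ext j
  simp only [Finset.mem_filter, Finset.mem_range]
  omega

/-- The levels below n and the remaining ones are independent and the latter have mean one, so the
value is free of m. This is the uniform bound that Fatou needs. -/
lemma lintegral_chaosDensity_rpow_mul_dropBelow (h : IsRegularField P ψ v b α) (γ : ℝ)
    (n m : ℕ) (t : halfOpenCube d) (a : ℝ) :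
    ∫⁻ ω, ENNReal.ofReal (chaosDensity P ψ γ n t ω ^ a) *
      ENNReal.ofReal (chaosDensity P (dropBelow n ψ) γ m t ω) ∂P =
      ENNReal.ofReal (Real.exp (γ ^ 2 / 2 * (a ^ 2 - a) * ∑ j ∈ Finset.range n, v j)) := by
  have hdisj : Disjoint (Finset.range n) ((Finset.range m).filter fun j => ¬ j < n) := by
    rw [Finset.disjoint_left]
    intro j hj hj'
    exact (Finset.mem_filter.1 hj').2 (Finset.mem_range.1 hj)
  have i1 := h.indep.indepFun_finset _ _ hdisj fun j => h.measurable_path j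
  have e1 : ∀ ω, chaosDensity P ψ γ n t ω = ∏ j : Finset.range n,
      Real.exp (γ * ψ j t ω - γ ^ 2 / 2 * v j) := fun ω => by
    rw [chaosDensity, ← Finset.prod_coe_sort]
    exact Finset.prod_congr rfl fun j _ => h.expFactor_eq γ j t ω
  have e2 : ∀ ω, chaosDensity P (dropBelow n ψ) γ m t ω =
      ∏ j : (Finset.range m).filter (fun j => ¬ j < n),
      Real.exp (γ * ψ j t ω - γ ^ 2 / 2 * v j) := fun ω => by
    rw [chaosDensity_dropBelow, ← Finset.prod_coe_sort]
    exact Finset.prod_congr rfl fun j _ => h.expFactor_eq γ j t ω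
  have m1 : ∀ s : Finset ℕ, Measurable fun x : s → halfOpenCube d → ℝ => ∏ j : s,
      Real.exp (γ * x j t - γ ^ 2 / 2 * v j) := fun s =>
    Finset.measurable_fun_prod _ fun j _ => by fun_prop
  have i2 := i1.comp (((m1 (Finset.range n)).pow_const a).ennreal_ofReal)
    ((m1 ((Finset.range m).filter fun j => ¬ j < n)).ennreal_ofReal)
  have key := lintegral_mul_eq_lintegral_mul_lintegral_of_indepFun
    ((((m1 (Finset.range n)).pow_const a).ennreal_ofReal).comp
      (measurable_pi_lambda _ fun j : Finset.range n => h.measurable_path j))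
    (((m1 ((Finset.range m).filter fun j => ¬ j < n)).ennreal_ofReal).comp
      (measurable_pi_lambda _ fun j : (Finset.range m).filter (fun j => ¬ j < n) =>
        h.measurable_path j)) i2
  simp only [Pi.mul_apply, Function.comp_def, ← e1, ← e2] at key
  rw [key, h.lintegral_chaosDensity_rpow]
  have := (h.zeroBelow n).lintegral_chaosDensity γ m t
  change ∫⁻ ω, ENNReal.ofReal (chaosDensity P (dropBelow n ψ) γ m t ω) ∂P = 1 at this
  rw [this, mul_one]

/-- The mass of the chaos density of level `m`, with the levels below `n` weighted by a power. -/
noncomputable def weightedMass (P : Measure Ω) (ψ : ℕ → halfOpenCube d → Ω → ℝ) (γ : ℝ)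
    (n m : ℕ) (a : ℝ) (ω : Ω) : ℝ≥0∞ :=
  ∫⁻ t, ENNReal.ofReal (chaosDensity P ψ γ n t ω ^ a) *
    ENNReal.ofReal (chaosDensity P (dropBelow n ψ) γ m t ω) ∂(cubeMeasure d)

omit [IsProbabilityMeasure P] in
lemma measurable_weightedMass_integrand (h : IsRegularField P ψ v b α) (γ : ℝ) (n m : ℕ) (a : ℝ) :
    Measurable fun p : halfOpenCube d × Ω => ENNReal.ofReal (chaosDensity P ψ γ n p.1 p.2 ^ a) *
      ENNReal.ofReal (chaosDensity P (dropBelow n ψ) γ m p.1 p.2) :=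
  ((h.measurable_chaosDensity γ n).pow_const a).ennreal_ofReal.mul
    ((h.zeroBelow n).measurable_chaosDensity γ m).ennreal_ofReal

omit [IsProbabilityMeasure P] in
lemma measurable_weightedMass (h : IsRegularField P ψ v b α) (γ : ℝ) (n m : ℕ) (a : ℝ) :
    Measurable (weightedMass P ψ γ n m a) :=
  (h.measurable_weightedMass_integrand γ n m a).lintegral_prod_left'

lemma lintegral_weightedMass (h : IsRegularField P ψ v b α) (γ : ℝ) (n m : ℕ) (a : ℝ) :
    ∫⁻ ω, weightedMass P ψ γ n m a ω ∂P =
      ENNReal.ofReal (Real.exp (γ ^ 2 / 2 * (a ^ 2 - a) * ∑ j ∈ Finset.range n, v j)) := by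
  unfold weightedMass
  rw [lintegral_lintegral_swap (f := fun ω t => ENNReal.ofReal (chaosDensity P ψ γ n t ω ^ a) *
      ENNReal.ofReal (chaosDensity P (dropBelow n ψ) γ m t ω))
    ((h.measurable_weightedMass_integrand γ n m a).comp measurable_swap).aemeasurable]
  simp [h.lintegral_chaosDensity_rpow_mul_dropBelow γ n m]

omit [IsProbabilityMeasure P] in
lemma chaosDensity_pos (γ : ℝ) (m : ℕ) (t : halfOpenCube d)
    (ω : Ω) : 0 < chaosDensity P ψ γ m t ω :=
  Finset.prod_pos fun _ _ => Real.exp_pos _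

omit [IsProbabilityMeasure P] in
lemma totalMass_eq_weightedMass (h : IsRegularField P ψ v b α) (γ : ℝ) {n m : ℕ} (hnm : n ≤ m)
    (ω : Ω) : totalMass P ψ γ m ω = weightedMass P ψ γ n m 1 ω := by
  refine lintegral_congr fun t => ?_
  rw [Real.rpow_one, ← ENNReal.ofReal_mul (h.chaosDensity_nonneg γ n t ω),
    chaosDensity_eq_mul_dropBelow γ hnm]

omit [IsProbabilityMeasure P] in
lemma totalMass_dropBelow_eq_weightedMass (γ : ℝ) (n m : ℕ) (ω : Ω) :
    totalMass P (dropBelow n ψ) γ m ω = weightedMass P ψ γ n m 0 ω := by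
  simp [totalMass, weightedMass]

lemma _root_.ENNReal.ofReal_rpow_le_mul_add_inv_mul {x : ℝ} (hx : 0 < x) (a s : ℝ) {L : ℕ}
    (hL : 1 ≤ L) : ENNReal.ofReal (x ^ a) ≤
      L * ENNReal.ofReal (x ^ (a - s)) + (L : ℝ≥0∞)⁻¹ * ENNReal.ofReal (x ^ (a + s)) := by
  have hL0 : (0:ℝ) < L := by exact_mod_cast hL
  have hs : 0 < x ^ s := by positivity
  have ha : 0 < x ^ a := by positivity
  rw [← ENNReal.ofReal_natCast L, ← ENNReal.ofReal_inv_of_pos hL0, ← ENNReal.ofReal_mul hL0.le,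
    ← ENNReal.ofReal_mul (inv_pos.2 hL0).le, ← ENNReal.ofReal_add (by positivity) (by positivity),
    Real.rpow_sub hx, Real.rpow_add hx]
  exact ENNReal.ofReal_le_ofReal (le_mul_div_add_inv_mul ha hs hL0)

omit [IsProbabilityMeasure P] in
lemma weightedMass_le (h : IsRegularField P ψ v b α) (γ : ℝ) (n m : ℕ) (a s : ℝ)
    {L : ℕ} (hL : 1 ≤ L) (ω : Ω) :
    weightedMass P ψ γ n m a ω ≤
      L * weightedMass P ψ γ n m (a - s) ω + (L : ℝ≥0∞)⁻¹ * weightedMass P ψ γ n m (a + s) ω := by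
  have hmeas : ∀ a : ℝ, Measurable fun t => ENNReal.ofReal (chaosDensity P ψ γ n t ω ^ a) *
      ENNReal.ofReal (chaosDensity P (dropBelow n ψ) γ m t ω) := fun a =>
    ((h.measurable_chaosDensity_left γ n ω).pow_const a).ennreal_ofReal.mul
      ((h.zeroBelow n).measurable_chaosDensity_left γ m ω).ennreal_ofReal
  have hle : ∀ t, ENNReal.ofReal (chaosDensity P ψ γ n t ω ^ a) *
      ENNReal.ofReal (chaosDensity P (dropBelow n ψ) γ m t ω) ≤
      L * (ENNReal.ofReal (chaosDensity P ψ γ n t ω ^ (a - s)) *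
        ENNReal.ofReal (chaosDensity P (dropBelow n ψ) γ m t ω)) +
      (L : ℝ≥0∞)⁻¹ * (ENNReal.ofReal (chaosDensity P ψ γ n t ω ^ (a + s)) *
        ENNReal.ofReal (chaosDensity P (dropBelow n ψ) γ m t ω)) := fun t => by
    rw [← mul_assoc, ← mul_assoc, ← add_mul]
    gcongr
    exact ENNReal.ofReal_rpow_le_mul_add_inv_mul (chaosDensity_pos γ n t ω) a s hL
  refine (lintegral_mono hle).trans (le_of_eq ?_)
  exact (lintegral_add_left ((hmeas (a - s)).const_mul _) _).trans
    (congrArg₂ (· + ·) (lintegral_const_mul _ (hmeas (a - s)))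
      (lintegral_const_mul _ (hmeas (a + s))))

/-- Sample paths are not assumed bounded, so the density of the first n levels cannot be bounded
above or below on the cube. Instead the weighted masses are interpolated: exponent 1 between 0 and 2
for one direction, exponent 0 between 1 and −1 for the other, where the moments of orders 2 and −1
are bounded in m. -/
lemma ae_tendsto_totalMass_zero_iff (h : IsRegularField P ψ v b α) (hb : 2 ≤ b) (hα : 0 < α)
    {γ : ℝ} (hγ : 0 < γ ∧ γ < √(2 * d)) (n : ℕ) :
    ∀ᵐ ω ∂P, Tendsto (fun m => totalMass P ψ γ m ω) atTop (𝓝 0) ↔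
      Tendsto (fun m => totalMass P (dropBelow n ψ) γ m ω) atTop (𝓝 0) := by
  have h1 := ae_tendsto_zero_of_le_add (P := P) (F := totalMass P ψ γ)
    (G := totalMass P (dropBelow n ψ) γ) (H := fun m => weightedMass P ψ γ n m (1 + 1))
    (fun m => h.measurable_weightedMass γ n m _) ENNReal.ofReal_ne_top
    (Eventually.of_forall fun m => (h.lintegral_weightedMass γ n m _).le)
    (by
      filter_upwards [eventually_ge_atTop n] with m hm L ω hL
      rw [h.totalMass_eq_weightedMass γ hm, totalMass_dropBelow_eq_weightedMass]
      have := h.weightedMass_le γ n m 1 1 hL ω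
      rwa [sub_self] at this)
    (h.ae_exists_tendsto_totalMass hb hα hγ)
  have h2 := ae_tendsto_zero_of_le_add (P := P) (F := totalMass P (dropBelow n ψ) γ)
    (G := totalMass P ψ γ) (H := fun m => weightedMass P ψ γ n m (0 + -1))
    (fun m => h.measurable_weightedMass γ n m _) ENNReal.ofReal_ne_top
    (Eventually.of_forall fun m => (h.lintegral_weightedMass γ n m _).le)
    (by
      filter_upwards [eventually_ge_atTop n] with m hm L ω hL
      rw [h.totalMass_eq_weightedMass γ hm, totalMass_dropBelow_eq_weightedMass]
      have := h.weightedMass_le γ n m 0 (-1) hL ω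
      rwa [zero_sub, neg_neg] at this)
    ((h.zeroBelow n).ae_exists_tendsto_totalMass hb hα hγ)
  filter_upwards [h1, h2] with ω a1 a2 using ⟨a2, a1⟩

end IsRegularField

/-! ### The zero-one law for the vanishing of the total mass -/

namespace IsRegularField

variable {d : ℕ} {Ω : Type*} [mΩ : MeasurableSpace Ω] {P : Measure Ω} [IsProbabilityMeasure P]
  {ψ : ℕ → halfOpenCube d → Ω → ℝ} {v : ℕ → ℝ} {b : ℕ} {α : ℝ}

/-- The σ-algebra generated by the `j`-th process. -/
abbrev pathSigma (ψ : ℕ → halfOpenCube d → Ω → ℝ) (j : ℕ) : MeasurableSpace Ω :=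
  MeasurableSpace.comap (fun (ω : Ω) (t : halfOpenCube d) => ψ j t ω) inferInstance

/-- The σ-algebra generated by the processes from level `n` on. -/
abbrev futureSigma (ψ : ℕ → halfOpenCube d → Ω → ℝ) (n : ℕ) : MeasurableSpace Ω :=
  ⨆ j ≥ n, pathSigma ψ j

omit [IsProbabilityMeasure P] in
lemma pathSigma_le (h : IsRegularField P ψ v b α) (j : ℕ) : pathSigma ψ j ≤ mΩ :=
  (h.measurable_path j).comap_le

/-- Joint measurability of the fields concerns the full σ-algebra, so the truncated mass agrees only
almost everywhere with a variable measurable for the future. The event is accordingly represented up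
to a null set. -/
lemma exists_measurableSet_future (h : IsRegularField P ψ v b α) (hb : 2 ≤ b) (hα : 0 < α)
    (γ : ℝ) (n : ℕ) :
    ∃ B : Set Ω, MeasurableSet[futureSigma ψ n] B ∧ ∀ᵐ ω ∂P,
      Tendsto (fun m => totalMass P (dropBelow n ψ) γ m ω) atTop (𝓝 0) ↔ ω ∈ B := by
  have hG : futureSigma ψ n ≤ mΩ := iSup₂_le fun j _ => h.pathSigma_le j
  have h' : IsRegularField P (dropBelow n ψ) _ b α := h.zeroBelow n
  have hmeas : ∀ m, AEStronglyMeasurable[futureSigma ψ n]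
      (fun ω => ∫ t, chaosDensity P (dropBelow n ψ) γ m t ω ∂(cubeMeasure d)) P := by
    intro m
    obtain ⟨C, _, hC, _⟩ := h'.eLpNorm_chaosDensity_le hb hα γ m (n := 2) (by norm_num) 1
    have hL := memLp_uncurry_of_eLpNorm_le (P := P) (ν := cubeMeasure d)
      (G := chaosDensity P (dropBelow n ψ) γ m) (h'.measurable_chaosDensity γ m)
      (n := 2) (by norm_num) ENNReal.ofReal_ne_top (ae_of_all _ hC)
    refine aestronglyMeasurable_integral_of_forall hG (hL.integrable (by norm_num))
      (ae_of_all _ fun t => Measurable.stronglyMeasurable ?_)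
    have e : chaosDensity P (dropBelow n ψ) γ m t = fun ω =>
        ∏ j ∈ (Finset.range m).filter (fun j => ¬ j < n),
          Real.exp (γ * ψ j t ω - γ ^ 2 / 2 * v j) := funext fun ω => by
      rw [chaosDensity_dropBelow]
      exact Finset.prod_congr rfl fun j _ => h.expFactor_eq γ j t ω
    rw [e]
    refine Finset.measurable_fun_prod _ fun j hj => ?_
    have hjn : j ≥ n := not_lt.1 (Finset.mem_filter.1 hj).2
    have h1 : Measurable[pathSigma ψ j] (ψ j t) :=
      (measurable_pi_apply t).comp (comap_measurable fun (ω : Ω) (t : halfOpenCube d) => ψ j t ω)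
    have h2 : Measurable[futureSigma ψ n] (ψ j t) :=
      h1.mono (le_iSup₂ (f := fun j (_ : j ≥ n) => pathSigma ψ j) j hjn) le_rfl
    exact Real.measurable_exp.comp ((h2.const_mul γ).sub_const _)
  choose Y hY hXY using hmeas
  refine ⟨{ω | Tendsto (fun m => ENNReal.ofReal (Y m ω)) atTop (𝓝 0)},
    measurableSet_tendsto (𝓝 0) fun m => (hY m).measurable.ennreal_ofReal, ?_⟩
  filter_upwards [ae_all_iff.2 hXY, h'.ae_integrable_chaosDensity hb hα γ] with ω hω hint
  simp_rw [h'.totalMass_eq (hint _), hω]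

/-- For every n the event coincides almost surely with one determined by the levels from n on. The
upper limit of these representatives is a genuine tail event, so Kolmogorov's law applies, and
probability one has already been excluded. -/
lemma ae_not_tendsto_totalMass_zero (h : IsRegularField P ψ v b α) (hb : 2 ≤ b) (hα : 0 < α)
    {γ : ℝ} (hγ : 0 < γ ∧ γ < √(2 * d)) :
    ∀ᵐ ω ∂P, ¬ Tendsto (fun m => totalMass P ψ γ m ω) atTop (𝓝 0) := by
  choose B hBm hB using h.exists_measurableSet_future hb hα γ
  have hmem : ∀ᵐ ω ∂P, ω ∈ limsup B atTop ↔
      Tendsto (fun m => totalMass P ψ γ m ω) atTop (𝓝 0) := by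
    filter_upwards [ae_all_iff.2 hB, ae_all_iff.2 (h.ae_tendsto_totalMass_zero_iff hb hα hγ)] with
      ω h1 h2
    rw [mem_limsup_iff_frequently_mem]
    have : ∀ n, ω ∈ B n ↔ Tendsto (fun m => totalMass P ψ γ m ω) atTop (𝓝 0) := fun n =>
      (h1 n).symm.trans (h2 n).symm
    simp_rw [this]
    exact frequently_const
  have htail : MeasurableSet[limsup (pathSigma ψ) atTop] (limsup B atTop) := by
    rw [limsup_eq_iInf_iSup_of_nat, MeasurableSpace.measurableSet_iInf]
    intro k
    -- Discarding the first k sets leaves the upper limit unchanged and makes it measurable for the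
    -- levels from k on.
    rw [← limsup_nat_add B k]
    refine @MeasurableSet.measurableSet_limsup _ (futureSigma ψ k) _ fun n => ?_
    have hle : futureSigma ψ (n + k) ≤ futureSigma ψ k :=
      biSup_mono fun j hj => le_trans (Nat.le_add_left k n) hj
    exact hle _ (hBm (n + k))
  have hind : iIndep (pathSigma ψ) P := (iIndepFun_iff_iIndep _ _ _).1 h.indep
  rcases measure_zero_or_one_of_measurableSet_limsup_atTop h.pathSigma_le hind htail with h0 | h1
  · filter_upwards [hmem, measure_eq_zero_iff_ae_notMem.1 h0] with ω hω hω' hcon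
    exact hω' (hω.2 hcon)
  · refine absurd ?_ (h.not_ae_tendsto_totalMass_zero hb hα hγ)
    have hms : MeasurableSet (limsup B atTop) :=
      (limsup_le_iSup.trans (iSup_le h.pathSigma_le)) _ htail
    filter_upwards [hmem, (prob_compl_eq_zero_iff hms).2 h1] with ω hω hω'
    exact hω.1 hω'

lemma ae_ne_zero (h : IsRegularField P ψ v b α) (hb : 2 ≤ b) (hα : 0 < α)
    {γ : ℝ} (hγ : 0 < γ ∧ γ < √(2 * d)) {M : Ω → Measure (EuclideanSpace ℝ (Fin d))}
    (hM : IsGMC P ψ γ M) : ∀ᵐ ω ∂P, M ω ≠ 0 := by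
  filter_upwards [h.ae_not_tendsto_totalMass_zero hb hα hγ, hM.tendsto] with ω hω hlim h0
  refine hω ((tendsto_add_atTop_iff_nat 1).1 ?_)
  have := hlim (BoundedContinuousFunction.const _ 1)
  simp only [h0, lintegral_zero_measure] at this
  refine this.congr fun m => ?_
  rw [h.lintegral_approxGMC γ m ω (by fun_prop)]
  simp [totalMass]

end IsRegularField

/-! ### The theorem -/

theorem proposition3p5 {d : ℕ} (hd : 1 ≤ d) {α₀ : ℝ} (hα₀ : 0 < α₀ ∧ α₀ ≤ 1)
    {K : EuclideanSpace ℝ (Fin d) → ℝ} {b : ℕ} (hb : 2 ≤ b)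
    {Kj : ℕ → EuclideanSpace ℝ (Fin d) → ℝ} (hK : IsSigmaAdmissible b α₀ K Kj)
    {γ : ℝ} (hγ : 0 < γ ∧ γ < √(2 * d))
    {Ω : Type*} [MeasurableSpace Ω] {P : Measure Ω} [IsProbabilityMeasure P]
    {ψ : ℕ → halfOpenCube d → Ω → ℝ} (hψ : IsGaussianDecomposition P Kj ψ) :
    (∃ M : Ω → Measure (EuclideanSpace ℝ (Fin d)), IsGMC P ψ γ M) ∧
    (∀ M : Ω → Measure (EuclideanSpace ℝ (Fin d)), IsGMC P ψ γ M →
      0 < P {ω | M ω ≠ 0} ∧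
      ∀ᵐ ω ∂P, HasPolynomialFourierDecay (M ω) ∧
        min (2 * α₀) (gmcExponent γ d) ≤ fourierDim (M ω)) ∧
    0 < min (2 * α₀) (gmcExponent γ d) := by
  have h := hK.isRegularField hα₀ hb hψ
  have hpos : 0 < min (2 * α₀) (gmcExponent γ d) :=
    lt_min (by linarith [hα₀.1]) (gmcExponent_pos hγ)
  refine ⟨h.exists_isGMC hb hα₀.1 hγ, fun M hM => ⟨?_, ?_⟩, hpos⟩
  · have hne := h.ae_ne_zero hb hα₀.1 hγ hM
    rw [pos_iff_ne_zero]
    intro h0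
    have hfalse : ∀ᵐ _ω ∂P, False := by
      filter_upwards [hne, measure_eq_zero_iff_ae_notMem.1 h0] with ω h1 h2 using h2 h1
    exact hfalse.exists.elim fun _ h => h
  -- Decay is known strictly below the minimum, so half of it serves as the positive exponent of
  -- polynomial decay.
  · have hhalf : min (2 * α₀) (gmcExponent γ d) / 2 < min (2 * α₀) (gmcExponent γ d) :=
      half_lt_self hpos
    filter_upwards [h.ae_ne_zero hb hα₀.1 hγ hM,
      h.ae_hasFourierDecay hd hb hα₀.1 hα₀.2 hγ hM (half_pos hpos)
        (hhalf.trans_le (min_le_left _ _)) (hhalf.trans_le (min_le_right _ _)),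
      h.ae_min_le_fourierDim hd hb hα₀.1 hα₀.2 hγ hM] with ω h1 h2 h3
    exact ⟨⟨h1, _, half_pos hpos, h2⟩, h3⟩
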